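/- Let $1\le l\le n$, $\theta\in(0,\pi)$, and let $M$ be a compact smooth $n$-dimensional manifold with boundary. Write $\overline{\mathbb R}^{n+1}_+=\{x : x_{n+1}\ge 0\}$ and $e=-e_{n+1}$. Let $x:M\times[0,T)\to\overline{\mathbb R}^{n+1}_+$, $0<T\le\infty$, be a smooth family of embeddings such that, for each $t$, $x(\cdot,t)$ maps the interior of $M$ into $\{x_{n+1}>0\}$ and $\partial M$ into $\{x_{n+1}=0\}$. Put $\Sigma_t=x(M,t)$, let $\widehat{\Sigma_t}$ be the bounded region enclosed by $\Sigma_t$ and $\{x_{n+1}=0\}$, let $\widehat{\partial\Sigma_t}$ be the part of the boundary of $\widehat{\Sigma_t}$ that lies in $\{x_{n+1}=0\}\cong\mathbb R^n$, and let $\nu$ be the smooth unit normal of $\Sigma_t$ pointing out of $\widehat{\Sigma_t}$. Assume that $\Sigma_t$ has constant contact angle $\theta$, i.e. $\langle\nu,e\rangle=\cos(\pi-\theta)$ along $\partial M$, and that $$(\partial_t x)^\perp=f\nu,\qquad f=\frac{1+\cos\theta\,\langle\nu,e\rangle}{F}-\langle x,\nu\rangle,\qquad F=\frac{H_l}{H_{l-1}},$$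 where $H_k=\binom nk^{-1}\sigma_k(\kappa)$ is the normalized $k$-th mean curvature of $\Sigma_t$ with respect to $h(X,Y)=\langle D_X\nu,Y\rangle$, and $H_0=1$. Define $$\mathcal V_{1,\theta}(\widehat\Sigma)=\frac1{n+1}\Bigl(|\Sigma|-\cos\theta\,|\widehat{\partial\Sigma}|\Bigr),\qquad \mathcal V_{k+1,\theta}(\widehat\Sigma)=\frac1{n+1}\Bigl(\int_\Sigma H_k\,dA-\frac{\cos\theta\sin^k\theta}{n}\int_{\partial\Sigma}H^{\partial\Sigma}_{k-1}\,ds\Bigr)\quad(1\le k\le n-1),$$ where $H^{\partial\Sigma}_{k-1}$ is the normalized $(k-1)$-th mean curvature of $\partial\Sigma$ as a hypersurface of $\mathbb R^n$, with respect to the unit normal pointing out of $\widehat{\partial\Sigma}$. Let $J\subset[0,T)$ be an interval such that $\Sigma_t$ is strictly $l$-convex for every $t\in J$, i.e. $H_j>0$ on all of $\Sigma_t$ for $1\le j\le l$. Then $\mathcal V_{l,\theta}(\widehat{\Sigma_t})$ is constant for $t\in J$, and for every $1\le k<l$ the function $t\mapsto\mathcal V_{k,\theta}(\widehat{\Sigma_t})$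 is non-decreasing on $J$. -/

import Mathlib

open Set Topology
open scoped Manifold ContDiff

noncomputable section

namespace CapillaryFlow

/-- The ambient Euclidean space of dimension `n + 1`; the last coordinate is the height over the
supporting hyperplane. -/
abbrev Amb (n : ℕ) : Type := EuclideanSpace ℝ (Fin (n + 1))

/-- The vector `e = -e_{n+1}`; it is also the unit normal of the supporting hyperplane that points
out of the upper half-space. -/
def downVec (n : ℕ) : Amb n := -EuclideanSpace.single (Fin.last n) 1

/-! ### Symmetric functions of principal curvatures -/

section Algebra

variable {ι : Type*} [Fintype ι] [DecidableEq ι]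

/-- The eigenvalues, with multiplicity, of the bilinear form with matrix `B` relative to the inner
product with matrix `G`, i.e. the eigenvalues of the Weingarten matrix `G⁻¹ B`. -/
def relEigenvalues (G B : Matrix ι ι ℝ) : Multiset ℝ := (G⁻¹ * B).charpoly.roots

/-- The normalized elementary symmetric function `σ_k / binom(m, k)` of these `m` eigenvalues. -/
def normSym (k : ℕ) (G B : Matrix ι ι ℝ) : ℝ :=
  (relEigenvalues G B).esymm k / ((Fintype.card ι).choose k : ℝ)

end Algebra

variable {n : ℕ} [NeZero n] {M : Type*} [TopologicalSpace M] [ChartedSpace (EuclideanHalfSpace n) M]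

/-! ### First and second fundamental forms in charts -/

/-- `∂_i g` at `p`: the derivative of the vector valued function `g` in the direction of the `i`-th
coordinate of the chart of `M` centred at `c`. -/
def coordDeriv (c : M) (g : M → Amb n) (p : M) (i : Fin n) : Amb n :=
  fderivWithin ℝ (g ∘ (extChartAt (𝓡∂ n) c).symm) (range (𝓡∂ n)) (extChartAt (𝓡∂ n) c p)
    (EuclideanSpace.single i 1)

/-- The matrix `⟨∂_i g, ∂_j x⟩` at `p` in the chart centred at `c`. For `g = x` it is the induced
metric; when `g` is a unit normal field `ν` of `x` it is the second fundamental form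
`h(X, Y) = -⟨D_X Y, ν⟩ = ⟨D_X ν, Y⟩`. -/
def pairing (c : M) (g x : M → Amb n) (p : M) : Matrix (Fin n) (Fin n) ℝ :=
  Matrix.of fun i j => inner ℝ (coordDeriv c g p i) (coordDeriv c x p j)

/-- The same matrix restricted to the coordinate directions other than the `0`-th one. At a boundary
point these directions span the tangent space of `∂M`, because the charts of `M` take values in the
half-space `{u | 0 ≤ u 0}`. -/
def bdryPairing (c : M) (g x : M → Amb n) (p : M) :
    Matrix {i : Fin n // i ≠ 0} {i : Fin n // i ≠ 0} ℝ :=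
  (pairing c g x p).submatrix Subtype.val Subtype.val

/-- The normalized `k`-th mean curvature `H_k` of the hypersurface `x` with unit normal `ν`. -/
def meanCurv (k : ℕ) (x ν : M → Amb n) (p : M) : ℝ :=
  normSym k (pairing p x x p) (pairing p ν x p)

/-- The unit vector in the direction of the horizontal part of `ν`. Along the boundary of a
hypersurface that meets the supporting hyperplane transversally, it is the unit normal of `∂Σ` in
the hyperplane, on the same side of `∂Σ` as `ν` is of `Σ`. -/
def bdryNormal (ν : M → Amb n) (p : M) : Amb n :=
  (‖ν p - inner ℝ (ν p) (downVec n) • downVec n‖)⁻¹ •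
    (ν p - inner ℝ (ν p) (downVec n) • downVec n)

/-- The normalized `k`-th mean curvature of `∂Σ`, as a hypersurface of the supporting hyperplane. -/
def bdryMeanCurv (k : ℕ) (x ν : M → Amb n) (p : M) : ℝ :=
  normSym k (bdryPairing p x x p) (bdryPairing p (bdryNormal ν) x p)

/-! ### Integration over the hypersurface and over its boundary -/

section Integration

variable (n M) in
/-- A smooth partition of unity of `M`, subordinate to the domains of the charts. The surface
integrals below do not depend on which one is taken. -/
def chartPartition [IsManifold (𝓡∂ n) ∞ M] [CompactSpace M] [T2Space M] :
    SmoothPartitionOfUnity M (𝓡∂ n) M univ :=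
  (SmoothPartitionOfUnity.exists_isSubordinate_chartAt_source (𝓡∂ n) M).choose

variable (n M) in
theorem chartPartition_isSubordinate [IsManifold (𝓡∂ n) ∞ M] [CompactSpace M] [T2Space M] :
    (chartPartition n M).IsSubordinate
      fun c : M => (chartAt (EuclideanHalfSpace n) c).source :=
  (SmoothPartitionOfUnity.exists_isSubordinate_chartAt_source (𝓡∂ n) M).choose_spec

variable [IsManifold (𝓡∂ n) ∞ M] [CompactSpace M] [T2Space M]

/-- The integral `∫_Σ φ dA` with respect to the area element of the metric induced by `x`, which is
`√(det g_{ij}) du` in a chart. -/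
def surfaceIntegral (x : M → Amb n) (φ : M → ℝ) : ℝ :=
  ∑ᶠ c : M, ∫ u in (extChartAt (𝓡∂ n) c).target,
    chartPartition n M c ((extChartAt (𝓡∂ n) c).symm u) * φ ((extChartAt (𝓡∂ n) c).symm u) *
      Real.sqrt (pairing c x x ((extChartAt (𝓡∂ n) c).symm u)).det

/-- The inclusion of `ℝ^{n-1}` in `ℝ^n` as the hyperplane `{u | u 0 = 0}`. -/
def bdryIncl (v : EuclideanSpace ℝ {i : Fin n // i ≠ 0}) : EuclideanSpace ℝ (Fin n) :=
  WithLp.toLp 2 fun i => if h : i = 0 then 0 else v ⟨i, h⟩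

/-- The integral `∫_{∂Σ} φ ds` with respect to the area element of the metric induced on `∂M` by
`x` (for `n = 1`: the sum over the points of `∂M`). -/
def bdryIntegral (x : M → Amb n) (φ : M → ℝ) : ℝ :=
  ∑ᶠ c : M, ∫ v in (bdryIncl ⁻¹' (extChartAt (𝓡∂ n) c).target),
    chartPartition n M c ((extChartAt (𝓡∂ n) c).symm (bdryIncl v)) *
      φ ((extChartAt (𝓡∂ n) c).symm (bdryIncl v)) *
      Real.sqrt (bdryPairing c x x ((extChartAt (𝓡∂ n) c).symm (bdryIncl v))).det

end Integration

/-! ### The enclosed domain and the capillary quermassintegrals -/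

/-- The part of the open upper half-space that does not lie on the set `S`. -/
def offSurface (S : Set (Amb n)) : Set (Amb n) := {q | 0 < q (Fin.last n) ∧ q ∉ S}

/-- The region enclosed by `S` and the supporting hyperplane: the union of the bounded connected
components of the open upper half-space minus `S` (one component, if `S` is a connected, properly
embedded compact hypersurface). -/
def enclosed (S : Set (Amb n)) : Set (Amb n) :=
  {q | q ∈ offSurface S ∧ Bornology.IsBounded (connectedComponentIn (offSurface S) q)}

/-- The flat part of the boundary of the enclosed region, as a subset of `ℝ^n`. -/
def wetted (S : Set (Amb n)) : Set (EuclideanSpace ℝ (Fin n)) :=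
  {y | (WithLp.toLp 2 (Fin.snoc (α := fun _ => ℝ) (fun i => y i) 0) : Amb n) ∈
    frontier (enclosed S)}

/-- The capillary quermassintegral `V_{k,θ}` of the region enclosed by the hypersurface `x(M)`
with outward unit normal `ν`. -/
def quermass [IsManifold (𝓡∂ n) ∞ M] [CompactSpace M] [T2Space M]
    (θ : ℝ) (k : ℕ) (x ν : M → Amb n) : ℝ :=
  match k with
  | 0 => (MeasureTheory.volume (enclosed (range x))).toReal
  | 1 => 1 / (n + 1 : ℝ) * (surfaceIntegral x (fun _ => 1) -
      Real.cos θ * (MeasureTheory.volume (wetted (range x))).toReal)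
  | k + 2 => 1 / (n + 1 : ℝ) * (surfaceIntegral x (meanCurv (k + 1) x ν) -
      Real.cos θ * Real.sin θ ^ (k + 1) / (n : ℝ) * bdryIntegral x (bdryMeanCurv k x ν))

/-! ### Capillary hypersurfaces and the flow -/

/-- `x` is a proper smooth embedding of the compact manifold with boundary `M` in the closed upper
half-space, `ν` is its unit normal field pointing out of the enclosed region, and `x(M)` meets the
supporting hyperplane at the constant contact angle `θ`. -/
structure IsCapillary (θ : ℝ) (x ν : M → Amb n) : Prop where
  smooth : ContMDiff (𝓡∂ n) 𝓘(ℝ, Amb n) ∞ x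
  injective : Function.Injective x
  immersion : ∀ p, Function.Injective (mfderiv (𝓡∂ n) 𝓘(ℝ, Amb n) x p)
  interior_pos : ∀ p ∈ (𝓡∂ n).interior M, 0 < x p (Fin.last n)
  boundary_zero : ∀ p ∈ (𝓡∂ n).boundary M, x p (Fin.last n) = 0
  smooth_normal : ContMDiff (𝓡∂ n) 𝓘(ℝ, Amb n) ∞ ν
  unit_normal : ∀ p, ‖ν p‖ = 1
  orthogonal : ∀ p i, inner ℝ (ν p) (coordDeriv p x p i) = 0
  outward : ∀ p ∈ (𝓡∂ n).interior M, ∀ᶠ s : ℝ in 𝓝[>] 0,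
    x p - s • ν p ∈ enclosed (range x) ∧ x p + s • ν p ∉ enclosed (range x)
  contact_angle : ∀ p ∈ (𝓡∂ n).boundary M,
    inner ℝ (ν p) (downVec n) = Real.cos (Real.pi - θ)

/-- Strict `l`-convexity: `H_j > 0` everywhere for `1 ≤ j ≤ l`. -/
def StrictlyConvexOrder (l : ℕ) (x ν : M → Amb n) : Prop :=
  ∀ j, 1 ≤ j → j ≤ l → ∀ p, 0 < meanCurv j x ν p

/-- The speed `f = (1 + cos θ ⟨ν, e⟩) / F - ⟨x, ν⟩` with `F = H_l / H_{l-1}`. -/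
def speed (θ : ℝ) (l : ℕ) (x ν : M → Amb n) (p : M) : ℝ :=
  (1 + Real.cos θ * inner ℝ (ν p) (downVec n)) / (meanCurv l x ν p / meanCurv (l - 1) x ν p) -
    inner ℝ (x p) (ν p)

/-- The time interval `[0, T)`, where `T = ∞` is allowed. -/
def timeInterval (T : EReal) : Set ℝ := {t | 0 ≤ t ∧ (t : EReal) < T}

/-- `x(·, t)`, `t ∈ [0, T)`, is a smooth family of capillary embeddings with outward unit normals
`ν(·, t)` that solves `(∂_t x)^⊥ = f ν` with the speed `f` above. The tangential part of the
velocity is not prescribed. -/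
structure IsFlow (θ : ℝ) (l : ℕ) (T : EReal) (x ν : ℝ → M → Amb n) : Prop where
  smooth : ContMDiffOn ((𝓡∂ n).prod 𝓘(ℝ, ℝ)) 𝓘(ℝ, Amb n) ∞
    (fun q : M × ℝ => x q.2 q.1) (univ ×ˢ timeInterval T)
  smooth_normal : ContMDiffOn ((𝓡∂ n).prod 𝓘(ℝ, ℝ)) 𝓘(ℝ, Amb n) ∞
    (fun q : M × ℝ => ν q.2 q.1) (univ ×ˢ timeInterval T)
  capillary : ∀ t ∈ timeInterval T, IsCapillary θ (x t) (ν t)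
  normal_velocity : ∀ t ∈ timeInterval T, ∀ p,
    inner ℝ (derivWithin (fun s => x s p) (timeInterval T) t) (ν t p) = speed θ l (x t) (ν t) p

end CapillaryFlow

end

noncomputable section

namespace CapillaryFlow

/-! ### Determinants of frames in the ambient space -/

section FrameDet

variable {n : ℕ}

/-- The volume form of the ambient space. -/
def ambVol (n : ℕ) : (Amb n) [⋀^Fin (n + 1)]→ₗ[ℝ] ℝ :=
  (Matrix.detRowAlternating (R := ℝ) (n := Fin (n + 1))).compLinearMap
    (WithLp.linearEquiv 2 ℝ (Fin (n + 1) → ℝ)).toLinearMap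

/-- The determinant of the vectors `a, v 0, …, v (n - 1)`. -/
def frameDet (a : Amb n) (v : Fin n → Amb n) : ℝ := ambVol n (Fin.cons a v)

theorem ambVol_apply (v : Fin (n + 1) → Amb n) :
    ambVol n v = Matrix.det (Matrix.of fun i j => v i j) := rfl

theorem ambVol_mul (v w : Fin (n + 1) → Amb n) :
    ambVol n v * ambVol n w = Matrix.det (Matrix.of fun i j => inner ℝ (v i) (w j)) := by
  rw [ambVol_apply, ambVol_apply, ← Matrix.det_transpose (Matrix.of fun i j => w i j),
    ← Matrix.det_mul]
  congr 1
  ext i j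
  simp [Matrix.mul_apply, PiLp.inner_apply, mul_comm]

theorem frameDet_mul_of_orthogonal {a ν : Amb n} {v w : Fin n → Amb n}
    (hv : ∀ i, inner ℝ (v i) ν = 0) :
    frameDet a v * frameDet ν w =
      inner ℝ a ν * Matrix.det (Matrix.of fun i j => inner ℝ (v i) (w j)) := by
  rw [frameDet, frameDet, ambVol_mul, Matrix.det_succ_column_zero, Fin.sum_univ_succ,
    Finset.sum_eq_zero]
  · simp only [Matrix.of_apply, Fin.cons_zero, add_zero]
    simp only [Fin.val_zero, pow_zero, one_mul]
    congr 1
  · intro i _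
    simp [hv]

theorem frameDet_sq {ν : Amb n} {v : Fin n → Amb n} (hν : ‖ν‖ = 1)
    (hv : ∀ i, inner ℝ (v i) ν = 0) :
    frameDet ν v ^ 2 = Matrix.det (Matrix.of fun i j => inner ℝ (v i) (v j)) := by
  rw [sq, frameDet_mul_of_orthogonal hv, real_inner_self_eq_norm_sq, hν]
  simp

theorem frameDet_smul_left (r : ℝ) (a : Amb n) (v : Fin n → Amb n) :
    frameDet (r • a) v = r * frameDet a v := by
  have := (ambVol n).map_update_smul (Fin.cons 0 v) 0 r a
  simpa [frameDet, Fin.update_cons_zero] using this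

theorem frameDet_zero_left (v : Fin n → Amb n) : frameDet 0 v = 0 := by
  simpa using frameDet_smul_left 0 (0 : Amb n) v

theorem frameDet_sum_left {α : Type*} (s : Finset α) (g : α → Amb n) (v : Fin n → Amb n) :
    frameDet (∑ k ∈ s, g k) v = ∑ k ∈ s, frameDet (g k) v := by
  have := (ambVol n).map_update_sum s 0 g (Fin.cons 0 v)
  simpa only [frameDet, Fin.update_cons_zero] using this

theorem frameDet_update_add (b : Amb n) (v : Fin n → Amb n) (i : Fin n) (x y : Amb n) :
    frameDet b (Function.update v i (x + y)) =
      frameDet b (Function.update v i x) + frameDet b (Function.update v i y) := by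
  have := (ambVol n).map_update_add (Fin.cons b v) i.succ x y
  simpa only [frameDet, Fin.cons_update] using this

theorem frameDet_update_smul (b : Amb n) (v : Fin n → Amb n) (i : Fin n) (r : ℝ) (x : Amb n) :
    frameDet b (Function.update v i (r • x)) = r * frameDet b (Function.update v i x) := by
  have := (ambVol n).map_update_smul (Fin.cons b v) i.succ r x
  simpa only [frameDet, Fin.cons_update, smul_eq_mul] using this

theorem frameDet_update_sum {α : Type*} (s : Finset α) (b : Amb n) (v : Fin n → Amb n) (i : Fin n)
    (g : α → Amb n) :
    frameDet b (Function.update v i (∑ k ∈ s, g k)) =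
      ∑ k ∈ s, frameDet b (Function.update v i (g k)) := by
  have := (ambVol n).map_update_sum s i.succ g (Fin.cons b v)
  simpa only [frameDet, Fin.cons_update] using this

theorem frameDet_swap_update (a b : Amb n) (v : Fin n → Amb n) (i : Fin n) :
    frameDet b (Function.update v i a) = - frameDet a (Function.update v i b) := by
  rw [frameDet, frameDet, ← (ambVol n).map_swap _ (Fin.succ_ne_zero i).symm]
  congr 1
  ext j : 1
  refine Fin.cases ?_ (fun j => ?_) j
  · simp
  · by_cases h : j = i
    · subst h
      simp [Function.update_of_ne (Fin.succ_ne_zero j).symm, Fin.cons_update]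
    · have h' : j.succ ≠ i.succ := fun h'' => h (Fin.succ_injective _ h'')
      simp [Function.comp, Equiv.swap_apply_of_ne_of_ne (Fin.succ_ne_zero j) h', h]

theorem frameDet_update_update_swap (b a s : Amb n) (v : Fin n → Amb n) {i j : Fin n}
    (hij : i ≠ j) :
    frameDet b (Function.update (Function.update v i a) j s) =
      - frameDet b (Function.update (Function.update v j a) i s) := by
  rw [frameDet, frameDet,
    ← (ambVol n).map_swap _ (fun h => hij (Fin.succ_injective _ h) : i.succ ≠ j.succ)]
  congr 1
  ext k : 1
  refine Fin.cases ?_ (fun k => ?_) k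
  · simp [Function.comp, Equiv.swap_apply_of_ne_of_ne (Fin.succ_ne_zero i).symm
      (Fin.succ_ne_zero j).symm]
  · by_cases hi : k = i
    · subst hi
      have h2 : j.succ ≠ k.succ := fun h => hij (Fin.succ_injective _ h).symm
      simp [Fin.cons_update, Function.update_of_ne h2, Function.update_of_ne hij]
    · by_cases hj : k = j
      · subst hj; simp
      · have h1 : k.succ ≠ i.succ := fun h => hi (Fin.succ_injective _ h)
        have h2 : k.succ ≠ j.succ := fun h => hj (Fin.succ_injective _ h)
        simp [Function.comp, Equiv.swap_apply_of_ne_of_ne h1 h2, hi, hj]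

theorem sum_frameDet_update_update_eq_zero (b a : Amb n) (v : Fin n → Amb n)
    (S : Fin n → Fin n → Amb n) (hS : ∀ i j, S i j = S j i) :
    ∑ i, ∑ j ∈ Finset.univ.erase i,
      frameDet b (Function.update (Function.update v i a) j (S i j)) = 0 := by
  have h1 : ∀ i, ∑ j ∈ Finset.univ.erase i,
      frameDet b (Function.update (Function.update v i a) j (S i j)) =
      ∑ j, if i = j then 0 else
        frameDet b (Function.update (Function.update v i a) j (S i j)) := by
    intro i
    rw [← Finset.sum_erase_add _ _ (Finset.mem_univ i)]
    simp only [if_true, add_zero]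
    exact Finset.sum_congr rfl fun j hj => (if_neg (Finset.ne_of_mem_erase hj).symm).symm
  simp_rw [h1]
  have h2 : (∑ i, ∑ j, if i = j then 0 else
        frameDet b (Function.update (Function.update v i a) j (S i j))) =
      - ∑ i, ∑ j, if i = j then 0 else
        frameDet b (Function.update (Function.update v i a) j (S i j)) := by
    conv_lhs => rw [Finset.sum_comm]
    rw [← Finset.sum_neg_distrib]
    refine Finset.sum_congr rfl fun j _ => ?_
    rw [← Finset.sum_neg_distrib]
    refine Finset.sum_congr rfl fun i _ => ?_
    by_cases h : i = j
    · simp [h]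
    · rw [if_neg h, if_neg (Ne.symm h), frameDet_update_update_swap _ _ _ _ h, hS]
  linarith

/-- A frame of vectors whose last coordinates vanish is degenerate. -/
theorem frameDet_eq_zero_of_horizontal {a : Amb n} {v : Fin n → Amb n} (ha : a (Fin.last n) = 0)
    (hv : ∀ i, v i (Fin.last n) = 0) : frameDet a v = 0 := by
  rw [frameDet, ambVol_apply]
  refine Matrix.det_eq_zero_of_column_eq_zero (Fin.last n) fun i => ?_
  refine Fin.cases ?_ (fun k => ?_) i
  · simpa using ha
  · simpa using hv k

theorem continuous_ambVol : Continuous (fun v : Fin (n + 1) → Amb n => ambVol n v) := by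
  simp only [ambVol_apply]
  refine Continuous.matrix_det ?_
  refine continuous_matrix fun i j => ?_
  simp only [Matrix.of_apply]
  fun_prop

variable (n) in
/-- The volume form of the ambient space as a continuous multilinear map. -/
def ambVolCM : ContinuousMultilinearMap ℝ (fun _ : Fin (n + 1) => Amb n) ℝ where
  toMultilinearMap := (ambVol n).toMultilinearMap
  cont := continuous_ambVol

theorem ambVolCM_cons (a : Amb n) (v : Fin n → Amb n) :
    ambVolCM n (Fin.cons a v) = frameDet a v := rfl

theorem contDiff_frameDet {m : WithTop ℕ∞} :
    ContDiff ℝ m (fun q : Amb n × (Fin n → Amb n) => frameDet q.1 q.2) := by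
  have : ContDiff ℝ m (fun q : Amb n × (Fin n → Amb n) =>
      (Fin.cons q.1 q.2 : Fin (n + 1) → Amb n)) := by
    rw [contDiff_pi]
    intro i
    refine Fin.cases ?_ (fun k => ?_) i
    · simpa using contDiff_fst
    · simp only [Fin.cons_succ]
      fun_prop
  exact (ambVolCM n).contDiff.comp this

theorem continuous_frameDet :
    Continuous (fun q : Amb n × (Fin n → Amb n) => frameDet q.1 q.2) :=
  (contDiff_frameDet (m := 0)).continuous

theorem hasFDerivAt_frameDet {G : Type*} [NormedAddCommGroup G] [NormedSpace ℝ G]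
    {b : G → Amb n} {v : Fin n → G → Amb n} {b' : G →L[ℝ] Amb n} {v' : Fin n → G →L[ℝ] Amb n}
    {x : G} (hb : HasFDerivAt b b' x) (hv : ∀ i, HasFDerivAt (v i) (v' i) x) :
    ∃ D : G →L[ℝ] ℝ, HasFDerivAt (fun y => frameDet (b y) (fun i => v i y)) D x ∧
      ∀ h, D h = frameDet (b' h) (fun i => v i x) +
        ∑ i, frameDet (b x) (Function.update (fun i => v i x) i (v' i h)) := by
  have hg : ∀ i : Fin (n + 1), HasFDerivAt
      (fun y => (Fin.cons (b y) (fun i => v i y) : Fin (n + 1) → Amb n) i)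
      ((Fin.cons b' v' : Fin (n + 1) → (G →L[ℝ] Amb n)) i) x := by
    intro i
    refine Fin.cases ?_ (fun k => ?_) i
    · simpa using hb
    · simpa using hv k
  refine ⟨_, HasFDerivAt.multilinear_comp (ambVolCM n) hg, fun h => ?_⟩
  rw [_root_.sum_apply, Fin.sum_univ_succ]
  simp only [ContinuousLinearMap.comp_apply, Fin.cons_zero, Fin.cons_succ]
  congr 1
  · exact congrArg (ambVolCM n)
      (Fin.update_cons_zero (α := fun _ => Amb n) (b x) (fun i => v i x) (b' h))
  · refine Finset.sum_congr rfl fun i _ => ?_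
    rw [← ambVolCM_cons, Fin.cons_update]
    rfl

theorem hasDerivAt_frameDet {b : ℝ → Amb n} {v : ℝ → Fin n → Amb n} {b' : Amb n}
    {v' : Fin n → Amb n} {t : ℝ} (hb : HasDerivAt b b' t)
    (hv : ∀ i, HasDerivAt (fun s => v s i) (v' i) t) :
    HasDerivAt (fun s => frameDet (b s) (v s))
      (frameDet b' (v t) + ∑ i, frameDet (b t) (Function.update (v t) i (v' i))) t := by
  obtain ⟨D, hD, hD'⟩ := hasFDerivAt_frameDet hb.hasFDerivAt (fun i => (hv i).hasFDerivAt)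
  have := hD.hasDerivAt
  rw [hD'] at this
  simpa using this

end FrameDet

/-! ### Change of frame -/

section ChangeFrame

variable {n : ℕ}

/-- The standard basis vectors of `ℝ^n`. -/
abbrev stdVec (i : Fin n) : EuclideanSpace ℝ (Fin n) := EuclideanSpace.single i 1

theorem frameDet_comp (b : Amb n) (Y : EuclideanSpace ℝ (Fin n) →L[ℝ] Amb n)
    (J : EuclideanSpace ℝ (Fin n) →L[ℝ] EuclideanSpace ℝ (Fin n)) :
    frameDet b (fun i => Y (J (stdVec i))) = J.det * frameDet b (fun i => Y (stdVec i)) := by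
  set e := (EuclideanSpace.basisFun (Fin n) ℝ).toBasis
  have he : ∀ i, e i = stdVec i := fun i => by simp [e]
  let f : (EuclideanSpace ℝ (Fin n)) [⋀^Fin n]→ₗ[ℝ] ℝ :=
    ((ambVol n).curryLeft b).compLinearMap Y.toLinearMap
  have hf : ∀ v, f v = frameDet b (fun i => Y (v i)) := fun v => rfl
  have h1 := congrArg (fun g => g (fun i => J (stdVec i))) (f.eq_smul_basis_det e)
  simp only [AlternatingMap.smul_apply, smul_eq_mul] at h1
  rw [← hf (fun i => J (stdVec i)), ← hf (fun i => stdVec i), h1, mul_comm]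
  have h2 : (fun i => J (stdVec i)) = J.toLinearMap ∘ e := by ext1 i; simp [he]
  have h3 : (fun i => stdVec i) = (e : Fin n → EuclideanSpace ℝ (Fin n)) := by ext1 i; simp [he]
  rw [h2, Module.Basis.det_comp, Module.Basis.det_self, mul_one, h3]

/-- The first order term of `frameDet b (Y + r A)` in `r`. -/
def frameVar (b : Amb n) (y a : Fin n → Amb n) : ℝ :=
  ∑ i, frameDet b (Function.update y i (a i))

theorem hasDerivAt_frameVar (b : Amb n) (y a : Fin n → Amb n) (s : ℝ) :
    HasDerivAt (fun r : ℝ => frameDet b (y + r • a)) (frameVar b (y + s • a) a) s := by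
  have := hasDerivAt_frameDet (hasDerivAt_const s b) (v := fun r => y + r • a) (v' := a) (t := s)
    (fun i => by
      simpa using ((hasDerivAt_id s).smul_const (a i)).const_add (y i))
  simpa [frameDet_zero_left, frameVar] using this

theorem frameVar_zero_left (v w : Fin n → Amb n) : frameVar 0 v w = 0 :=
  Finset.sum_eq_zero fun _ _ => frameDet_zero_left _

theorem frameVar_zero_right (b : Amb n) (v : Fin n → Amb n) : frameVar b v 0 = 0 := by
  refine Finset.sum_eq_zero fun i _ => ?_
  simpa using frameDet_update_smul b v i 0 0

theorem frameVar_sum_left {α : Type*} (s : Finset α) (g : α → Amb n) (v w : Fin n → Amb n) :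
    frameVar (∑ k ∈ s, g k) v w = ∑ k ∈ s, frameVar (g k) v w := by
  simp only [frameVar, frameDet_sum_left]
  exact Finset.sum_comm

theorem frameVar_sum_right {α : Type*} (s : Finset α) (b : Amb n) (v : Fin n → Amb n)
    (w : Fin n → α → Amb n) :
    frameVar b v (fun i => ∑ k ∈ s, w i k) = ∑ k ∈ s, frameVar b v (fun i => w i k) := by
  simp only [frameVar, frameDet_update_sum]
  exact Finset.sum_comm

theorem frameVar_comp (b : Amb n) (Y A : EuclideanSpace ℝ (Fin n) →L[ℝ] Amb n)
    (J : EuclideanSpace ℝ (Fin n) →L[ℝ] EuclideanSpace ℝ (Fin n)) :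
    frameVar b (fun i => Y (J (stdVec i))) (fun i => A (J (stdVec i))) =
      J.det * frameVar b (fun i => Y (stdVec i)) (fun i => A (stdVec i)) := by
  have h1 := hasDerivAt_frameVar b (fun i => Y (J (stdVec i))) (fun i => A (J (stdVec i))) 0
  have h2 := (hasDerivAt_frameVar b (fun i => Y (stdVec i)) (fun i => A (stdVec i)) 0).const_mul
    J.det
  have h3 : (fun r : ℝ => frameDet b
      ((fun i => Y (J (stdVec i))) + r • (fun i => A (J (stdVec i))))) =
      fun r : ℝ => J.det * frameDet b ((fun i => Y (stdVec i)) + r • (fun i => A (stdVec i))) := by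
    ext1 r
    exact frameDet_comp b (Y + r • A) J
  rw [h3] at h1
  simpa using h1.unique h2

end ChangeFrame

/-! ### Newton's inequalities -/

section Newton

open Polynomial

theorem esymm_cons_succ (a : ℝ) (s : Multiset ℝ) (k : ℕ) :
    (a ::ₘ s).esymm (k + 1) = s.esymm (k + 1) + a * s.esymm k := by
  simp only [Multiset.esymm, Multiset.powersetCard_cons, Multiset.map_add, Multiset.sum_add,
    Multiset.map_map, Function.comp_def, Multiset.prod_cons, Multiset.sum_map_mul_left]

theorem esymm_zero_eq_one (s : Multiset ℝ) : s.esymm 0 = 1 := by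
  simp [Multiset.esymm]

theorem esymm_eq_zero_of_card_lt {s : Multiset ℝ} {k : ℕ} (h : Multiset.card s < k) :
    s.esymm k = 0 := by
  simp [Multiset.esymm, Multiset.powersetCard_eq_empty _ h]

/-- The mean of the products of `k` elements of `s`. -/
def esymmMean (s : Multiset ℝ) (k : ℕ) : ℝ := s.esymm k / ((Multiset.card s).choose k : ℝ)

theorem esymm_last_mul_le (s : Multiset ℝ) : ∀ m : ℕ, Multiset.card s = m + 2 →
    2 * (m + 2 : ℝ) * (s.esymm (m + 2) * s.esymm m) ≤ (m + 1) * s.esymm (m + 1) ^ 2 := by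
  induction s using Multiset.induction_on with
  | empty => intro m h; simp at h
  | cons a s ih =>
    intro m h
    rw [Multiset.card_cons] at h
    have hc : Multiset.card s = m + 1 := by omega
    have e0 : s.esymm (m + 2) = 0 := esymm_eq_zero_of_card_lt (by omega)
    cases m with
    | zero =>
      rw [esymm_cons_succ, esymm_cons_succ, e0, esymm_zero_eq_one, esymm_zero_eq_one]
      push_cast
      nlinarith [sq_nonneg (s.esymm 1 - a)]
    | succ m =>
      have := ih m hc
      rw [esymm_cons_succ, esymm_cons_succ, esymm_cons_succ, e0]
      push_cast at this ⊢
      set p := s.esymm (m + 2)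
      set q := s.esymm (m + 1)
      set r := s.esymm m
      have hm : (0 : ℝ) ≤ m := Nat.cast_nonneg m
      have key : 0 ≤ ((m + 2) * p - a * q) ^ 2 + (m + 3) * a ^ 2 *
          ((m + 1) * q ^ 2 - 2 * (m + 2) * (p * r)) := by
        have : 0 ≤ (m + 1) * q ^ 2 - 2 * (m + 2) * (p * r) := by linarith
        positivity
      have h2 : (0 : ℝ) < m + 2 := by linarith
      have : 0 ≤ (m + 2) * ((m + 2) * (p + a * q) ^ 2
          - 2 * (m + 3) * ((a * p) * (q + a * r))) := by
        convert key using 1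
        ring
      have := nonneg_of_mul_nonneg_right this h2
      nlinarith

/-- The roots of the derivative of `∏ (X + r)` have the same means of products. -/
theorem exists_card_eq_esymmMean_eq (s : Multiset ℝ) (m : ℕ) (hs : Multiset.card s = m + 1) :
    ∃ s' : Multiset ℝ, Multiset.card s' = m ∧ ∀ k ≤ m, esymmMean s' k = esymmMean s k := by
  set P : ℝ[X] := (s.map fun r => X + C r).prod with hP
  have hmonic : P.Monic := monic_multiset_prod_of_monic _ _ fun r _ => monic_X_add_C r
  have hdeg : P.natDegree = m + 1 := by
    rw [hP, natDegree_multiset_prod_of_monic _ fun f hf => ?_]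
    · simp [hs, add_comm]
    · obtain ⟨r, _, rfl⟩ := Multiset.mem_map.1 hf
      exact monic_X_add_C r
  have hcoeff : ∀ j ≤ m + 1, P.coeff (m + 1 - j) = s.esymm j := by
    intro j hj
    rw [hP, Multiset.prod_X_add_C_coeff _ (by omega), hs]
    congr 1; omega
  have hroots : Multiset.card P.roots = m + 1 := by
    rw [← hdeg]
    apply Polynomial.splits_iff_card_roots.1
    rw [hP]
    apply Polynomial.Splits.multisetProd
    intro f hf
    obtain ⟨r, _, rfl⟩ := Multiset.mem_map.1 hf
    exact Polynomial.Splits.X_add_C r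
  have hdd : (derivative P).natDegree ≤ m := by
    have := natDegree_derivative_le P
    omega
  have hlead : (derivative P).coeff m = m + 1 := by
    rw [coeff_derivative]
    have := hcoeff 0 (by omega)
    rw [esymm_zero_eq_one] at this
    simp only [Nat.sub_zero] at this
    rw [this, one_mul]
  have hm1 : (0 : ℝ) < m + 1 := by positivity
  have hdd' : (derivative P).natDegree = m := by
    refine le_antisymm hdd (le_natDegree_of_ne_zero ?_)
    rw [hlead]; exact hm1.ne'
  have hcr : Multiset.card (derivative P).roots = m := by
    have h1 := card_roots_le_derivative P
    have h2 := card_roots' (derivative P)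
    omega
  refine ⟨(derivative P).roots.map Neg.neg, by simpa using hcr, fun k hk => ?_⟩
  have h1 := Polynomial.coeff_eq_esymm_roots_of_card (p := derivative P) (k := m - k)
    (by rw [hcr, hdd']) (by omega)
  rw [Polynomial.leadingCoeff, hdd', hlead, coeff_derivative, show m - (m - k) = k by omega,
    show m - k + 1 = m + 1 - k by omega, hcoeff k (by omega)] at h1
  rw [esymmMean, esymmMean, Multiset.esymm_neg, Multiset.card_map, hcr, hs]
  have hch : ((m + 1).choose k : ℝ) * (m + 1 - k) = (m.choose k : ℝ) * (m + 1) := by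
    have := Nat.choose_mul_succ_eq m k
    have h3 : ((m + 1 - k : ℕ) : ℝ) = m + 1 - k := by push_cast [show k ≤ m + 1 by omega]; ring
    rw [← h3]
    exact_mod_cast this.symm
  have hk' : ((m - k : ℕ) : ℝ) = m - k := by push_cast [hk]; ring
  rw [hk'] at h1
  have p1 : (0 : ℝ) < m.choose k := by exact_mod_cast Nat.choose_pos hk
  have p2 : (0 : ℝ) < (m + 1).choose k := by exact_mod_cast Nat.choose_pos (by omega : k ≤ m + 1)
  rw [div_eq_div_iff p1.ne' p2.ne']
  set E := (-1 : ℝ) ^ k * (derivative P).roots.esymm k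
  have h4 : s.esymm k * (m - k + 1) = (m + 1) * E := by rw [h1]; ring
  have : (m + 1) * (E * ((m + 1).choose k : ℝ)) = (m + 1) * (s.esymm k * (m.choose k : ℝ)) := by
    rw [← mul_assoc, ← h4, mul_assoc, show (m - k + 1 : ℝ) * ((m + 1).choose k : ℝ) =
      ((m + 1).choose k : ℝ) * (m + 1 - k) by ring, hch]
    ring
  exact mul_left_cancel₀ hm1.ne' this

/-- **Newton's inequalities**. -/
theorem esymmMean_mul_le_sq (m : ℕ) : ∀ (s : Multiset ℝ) (k : ℕ), Multiset.card s = m →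
    k + 2 ≤ m → esymmMean s k * esymmMean s (k + 2) ≤ esymmMean s (k + 1) ^ 2 := by
  induction m with
  | zero => intro s k _ h; omega
  | succ m ih =>
    intro s k hs hk
    rcases Nat.lt_or_ge m (k + 2) with h | h
    · obtain rfl : m = k + 1 := by omega
      have h1 := esymm_last_mul_le s k hs
      rw [esymmMean, esymmMean, esymmMean, hs]
      have c0 : ((k + 1 + 1).choose (k + 2) : ℝ) = 1 := by simp
      have c1 : ((k + 1 + 1).choose (k + 1) : ℝ) = k + 2 := by
        rw [Nat.choose_succ_self_right]; push_cast; ring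
      have c2 : ((k + 1 + 1).choose k : ℝ) = (k + 2) * (k + 1) / 2 := by
        rw [show k + 1 + 1 = k + 2 by rfl, Nat.choose_symm_add, Nat.choose_two_right,
          Nat.cast_div (Nat.even_mul_pred_self _).two_dvd two_ne_zero]
        push_cast
        simp
      rw [c0, c1, c2]
      have hk0 : (0 : ℝ) ≤ k := Nat.cast_nonneg k
      rw [div_one, div_pow, div_mul_eq_mul_div, div_le_div_iff₀ (by positivity) (by positivity)]
      have : (0 : ℝ) ≤ (k + 2) / 2 := by positivity
      nlinarith [mul_le_mul_of_nonneg_left h1 this]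
    · obtain ⟨s', hs', he⟩ := exists_card_eq_esymmMean_eq s m hs
      rw [← he k (by omega), ← he (k + 1) (by omega), ← he (k + 2) (by omega)]
      exact ih s' k hs' h

end Newton

/-! ### Determinants and symmetric functions of relative eigenvalues -/

section RelEigenvalues

variable {ι : Type*} [Fintype ι] [DecidableEq ι]

theorem normSym_zero (G B : Matrix ι ι ℝ) : normSym 0 G B = 1 := by
  simp [normSym, esymm_zero_eq_one]

open scoped MatrixOrder Matrix.Norms.L2Operator ComplexOrder in
theorem exists_isHermitian_charpoly_eq {G B : Matrix ι ι ℝ} (hG : G.PosDef)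
    (hB : B.IsHermitian) : ∃ S : Matrix ι ι ℝ, S.IsHermitian ∧ (G⁻¹ * B).charpoly = S.charpoly := by
  obtain ⟨C, hC⟩ := CStarAlgebra.nonneg_iff_eq_star_mul_self.mp hG.posSemidef.nonneg
  refine ⟨(C⁻¹).conjTranspose * B * C⁻¹, Matrix.isHermitian_conjTranspose_mul_mul _ hB, ?_⟩
  rw [Matrix.charpoly_mul_comm (C⁻¹.conjTranspose * B), ← mul_assoc]
  congr 2
  rw [hC, Matrix.mul_inv_rev, Matrix.star_eq_conjTranspose, Matrix.conjTranspose_nonsing_inv]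

theorem card_relEigenvalues {G B : Matrix ι ι ℝ} (hG : G.PosDef) (hB : B.IsHermitian) :
    Multiset.card (relEigenvalues G B) = Fintype.card ι := by
  obtain ⟨S, hS, h⟩ := exists_isHermitian_charpoly_eq hG hB
  rw [relEigenvalues, h, hS.roots_charpoly_eq_eigenvalues]
  simp

theorem normSym_eq_esymmMean {G B : Matrix ι ι ℝ} (hG : G.PosDef) (hB : B.IsHermitian) (k : ℕ) :
    normSym k G B = esymmMean (relEigenvalues G B) k := by
  rw [normSym, esymmMean, card_relEigenvalues hG hB]

theorem normSym_mul_le_sq {G B : Matrix ι ι ℝ} (hG : G.PosDef) (hB : B.IsHermitian) (k : ℕ)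
    (hk : k + 2 ≤ Fintype.card ι) :
    normSym k G B * normSym (k + 2) G B ≤ normSym (k + 1) G B ^ 2 := by
  simp only [normSym_eq_esymmMean hG hB]
  exact esymmMean_mul_le_sq _ _ _ (card_relEigenvalues hG hB) hk

open Polynomial in
theorem det_add_smul_eq_sum {G B : Matrix ι ι ℝ} (hG : G.PosDef) (hB : B.IsHermitian) (r : ℝ) :
    (G + r • B).det = G.det * ∑ k ∈ Finset.range (Fintype.card ι + 1),
      ((Fintype.card ι).choose k : ℝ) * r ^ k * normSym k G B := by
  set m := Fintype.card ι with hm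
  have hunit : IsUnit G.det := hG.isUnit.map Matrix.detMonoidHom
  have h1 : G + r • B = G * (1 + r • (G⁻¹ * B)) := by
    rw [mul_add, mul_one, Matrix.mul_smul, Matrix.mul_nonsing_inv_cancel_left _ _ hunit]
  rw [h1, Matrix.det_mul]
  congr 1
  have h2 : ∀ k ∈ Finset.range (m + 1), (m.choose k : ℝ) * r ^ k * normSym k G B =
      r ^ k * (relEigenvalues G B).esymm k := by
    intro k hk
    have : (0 : ℝ) < m.choose k := by
      exact_mod_cast Nat.choose_pos (Nat.lt_succ_iff.1 (Finset.mem_range.1 hk))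
    rw [normSym, ← hm]
    field_simp
  rw [Finset.sum_congr rfl h2]
  rcases eq_or_ne r 0 with rfl | hr
  · rw [Finset.sum_eq_single 0]
    · simp [esymm_zero_eq_one]
    · intro b _ hb; simp [hb]
    · simp
  set W := G⁻¹ * B
  obtain ⟨S, hS, h⟩ := exists_isHermitian_charpoly_eq hG hB
  have hcard := card_relEigenvalues hG hB
  have hW : W.charpoly = ((relEigenvalues G B).map fun t => X - C t).prod := by
    have hdeg : W.charpoly.natDegree = m := Matrix.charpoly_natDegree_eq_dim _
    have := (Polynomial.C_leadingCoeff_mul_prod_multiset_X_sub_C (p := W.charpoly)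
      (by rw [hdeg]; exact hcard))
    rw [(Matrix.charpoly_monic W).leadingCoeff, C_1, one_mul] at this
    exact this.symm
  have h3 : (1 + r • W).det = (-r) ^ m * W.charpoly.eval (-r⁻¹) := by
    rw [Matrix.eval_charpoly, hm, ← Matrix.det_smul]
    congr 1
    rw [smul_sub, Matrix.scalar_apply]
    ext i j
    by_cases hij : i = j
    · subst hij; simp [hr]
    · simp [hij]
  rw [h3, hW, Multiset.prod_X_sub_X_eq_sum_esymm, hcard, Polynomial.eval_finsetSum,
    Finset.mul_sum]
  refine Finset.sum_congr rfl fun k hk => ?_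
  have hk' : k ≤ m := Nat.lt_succ_iff.1 (Finset.mem_range.1 hk)
  simp only [eval_mul, eval_pow, eval_neg, eval_one, eval_C, eval_X]
  obtain ⟨j, hj⟩ := Nat.exists_eq_add_of_le hk'
  rw [← hm, hj, show k + j - k = j by omega, pow_add]
  have : (-r) ^ j * (-r⁻¹) ^ j = 1 := by rw [← mul_pow]; simp [hr]
  have h5 : (-r) ^ k * (-1) ^ k = r ^ k := by rw [← mul_pow]; simp
  calc _ = ((-r) ^ k * (-1) ^ k) * ((-r) ^ j * (-r⁻¹) ^ j) * (relEigenvalues G B).esymm k := by ring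
    _ = _ := by rw [this, h5]; ring

end RelEigenvalues

/-! ### The divergence theorem on a half-space -/

section HalfSpace

open MeasureTheory

variable {n : ℕ} [NeZero n]

theorem bdryIncl_apply_zero (v : EuclideanSpace ℝ {i : Fin n // i ≠ 0}) : bdryIncl v 0 = 0 := by
  simp [bdryIncl]

theorem bdryIncl_apply_of_ne (v : EuclideanSpace ℝ {i : Fin n // i ≠ 0}) {i : Fin n} (h : i ≠ 0) :
    bdryIncl v i = v ⟨i, h⟩ := by
  simp [bdryIncl, h]

theorem continuous_bdryIncl :
    Continuous (bdryIncl : EuclideanSpace ℝ {i : Fin n // i ≠ 0} → EuclideanSpace ℝ (Fin n)) := by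
  refine (PiLp.continuous_toLp 2 _).comp (continuous_pi fun i => ?_)
  by_cases h : i = 0
  · simp only [h, dif_pos]; exact continuous_const
  · simp only [h, dif_neg, not_false_eq_true]; fun_prop

theorem norm_bdryIncl (v : EuclideanSpace ℝ {i : Fin n // i ≠ 0}) : ‖bdryIncl v‖ = ‖v‖ := by
  rw [EuclideanSpace.norm_eq, EuclideanSpace.norm_eq]
  congr 1
  rw [← Finset.sum_filter_add_sum_filter_not Finset.univ (fun i : Fin n => i ≠ 0),
    Finset.sum_eq_zero (s := Finset.univ.filter fun i : Fin n => ¬ i ≠ 0), add_zero,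
    Finset.sum_subtype (p := fun i : Fin n => i ≠ 0) _ (by simp)]
  · exact Finset.sum_congr rfl fun i _ => by rw [bdryIncl_apply_of_ne v i.2]
  · intro i hi
    obtain rfl : i = 0 := by simpa using hi
    simp [bdryIncl_apply_zero]

theorem volume_coord_eq (i : Fin n) (r : ℝ) :
    volume {u : EuclideanSpace ℝ (Fin n) | u i = r} = 0 := by
  have h : {u : EuclideanSpace ℝ (Fin n) | u i = r} =
      (WithLp.ofLp : EuclideanSpace ℝ (Fin n) → Fin n → ℝ) ⁻¹' {x | x i = r} := rfl
  have h2 : {x : Fin n → ℝ | x i = r} = Function.eval i ⁻¹' ({r} : Set ℝ) := rfl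
  rw [h, (PiLp.volume_preserving_ofLp (Fin n)).measure_preimage_emb
    (MeasurableEquiv.toLp 2 (Fin n → ℝ)).symm.measurableEmbedding, h2]
  exact Measure.pi_hyperplane (fun _ : Fin n => (volume : Measure ℝ)) i r

theorem integral_toLp_fin_cons {m : ℕ} (F : EuclideanSpace ℝ (Fin (m + 1)) → ℝ) :
    ∫ v, F (bdryIncl v) = ∫ y : Fin m → ℝ, F (WithLp.toLp 2 (Fin.cons 0 y)) := by
  let e : Fin m ≃ {i : Fin (m + 1) // i ≠ 0} := finSuccAboveEquiv 0
  have h1 := (PiLp.volume_preserving_toLp {i : Fin (m + 1) // i ≠ 0}).integral_comp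
    (MeasurableEquiv.toLp 2 _).measurableEmbedding (fun v => F (bdryIncl v))
  rw [← h1]
  have h2 := (volume_measurePreserving_piCongrLeft (fun _ => ℝ) e).integral_comp
    (MeasurableEquiv.piCongrLeft _ e).measurableEmbedding
    (fun v : {i : Fin (m + 1) // i ≠ 0} → ℝ => F (bdryIncl (WithLp.toLp 2 v)))
  rw [← h2]
  congr 1
  ext1 y
  congr 1
  ext i
  refine Fin.cases ?_ (fun k => ?_) i
  · rw [bdryIncl_apply_zero]; rfl
  · rw [bdryIncl_apply_of_ne _ (Fin.succ_ne_zero k)]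
    simp only [Fin.cons_succ]
    have : (⟨k.succ, Fin.succ_ne_zero k⟩ : {i : Fin (m + 1) // i ≠ 0}) = e k := by
      exact Subtype.ext rfl
    rw [this]
    exact Equiv.piCongrLeft_apply_apply (fun _ => ℝ) e y k

theorem integral_divergence_halfSpace (V : Fin n → EuclideanSpace ℝ (Fin n) → ℝ)
    (V' : Fin n → EuclideanSpace ℝ (Fin n) → EuclideanSpace ℝ (Fin n) →L[ℝ] ℝ)
    {K : Set (EuclideanSpace ℝ (Fin n))} (hK : Bornology.IsBounded K)
    (hVK : ∀ i, ∀ u ∉ K, V i u = 0) (hV'K : ∀ i, ∀ u ∉ K, V' i u = 0)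
    (hc : ∀ i, ContinuousOn (V i) {u | 0 ≤ u 0})
    (hd : ∀ i u, 0 < u 0 → HasFDerivAt (V i) (V' i u) u)
    (hint : IntegrableOn (fun u => ∑ i, V' i u (stdVec i)) {u | 0 ≤ u 0}) :
    ∫ u in {u : EuclideanSpace ℝ (Fin n) | 0 ≤ u 0}, ∑ i, V' i u (stdVec i) =
      - ∫ v, V 0 (bdryIncl v) := by
  obtain ⟨m, rfl⟩ : ∃ m, n = m + 1 := ⟨n - 1, (Nat.succ_pred (NeZero.ne n)).symm⟩
  obtain ⟨R, hR0, hR⟩ : ∃ R : ℝ, 0 < R ∧ ∀ u ∈ K, ∀ i, |u i| < R := by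
    obtain ⟨R, hR⟩ := hK.exists_norm_le
    refine ⟨|R| + 1, by positivity, fun u hu i => ?_⟩
    have h1 := PiLp.norm_apply_le u i
    have h2 := hR u hu
    rw [Real.norm_eq_abs] at h1
    linarith [le_abs_self R]
  let toL : (Fin (m + 1) → ℝ) →L[ℝ] EuclideanSpace ℝ (Fin (m + 1)) :=
    (PiLp.continuousLinearEquiv 2 ℝ (fun _ : Fin (m + 1) => ℝ)).symm.toContinuousLinearMap
  have htoL : ∀ x, toL x = WithLp.toLp 2 x := fun x => rfl
  let a : Fin (m + 1) → ℝ := Fin.cons 0 (fun _ => -R)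
  let b : Fin (m + 1) → ℝ := fun _ => R
  have hab : a ≤ b := by
    intro i
    refine Fin.cases ?_ (fun k => ?_) i
    · simpa [a, b] using hR0.le
    · simp only [a, b, Fin.cons_succ]; linarith
  have hsub : Icc a b ⊆ (WithLp.toLp 2) ⁻¹' {u : EuclideanSpace ℝ (Fin (m + 1)) | 0 ≤ u 0} := by
    intro x hx
    exact hx.1 0
  have hmp := PiLp.volume_preserving_toLp (Fin (m + 1))
  have hme : MeasurableEmbedding (@WithLp.toLp 2 (Fin (m + 1) → ℝ)) :=
    (MeasurableEquiv.toLp 2 _).measurableEmbedding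
  have hstd : ∀ i, toL (Pi.single i 1) = stdVec i := fun i => rfl
  have key := integral_divergence_of_hasFDerivAt_off_countable' a b hab
    (fun i x => V i (toL x)) (fun i x => (V' i (toL x)).comp toL) ∅ countable_empty
    (fun i => (hc i).comp toL.continuous.continuousOn hsub)
    (fun x hx i => (hd i (toL x) (by have := (hx.1 0 (mem_univ _)).1; exact this)).comp x
      toL.hasFDerivAt)
    (by
      have := (hmp.integrableOn_comp_preimage hme).2 hint
      exact this.mono_set hsub)
  have hout : ∀ x : Fin (m + 1) → ℝ, (∃ i, R ≤ |x i|) → toL x ∉ K := by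
    rintro x ⟨i, hi⟩ hx
    exact absurd (hR _ hx i) (not_lt.2 hi)
  have hlhs : ∫ u in {u : EuclideanSpace ℝ (Fin (m + 1)) | 0 ≤ u 0}, ∑ i, V' i u (stdVec i) =
      ∫ x in Icc a b, ∑ i, (V' i (toL x)).comp toL (Pi.single i 1) := by
    rw [← hmp.setIntegral_preimage_emb hme]
    change ∫ x in WithLp.toLp 2 ⁻¹' {u : EuclideanSpace ℝ (Fin (m + 1)) | 0 ≤ u 0},
      ∑ i, (V' i (toL x)).comp toL (Pi.single i 1) = _
    refine setIntegral_eq_of_subset_of_forall_sdiff_eq_zero ?_ hsub ?_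
    · exact measurableSet_le measurable_const
        ((measurable_pi_apply 0).comp (measurable_id))
    · intro x hx
      have : toL x ∉ K := by
        apply hout
        by_contra! h
        apply hx.2
        constructor
        · intro i
          refine Fin.cases ?_ (fun k => ?_) i
          · exact hx.1
          · exact (abs_lt.1 (h k.succ)).1.le
        · exact fun i => (abs_lt.1 (h i)).2.le
      refine Finset.sum_eq_zero fun i _ => ?_
      have h2 := hV'K i _ this
      rw [ContinuousLinearMap.comp_apply, h2]; rfl
  rw [hlhs, key]
  have hfront : ∀ i : Fin (m + 1), ∫ x in Icc (a ∘ i.succAbove) (b ∘ i.succAbove),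
      V i (toL (i.insertNth (b i) x)) = 0 := by
    intro i
    refine (setIntegral_congr_fun measurableSet_Icc fun x _ => ?_).trans (integral_zero _ _)
    refine hVK i _ (hout _ ⟨i, ?_⟩)
    simp [b, le_abs_self]
  have hback : ∀ k : Fin m, ∫ x in Icc (a ∘ k.succ.succAbove) (b ∘ k.succ.succAbove),
      V k.succ (toL (k.succ.insertNth (a k.succ) x)) = 0 := by
    intro k
    refine (setIntegral_congr_fun measurableSet_Icc fun x _ => ?_).trans (integral_zero _ _)
    refine hVK _ _ (hout _ ⟨k.succ, ?_⟩)
    simp [a, le_abs_self]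
  have hs : ∀ i : Fin (m + 1), (∫ x in Icc (a ∘ i.succAbove) (b ∘ i.succAbove),
      V i (toL (i.insertNth (b i) x))) - (∫ x in Icc (a ∘ i.succAbove) (b ∘ i.succAbove),
      V i (toL (i.insertNth (a i) x))) = if i = 0 then - ∫ v, V 0 (bdryIncl v) else 0 := by
    intro i
    rw [hfront]
    refine Fin.cases ?_ (fun k => ?_) i
    · rw [if_pos rfl, zero_sub, integral_toLp_fin_cons]
      congr 1
      have e1 : ∀ x : Fin m → ℝ, toL (Fin.insertNth 0 (a 0) x) = WithLp.toLp 2 (Fin.cons 0 x) := by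
        intro x
        rw [htoL, Fin.insertNth_zero]
        rfl
      simp_rw [e1]
      refine setIntegral_eq_integral_of_forall_compl_eq_zero fun x hx => ?_
      refine hVK _ _ (hout _ ?_)
      by_contra! h
      apply hx
      refine ⟨fun j => ?_, fun j => ?_⟩
      · have := h j.succ
        exact (abs_lt.1 this).1.le
      · have := h j.succ
        exact (abs_lt.1 this).2.le
    · rw [hback, if_neg (Fin.succ_ne_zero k), sub_zero]
  rw [Finset.sum_congr rfl fun i _ => hs i]
  simp

end HalfSpace

/-! ### Smooth functions in charts -/

section Charts

variable {n : ℕ} [NeZero n] {M : Type*} [TopologicalSpace M] [ChartedSpace (EuclideanHalfSpace n) M]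

/-- The derivative of `g` in the chart centred at `c`. -/
def chartDeriv (c : M) (g : M → Amb n) (p : M) : EuclideanSpace ℝ (Fin n) →L[ℝ] Amb n :=
  fderivWithin ℝ (g ∘ (extChartAt (𝓡∂ n) c).symm) (range (𝓡∂ n)) (extChartAt (𝓡∂ n) c p)

theorem coordDeriv_eq (c : M) (g : M → Amb n) (p : M) (i : Fin n) :
    coordDeriv c g p i = chartDeriv c g p (stdVec i) := rfl

theorem target_mem_nhdsWithin {c : M} {u : EuclideanSpace ℝ (Fin n)}
    (hu : u ∈ (extChartAt (𝓡∂ n) c).target) :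
    (extChartAt (𝓡∂ n) c).target ∈ 𝓝[range (𝓡∂ n)] u := by
  have := extChartAt_target_mem_nhdsWithin' (I := 𝓡∂ n) ((extChartAt (𝓡∂ n) c).map_target hu)
  rwa [(extChartAt (𝓡∂ n) c).right_inv hu] at this

theorem target_subset_halfSpace (c : M) :
    (extChartAt (𝓡∂ n) c).target ⊆ {u : EuclideanSpace ℝ (Fin n) | 0 ≤ u 0} := by
  rw [← range_modelWithCornersEuclideanHalfSpace]
  exact extChartAt_target_subset_range c

theorem target_mem_nhds {c : M} {u : EuclideanSpace ℝ (Fin n)}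
    (hu : u ∈ (extChartAt (𝓡∂ n) c).target) (h0 : 0 < u 0) :
    (extChartAt (𝓡∂ n) c).target ∈ 𝓝 u := by
  have h1 := target_mem_nhdsWithin hu
  rwa [nhdsWithin_eq_nhds.2] at h1
  rw [range_modelWithCornersEuclideanHalfSpace]
  exact Filter.mem_of_superset
    ((isOpen_lt continuous_const (PiLp.continuous_apply 2 _ 0)).mem_nhds h0)
    fun v (hv : 0 < v 0) => hv.le

theorem mem_closure_interior_target {c : M} {u : EuclideanSpace ℝ (Fin n)}
    (hu : u ∈ (extChartAt (𝓡∂ n) c).target) :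
    u ∈ closure (interior (extChartAt (𝓡∂ n) c).target) := by
  have hcl : u ∈ closure (interior (range (𝓡∂ n))) :=
    (𝓡∂ n).range_subset_closure_interior (extChartAt_target_subset_range c hu)
  rw [mem_closure_iff_nhdsWithin_neBot] at hcl ⊢
  refine hcl.mono ?_
  rw [nhdsWithin_le_iff]
  obtain ⟨O, hO, huO, hOT⟩ := mem_nhdsWithin.1 (target_mem_nhdsWithin hu)
  filter_upwards [self_mem_nhdsWithin, mem_nhdsWithin_of_mem_nhds (hO.mem_nhds huO)] with v hv hvO
  rw [mem_interior_iff_mem_nhds] at hv ⊢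
  filter_upwards [hv, hO.mem_nhds hvO] with w hw hwO
  exact hOT ⟨hwO, hw⟩

theorem measurableSet_target (c : M) : MeasurableSet (extChartAt (𝓡∂ n) c).target := by
  rw [extChartAt_target]
  refine ((((chartAt (EuclideanHalfSpace n) c).open_target).preimage
    (𝓡∂ n).continuous_symm).measurableSet).inter ?_
  rw [range_modelWithCornersEuclideanHalfSpace]
  exact (isClosed_le continuous_const (PiLp.continuous_apply 2 _ 0)).measurableSet

theorem fderivWithin_range_eq {F : Type*} [NormedAddCommGroup F] [NormedSpace ℝ F] {c : M}
    {f : EuclideanSpace ℝ (Fin n) → F} {u : EuclideanSpace ℝ (Fin n)}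
    (hu : u ∈ (extChartAt (𝓡∂ n) c).target) :
    fderivWithin ℝ f (range (𝓡∂ n)) u = fderivWithin ℝ f (extChartAt (𝓡∂ n) c).target u := by
  apply fderivWithin_congr_set
  have h1 := target_mem_nhdsWithin hu
  rw [mem_nhdsWithin_iff_eventually] at h1
  filter_upwards [h1] with v hv
  exact propext ⟨fun h => hv h, fun h => extChartAt_target_subset_range c h⟩

theorem continuousOn_chart_symm (c : M) :
    ContinuousOn (extChartAt (𝓡∂ n) c).symm (extChartAt (𝓡∂ n) c).target :=
  continuousOn_extChartAt_symm c

theorem chart_symm_mem {c : M} {u : EuclideanSpace ℝ (Fin n)}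
    (hu : u ∈ (extChartAt (𝓡∂ n) c).target) :
    (extChartAt (𝓡∂ n) c).symm u ∈ (chartAt (EuclideanHalfSpace n) c).source := by
  rw [← extChartAt_source (𝓡∂ n)]
  exact (extChartAt (𝓡∂ n) c).map_target hu

theorem chart_mem_target {c p : M} (hp : p ∈ (chartAt (EuclideanHalfSpace n) c).source) :
    extChartAt (𝓡∂ n) c p ∈ (extChartAt (𝓡∂ n) c).target := by
  rw [← extChartAt_source (𝓡∂ n)] at hp
  exact (extChartAt (𝓡∂ n) c).map_source hp

theorem chart_left_inv {c p : M} (hp : p ∈ (chartAt (EuclideanHalfSpace n) c).source) :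
    (extChartAt (𝓡∂ n) c).symm (extChartAt (𝓡∂ n) c p) = p := by
  rw [← extChartAt_source (𝓡∂ n)] at hp
  exact (extChartAt (𝓡∂ n) c).left_inv hp

theorem mem_chart_source' (c : M) : c ∈ (chartAt (EuclideanHalfSpace n) c).source :=
  mem_chart_source _ c

variable [IsManifold (𝓡∂ n) ∞ M] {F : Type*} [NormedAddCommGroup F] [NormedSpace ℝ F]

theorem contDiffOn_chart {g : M → F} (hg : ContMDiff (𝓡∂ n) 𝓘(ℝ, F) ∞ g) (c : M) :
    ContDiffOn ℝ ∞ (g ∘ (extChartAt (𝓡∂ n) c).symm) (extChartAt (𝓡∂ n) c).target := by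
  rw [← contMDiffOn_iff_contDiffOn]
  exact hg.comp_contMDiffOn (contMDiffOn_extChartAt_symm c)

theorem contDiffOn_coordDeriv {g : M → Amb n} (hg : ContMDiff (𝓡∂ n) 𝓘(ℝ, Amb n) ∞ g) (c : M)
    (i : Fin n) :
    ContDiffOn ℝ ∞ (fun u => coordDeriv c g ((extChartAt (𝓡∂ n) c).symm u) i)
      (extChartAt (𝓡∂ n) c).target := by
  have h1 := (contDiffOn_chart hg c).fderivWithin (m := ∞) (uniqueDiffOn_extChartAt_target c)
    (by simp)
  refine (h1.clm_apply (contDiffOn_const (c := stdVec i))).congr fun u hu => ?_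
  rw [coordDeriv, (extChartAt (𝓡∂ n) c).right_inv hu, fderivWithin_range_eq hu]

theorem continuousOn_coordDeriv_chart {g : M → Amb n} (hg : ContMDiff (𝓡∂ n) 𝓘(ℝ, Amb n) ∞ g)
    (c : M) (i : Fin n) :
    ContinuousOn (fun u => coordDeriv c g ((extChartAt (𝓡∂ n) c).symm u) i)
      (extChartAt (𝓡∂ n) c).target :=
  (contDiffOn_coordDeriv hg c i).continuousOn

theorem continuousOn_coordDeriv {g : M → Amb n} (hg : ContMDiff (𝓡∂ n) 𝓘(ℝ, Amb n) ∞ g)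
    (c : M) (i : Fin n) :
    ContinuousOn (fun p => coordDeriv c g p i) (chartAt (EuclideanHalfSpace n) c).source := by
  have h1 := (continuousOn_coordDeriv_chart hg c i).comp
    (continuousOn_extChartAt (I := 𝓡∂ n) c) (by
      intro p hp
      exact (extChartAt (𝓡∂ n) c).map_source hp)
  rw [extChartAt_source] at h1
  refine h1.congr fun p hp => ?_
  simp only [Function.comp_apply, chart_left_inv hp]

theorem hasFDerivWithinAt_chart {g : M → Amb n} (hg : ContMDiff (𝓡∂ n) 𝓘(ℝ, Amb n) ∞ g) {c p : M}
    (hp : p ∈ (chartAt (EuclideanHalfSpace n) c).source) :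
    HasFDerivWithinAt (g ∘ (extChartAt (𝓡∂ n) c).symm) (chartDeriv c g p) (range (𝓡∂ n))
      (extChartAt (𝓡∂ n) c p) := by
  have hu := chart_mem_target hp
  refine DifferentiableWithinAt.hasFDerivWithinAt ?_
  refine DifferentiableWithinAt.mono_of_mem_nhdsWithin
    ((contDiffOn_chart hg c).differentiableOn (by simp) _ hu) ?_
  exact target_mem_nhdsWithin hu

theorem hasFDerivAt_chart {g : M → Amb n} (hg : ContMDiff (𝓡∂ n) 𝓘(ℝ, Amb n) ∞ g) {c : M}
    {u : EuclideanSpace ℝ (Fin n)} (hu : u ∈ (extChartAt (𝓡∂ n) c).target) (h0 : 0 < u 0) :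
    HasFDerivAt (g ∘ (extChartAt (𝓡∂ n) c).symm)
      (chartDeriv c g ((extChartAt (𝓡∂ n) c).symm u)) u := by
  have h1 := hasFDerivWithinAt_chart hg (chart_symm_mem hu)
  rw [(extChartAt (𝓡∂ n) c).right_inv hu] at h1
  exact h1.hasFDerivAt (Filter.mem_of_superset (target_mem_nhds hu h0)
    (extChartAt_target_subset_range c))

theorem uniqueDiff_range (u : EuclideanSpace ℝ (Fin n)) (hu : u ∈ range (𝓡∂ n)) :
    UniqueDiffWithinAt ℝ (range (𝓡∂ n)) u := (𝓡∂ n).uniqueDiffOn u hu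

omit [IsManifold (𝓡∂ n) ∞ M] in
theorem chart_mem_range (c p : M) : extChartAt (𝓡∂ n) c p ∈ range (𝓡∂ n) :=
  mem_range_self _

theorem chartDeriv_comp {g : M → Amb n} (hg : ContMDiff (𝓡∂ n) 𝓘(ℝ, Amb n) ∞ g) {c c' p : M}
    (hp : p ∈ (chartAt (EuclideanHalfSpace n) c).source)
    (hp' : p ∈ (chartAt (EuclideanHalfSpace n) c').source) :
    chartDeriv c g p = (chartDeriv c' g p).comp (tangentCoordChange (𝓡∂ n) c c' p) := by
  have h1 := hasFDerivWithinAt_chart hg hp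
  have h2 := hasFDerivWithinAt_tangentCoordChange (I := 𝓡∂ n) (x := c) (y := c') (z := p)
    (by rw [extChartAt_source, extChartAt_source]; exact ⟨hp, hp'⟩)
  have h3 := hasFDerivWithinAt_chart hg hp'
  have h4 : HasFDerivWithinAt ((g ∘ (extChartAt (𝓡∂ n) c').symm) ∘
      ((extChartAt (𝓡∂ n) c') ∘ (extChartAt (𝓡∂ n) c).symm))
      ((chartDeriv c' g p).comp (tangentCoordChange (𝓡∂ n) c c' p)) (range (𝓡∂ n))
      (extChartAt (𝓡∂ n) c p) := by
    refine HasFDerivWithinAt.comp (t := range (𝓡∂ n)) _ ?_ h2 ?_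
    · simp only [Function.comp_apply, chart_left_inv hp]
      exact h3
    · intro v _
      exact chart_mem_range _ _
  have h5 : (g ∘ (extChartAt (𝓡∂ n) c).symm) =ᶠ[𝓝[range (𝓡∂ n)] (extChartAt (𝓡∂ n) c p)]
      ((g ∘ (extChartAt (𝓡∂ n) c').symm) ∘
      ((extChartAt (𝓡∂ n) c') ∘ (extChartAt (𝓡∂ n) c).symm)) := by
    have h6 : (extChartAt (𝓡∂ n) c).symm ⁻¹' (chartAt (EuclideanHalfSpace n) c').source ∈
        𝓝[range (𝓡∂ n)] (extChartAt (𝓡∂ n) c p) := by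
      have h7 : ContinuousWithinAt (extChartAt (𝓡∂ n) c).symm (range (𝓡∂ n))
          (extChartAt (𝓡∂ n) c p) :=
        (continuousAt_extChartAt_symm' (by rwa [extChartAt_source])).continuousWithinAt
      apply h7
      rw [chart_left_inv hp]
      exact (chartAt (EuclideanHalfSpace n) c').open_source.mem_nhds hp'
    filter_upwards [h6] with v hv
    simp only [Function.comp_apply, chart_left_inv hv]
  exact (uniqueDiff_range _ (chart_mem_range c p)).eq h1
    (h4.congr_of_eventuallyEq h5 (by simp only [Function.comp_apply, chart_left_inv hp,
      chart_left_inv hp']))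

theorem det_tangentCoordChange_ne_zero {c c' p : M}
    (hp : p ∈ (chartAt (EuclideanHalfSpace n) c).source)
    (hp' : p ∈ (chartAt (EuclideanHalfSpace n) c').source) :
    (tangentCoordChange (𝓡∂ n) c c' p).det ≠ 0 := by
  have h : (tangentCoordChange (𝓡∂ n) c' c p).comp (tangentCoordChange (𝓡∂ n) c c' p) =
      ContinuousLinearMap.id ℝ _ := by
    ext1 v
    rw [ContinuousLinearMap.comp_apply, tangentCoordChange_comp, tangentCoordChange_self]
    · rfl
    · rwa [extChartAt_source]
    · simp only [extChartAt_source]; exact ⟨⟨hp, hp'⟩, hp⟩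
  have h2 := congrArg ContinuousLinearMap.det h
  rw [ContinuousLinearMap.det, ContinuousLinearMap.toLinearMap_comp, LinearMap.det_comp] at h2
  intro h3
  rw [← ContinuousLinearMap.det, ← ContinuousLinearMap.det, h3, mul_zero] at h2
  simp [ContinuousLinearMap.det] at h2

omit [IsManifold (𝓡∂ n) ∞ M] in
theorem coordDeriv_add {g h : M → Amb n} {c p : M}
    (hg : DifferentiableWithinAt ℝ (g ∘ (extChartAt (𝓡∂ n) c).symm) (range (𝓡∂ n))
      (extChartAt (𝓡∂ n) c p))
    (hh : DifferentiableWithinAt ℝ (h ∘ (extChartAt (𝓡∂ n) c).symm) (range (𝓡∂ n))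
      (extChartAt (𝓡∂ n) c p)) :
    coordDeriv c (g + h) p = coordDeriv c g p + coordDeriv c h p := by
  ext1 i
  rw [coordDeriv, Pi.add_comp, fderivWithin_add (uniqueDiff_range _ (chart_mem_range c p)) hg hh]
  rfl

theorem differentiableWithinAt_chart {g : M → Amb n} (hg : ContMDiff (𝓡∂ n) 𝓘(ℝ, Amb n) ∞ g)
    {c p : M} (hp : p ∈ (chartAt (EuclideanHalfSpace n) c).source) :
    DifferentiableWithinAt ℝ (g ∘ (extChartAt (𝓡∂ n) c).symm) (range (𝓡∂ n))
      (extChartAt (𝓡∂ n) c p) := (hasFDerivWithinAt_chart hg hp).differentiableWithinAt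

omit [IsManifold (𝓡∂ n) ∞ M] in
theorem coordDeriv_const_smul (r : ℝ) (g : M → Amb n) (c p : M) :
    coordDeriv c (r • g) p = r • coordDeriv c g p := by
  ext1 i
  have : (r • g) ∘ (extChartAt (𝓡∂ n) c).symm = r • (g ∘ (extChartAt (𝓡∂ n) c).symm) := rfl
  rw [coordDeriv, this, fderivWithin_const_smul_field]
  · rfl
  · exact uniqueDiff_range _ (chart_mem_range c p)

omit [IsManifold (𝓡∂ n) ∞ M] in
theorem coordDeriv_const (b : Amb n) (c p : M) : coordDeriv c (fun _ => b) p = 0 := by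
  ext1 i
  have : (fun _ : M => b) ∘ (extChartAt (𝓡∂ n) c).symm = fun _ => b := rfl
  rw [coordDeriv, this, fderivWithin_const_apply]
  rfl

theorem coordDeriv_sum {α : Type*} (s : Finset α) (g : α → M → Amb n)
    (hg : ∀ k ∈ s, ContMDiff (𝓡∂ n) 𝓘(ℝ, Amb n) ∞ (g k)) {c p : M}
    (hp : p ∈ (chartAt (EuclideanHalfSpace n) c).source) (i : Fin n) :
    coordDeriv c (fun q => ∑ k ∈ s, g k q) p i = ∑ k ∈ s, coordDeriv c (g k) p i := by
  have h : (fun q => ∑ k ∈ s, g k q) ∘ (extChartAt (𝓡∂ n) c).symm =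
      fun u => ∑ k ∈ s, (g k ∘ (extChartAt (𝓡∂ n) c).symm) u := rfl
  have h1 : HasFDerivWithinAt (fun u => ∑ k ∈ s, (g k ∘ (extChartAt (𝓡∂ n) c).symm) u)
      (∑ k ∈ s, chartDeriv c (g k) p) (range (𝓡∂ n)) (extChartAt (𝓡∂ n) c p) :=
    HasFDerivWithinAt.fun_sum fun k hk => hasFDerivWithinAt_chart (hg k hk) hp
  rw [coordDeriv, h, h1.fderivWithin (uniqueDiff_range _ (chart_mem_range c p)), _root_.sum_apply]
  rfl

/-- Second derivatives in a chart are symmetric, up to the boundary. -/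
theorem fderivWithin_coordDeriv_symm {g : M → Amb n} (hg : ContMDiff (𝓡∂ n) 𝓘(ℝ, Amb n) ∞ g)
    {c : M} {u : EuclideanSpace ℝ (Fin n)} (hu : u ∈ (extChartAt (𝓡∂ n) c).target) (i j : Fin n) :
    fderivWithin ℝ (fun v => coordDeriv c g ((extChartAt (𝓡∂ n) c).symm v) i)
      (extChartAt (𝓡∂ n) c).target u (stdVec j) =
    fderivWithin ℝ (fun v => coordDeriv c g ((extChartAt (𝓡∂ n) c).symm v) j)
      (extChartAt (𝓡∂ n) c).target u (stdVec i) := by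
  set T := (extChartAt (𝓡∂ n) c).target
  set f := g ∘ (extChartAt (𝓡∂ n) c).symm
  have hf : ContDiffOn ℝ ∞ f T := contDiffOn_chart hg c
  have hT : UniqueDiffOn ℝ T := uniqueDiffOn_extChartAt_target c
  have h1 : ∀ k, fderivWithin ℝ (fun v => coordDeriv c g ((extChartAt (𝓡∂ n) c).symm v) k) T u =
      (fderivWithin ℝ (fderivWithin ℝ f T) T u).flip (stdVec k) := by
    intro k
    have h2 : fderivWithin ℝ (fun v => coordDeriv c g ((extChartAt (𝓡∂ n) c).symm v) k) T u =
        fderivWithin ℝ (fun v => fderivWithin ℝ f T v (stdVec k)) T u := by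
      refine fderivWithin_congr (fun v hv => ?_) ?_
      · rw [coordDeriv, (extChartAt (𝓡∂ n) c).right_inv hv, fderivWithin_range_eq hv]
      · rw [coordDeriv, (extChartAt (𝓡∂ n) c).right_inv hu, fderivWithin_range_eq hu]
    rw [h2]
    have h3 := (hf.fderivWithin (m := ∞) hT (by simp)).differentiableOn (by simp) u hu
    have h4 := (h3.hasFDerivWithinAt.clm_apply
      (hasFDerivWithinAt_const (stdVec k) u T)).fderivWithin (hT u hu)
    rw [h4]
    ext1 w
    simp
  rw [h1, h1]
  refine (ContDiffWithinAt.isSymmSndFDerivWithinAt (n := ∞) (hf u hu)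
    (by simp only [minSmoothness_of_isRCLikeNormedField]; exact ENat.LEInfty.out) hT
    (mem_closure_interior_target hu) hu) _ _

end Charts

/-! ### Geometry of capillary hypersurfaces in charts -/

section Geometry

variable {n : ℕ} [NeZero n] {M : Type*} [TopologicalSpace M] [ChartedSpace (EuclideanHalfSpace n) M]
  [IsManifold (𝓡∂ n) ∞ M] {θ : ℝ} {x ν : M → Amb n}

theorem eq_sum_stdVec (v : EuclideanSpace ℝ (Fin n)) : v = ∑ i, v i • stdVec i := by
  conv_lhs => rw [← (EuclideanSpace.basisFun (Fin n) ℝ).sum_repr v]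
  simp

theorem IsCapillary.inner_chartDeriv (hx : IsCapillary θ x ν) {c p : M}
    (hp : p ∈ (chartAt (EuclideanHalfSpace n) c).source) (v : EuclideanSpace ℝ (Fin n)) :
    inner ℝ (ν p) (chartDeriv c x p v) = 0 := by
  have h1 : ∀ w, inner ℝ (ν p) (chartDeriv p x p w) = 0 := by
    intro w
    rw [eq_sum_stdVec w, map_sum, inner_sum]
    refine Finset.sum_eq_zero fun i _ => ?_
    rw [map_smul, inner_smul_right, ← coordDeriv_eq, hx.orthogonal, mul_zero]
  rw [chartDeriv_comp hx.smooth hp (mem_chart_source' p)]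
  exact h1 _

theorem IsCapillary.inner_coordDeriv (hx : IsCapillary θ x ν) {c p : M}
    (hp : p ∈ (chartAt (EuclideanHalfSpace n) c).source) (i : Fin n) :
    inner ℝ (coordDeriv c x p i) (ν p) = 0 := by
  rw [real_inner_comm]; exact hx.inner_chartDeriv hp _

theorem IsCapillary.inner_coordDeriv_normal (hx : IsCapillary θ x ν) {c p : M}
    (hp : p ∈ (chartAt (EuclideanHalfSpace n) c).source) (i : Fin n) :
    inner ℝ (coordDeriv c ν p i) (ν p) = 0 := by
  have h1 := hasFDerivWithinAt_chart hx.smooth_normal hp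
  have h2 := h1.inner ℝ h1
  have h3 : (fun t => inner ℝ ((ν ∘ (extChartAt (𝓡∂ n) c).symm) t)
      ((ν ∘ (extChartAt (𝓡∂ n) c).symm) t)) = fun _ => (1 : ℝ) := by
    ext1 t
    simp [hx.unit_normal]
  rw [h3] at h2
  have h4 := (uniqueDiff_range _ (chart_mem_range c p)).eq h2
    (hasFDerivWithinAt_const (1 : ℝ) _ _)
  have h5 := congrArg (fun L => L (stdVec i)) h4
  simp only [ContinuousLinearMap.comp_apply, ContinuousLinearMap.prod_apply,
    fderivInnerCLM_apply, Function.comp_apply, chart_left_inv hp,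
    _root_.zero_apply] at h5
  rw [← coordDeriv_eq, real_inner_comm] at h5
  linarith

theorem IsCapillary.chartDeriv_injective (hx : IsCapillary θ x ν) {c p : M}
    (hp : p ∈ (chartAt (EuclideanHalfSpace n) c).source) :
    Function.Injective (chartDeriv c x p) := by
  have h1 : Function.Injective (chartDeriv p x p) := by
    have h := hx.immersion p
    have h2 : chartDeriv p x p = mfderiv (𝓡∂ n) 𝓘(ℝ, Amb n) x p :=
      (hx.smooth.mdifferentiableAt (by simp)).mfderiv.symm
    rw [h2]
    exact h
  rw [chartDeriv_comp hx.smooth hp (mem_chart_source' p)]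
  refine h1.comp ?_
  have hd := det_tangentCoordChange_ne_zero hp (mem_chart_source' p)
  have := (LinearMap.equivOfDetNeZero _ hd).injective
  exact this

theorem IsCapillary.linearIndependent (hx : IsCapillary θ x ν) {c p : M}
    (hp : p ∈ (chartAt (EuclideanHalfSpace n) c).source) :
    LinearIndependent ℝ (coordDeriv c x p) := by
  have h1 : LinearIndependent ℝ (fun i : Fin n => stdVec i) := by
    have := (EuclideanSpace.basisFun (Fin n) ℝ).toBasis.linearIndependent
    convert! this using 1
    ext1 i
    simp
  exact h1.map' (chartDeriv c x p).toLinearMap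
    (LinearMap.ker_eq_bot.2 (hx.chartDeriv_injective hp))

theorem IsCapillary.posDef (hx : IsCapillary θ x ν) {c p : M}
    (hp : p ∈ (chartAt (EuclideanHalfSpace n) c).source) : (pairing c x x p).PosDef :=
  Matrix.posDef_gram_of_linearIndependent (hx.linearIndependent hp)

/-- The density of the area element in the chart centred at `c`, up to its sign. -/
def areaForm (x ν : M → Amb n) (c p : M) : ℝ := frameDet (ν p) (coordDeriv c x p)

theorem IsCapillary.areaForm_sq (hx : IsCapillary θ x ν) {c p : M}
    (hp : p ∈ (chartAt (EuclideanHalfSpace n) c).source) :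
    areaForm x ν c p ^ 2 = (pairing c x x p).det :=
  frameDet_sq (hx.unit_normal p) fun i => hx.inner_coordDeriv hp i

theorem IsCapillary.areaForm_ne_zero (hx : IsCapillary θ x ν) {c p : M}
    (hp : p ∈ (chartAt (EuclideanHalfSpace n) c).source) : areaForm x ν c p ≠ 0 := by
  intro h
  have h1 := hx.areaForm_sq hp
  rw [h] at h1
  have := (hx.posDef hp).det_pos
  rw [← h1] at this
  simp at this

theorem IsCapillary.sqrt_det (hx : IsCapillary θ x ν) {c p : M}
    (hp : p ∈ (chartAt (EuclideanHalfSpace n) c).source) :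
    Real.sqrt (pairing c x x p).det = |areaForm x ν c p| := by
  rw [← hx.areaForm_sq hp, Real.sqrt_sq_eq_abs]

theorem IsCapillary.pairing_isHermitian (hx : IsCapillary θ x ν) {c p : M}
    (hp : p ∈ (chartAt (EuclideanHalfSpace n) c).source) : (pairing c ν x p).IsHermitian := by
  set T := (extChartAt (𝓡∂ n) c).target
  set u := extChartAt (𝓡∂ n) c p with hu'
  have hu : u ∈ T := chart_mem_target hp
  have hpu : (extChartAt (𝓡∂ n) c).symm u = p := chart_left_inv hp
  have key : ∀ i j, inner ℝ (coordDeriv c ν p i) (coordDeriv c x p j) = - inner ℝ (ν p)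
      (fderivWithin ℝ (fun v => coordDeriv c x ((extChartAt (𝓡∂ n) c).symm v) j) T u
        (stdVec i)) := by
    intro i j
    have h1 : HasFDerivWithinAt (ν ∘ (extChartAt (𝓡∂ n) c).symm) (chartDeriv c ν p) T u :=
      (hasFDerivWithinAt_chart hx.smooth_normal hp).mono (extChartAt_target_subset_range c)
    have h2 := ((contDiffOn_coordDeriv hx.smooth c j).differentiableOn (by simp) u
      hu).hasFDerivWithinAt
    have h3 := h1.inner ℝ h2
    have h4 : HasFDerivWithinAt (fun t => inner ℝ ((ν ∘ (extChartAt (𝓡∂ n) c).symm) t)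
      (coordDeriv c x ((extChartAt (𝓡∂ n) c).symm t) j)) (0 : _ →L[ℝ] ℝ) T u := by
      refine (hasFDerivWithinAt_const (0 : ℝ) u T).congr (fun t ht => ?_) ?_
      · exact hx.inner_chartDeriv (chart_symm_mem ht) _
      · exact hx.inner_chartDeriv (chart_symm_mem hu) _
    have h5 := (uniqueDiffOn_extChartAt_target c u hu).eq h3 h4
    have h6 := congrArg (fun L => L (stdVec i)) h5
    simp only [ContinuousLinearMap.comp_apply, ContinuousLinearMap.prod_apply,
      fderivInnerCLM_apply, Function.comp_apply, hpu, _root_.zero_apply] at h6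
    rw [← coordDeriv_eq] at h6
    linarith
  ext i j
  simp only [pairing, Matrix.conjTranspose_apply, Matrix.of_apply, star_trivial]
  rw [key, key, fderivWithin_coordDeriv_symm hx.smooth hu]

/-! ### Top degree forms -/

variable (n) in
/-- A family of functions that transforms like the coefficient of an `n`-form. -/
def IsTopForm (Θ : M → M → ℝ) : Prop :=
  ∀ c c' p, p ∈ (chartAt (EuclideanHalfSpace n) c).source →
    p ∈ (chartAt (EuclideanHalfSpace n) c').source →
    Θ c p = (tangentCoordChange (𝓡∂ n) c c' p).det * Θ c' p

theorem isTopForm_frameDet (b : M → Amb n) {y : M → Amb n}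
    (hy : ContMDiff (𝓡∂ n) 𝓘(ℝ, Amb n) ∞ y) :
    IsTopForm n (fun c p => frameDet (b p) (coordDeriv c y p)) := by
  intro c c' p hp hp'
  have h : ∀ i, coordDeriv c y p i =
      chartDeriv c' y p (tangentCoordChange (𝓡∂ n) c c' p (stdVec i)) := by
    intro i
    rw [coordDeriv_eq, chartDeriv_comp hy hp hp']; rfl
  have h1 : coordDeriv c y p = fun i =>
      chartDeriv c' y p (tangentCoordChange (𝓡∂ n) c c' p (stdVec i)) := funext h
  simp only [h1, frameDet_comp]
  rfl

theorem isTopForm_frameVar (b : M → Amb n) {y a : M → Amb n}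
    (hy : ContMDiff (𝓡∂ n) 𝓘(ℝ, Amb n) ∞ y) (ha : ContMDiff (𝓡∂ n) 𝓘(ℝ, Amb n) ∞ a) :
    IsTopForm n (fun c p => frameVar (b p) (coordDeriv c y p) (coordDeriv c a p)) := by
  intro c c' p hp hp'
  have h1 : coordDeriv c y p = fun i =>
      chartDeriv c' y p (tangentCoordChange (𝓡∂ n) c c' p (stdVec i)) := by
    ext1 i; rw [coordDeriv_eq, chartDeriv_comp hy hp hp']; rfl
  have h2 : coordDeriv c a p = fun i =>
      chartDeriv c' a p (tangentCoordChange (𝓡∂ n) c c' p (stdVec i)) := by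
    ext1 i; rw [coordDeriv_eq, chartDeriv_comp ha hp hp']; rfl
  simp only [h1, h2, frameVar_comp]
  rfl

theorem IsTopForm.sub {Θ Θ' : M → M → ℝ} (h : IsTopForm n Θ) (h' : IsTopForm n Θ') :
    IsTopForm n (fun c p => Θ c p - Θ' c p) := by
  intro c c' p hp hp'
  simp only [h c c' p hp hp', h' c c' p hp hp']
  ring

/-- The ratio of a top form to the area form, as a function on the manifold. -/
def density (x ν : M → Amb n) (Θ : M → M → ℝ) (p : M) : ℝ := Θ p p / areaForm x ν p p

theorem IsCapillary.density_eq (hx : IsCapillary θ x ν) {Θ : M → M → ℝ} (hΘ : IsTopForm n Θ)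
    {c p : M} (hp : p ∈ (chartAt (EuclideanHalfSpace n) c).source) :
    density x ν Θ p = Θ c p / areaForm x ν c p := by
  rw [density, hΘ c p p hp (mem_chart_source' p),
    show areaForm x ν c p = (tangentCoordChange (𝓡∂ n) c p p).det * areaForm x ν p p from
      isTopForm_frameDet ν hx.smooth c p p hp (mem_chart_source' p),
    mul_div_mul_left _ _ (det_tangentCoordChange_ne_zero hp (mem_chart_source' p))]

/-- The sign of the area form. -/
def orient (x ν : M → Amb n) (c p : M) : ℝ := areaForm x ν c p / |areaForm x ν c p|

theorem IsCapillary.density_mul_sqrt (hx : IsCapillary θ x ν) {Θ : M → M → ℝ} (hΘ : IsTopForm n Θ)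
    {c p : M} (hp : p ∈ (chartAt (EuclideanHalfSpace n) c).source) :
    density x ν Θ p * Real.sqrt (pairing c x x p).det = orient x ν c p * Θ c p := by
  have h := hx.areaForm_ne_zero hp
  have h' : |areaForm x ν c p| ≠ 0 := abs_ne_zero.2 h
  rw [hx.density_eq hΘ hp, hx.sqrt_det hp, orient]
  field_simp
  rw [sq_abs]

theorem continuousOn_frameDet {X : Type*} [TopologicalSpace X]
    {b : X → Amb n} {v : X → Fin n → Amb n} {s : Set X}
    (hb : ContinuousOn b s) (hv : ∀ i, ContinuousOn (fun p => v p i) s) :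
    ContinuousOn (fun p => frameDet (b p) (v p)) s :=
  continuous_frameDet.comp_continuousOn (hb.prodMk (continuousOn_pi.2 hv))

theorem continuousOn_frameVar {X : Type*} [TopologicalSpace X]
    {b : X → Amb n} {v a : X → Fin n → Amb n} {s : Set X}
    (hb : ContinuousOn b s) (hv : ∀ i, ContinuousOn (fun p => v p i) s)
    (ha : ∀ i, ContinuousOn (fun p => a p i) s) :
    ContinuousOn (fun p => frameVar (b p) (v p) (a p)) s := by
  refine continuousOn_finsetSum _ fun i _ => ?_
  refine continuousOn_frameDet hb fun j => ?_
  by_cases h : j = i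
  · subst h; simpa using ha j
  · simpa [Function.update_of_ne h] using hv j

theorem IsCapillary.continuousOn_areaForm (hx : IsCapillary θ x ν) (c : M) :
    ContinuousOn (areaForm x ν c) (chartAt (EuclideanHalfSpace n) c).source :=
  continuousOn_frameDet hx.smooth_normal.continuous.continuousOn
    fun i => continuousOn_coordDeriv hx.smooth c i

theorem IsCapillary.continuous_density (hx : IsCapillary θ x ν) {Θ : M → M → ℝ}
    (hΘ : IsTopForm n Θ)
    (hc : ∀ c, ContinuousOn (Θ c) (chartAt (EuclideanHalfSpace n) c).source) :
    Continuous (density x ν Θ) := by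
  rw [continuous_iff_continuousAt]
  intro c
  have h1 : ContinuousOn (fun p => Θ c p / areaForm x ν c p)
      (chartAt (EuclideanHalfSpace n) c).source :=
    (hc c).div (hx.continuousOn_areaForm c) fun p hp => hx.areaForm_ne_zero hp
  have hmem := (chartAt (EuclideanHalfSpace n) c).open_source.mem_nhds (mem_chart_source' c)
  refine (h1.continuousAt hmem).congr ?_
  filter_upwards [hmem] with p hp
  exact (hx.density_eq hΘ hp).symm

end Geometry

/-! ### Surface integrals -/

section Integrals

open MeasureTheory

variable {n : ℕ} [NeZero n] {M : Type*} [TopologicalSpace M] [ChartedSpace (EuclideanHalfSpace n) M]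
  [IsManifold (𝓡∂ n) ∞ M] [CompactSpace M] [T2Space M] {θ : ℝ} {x ν : M → Amb n}

theorem tsupport_chartPartition_subset (c : M) :
    tsupport (chartPartition n M c) ⊆ (chartAt (EuclideanHalfSpace n) c).source :=
  chartPartition_isSubordinate n M c

theorem isCompact_tsupport_chartPartition (c : M) : IsCompact (tsupport (chartPartition n M c)) :=
  (isClosed_tsupport _).isCompact

theorem contMDiff_chartPartition (c : M) : ContMDiff (𝓡∂ n) 𝓘(ℝ, ℝ) ∞ (chartPartition n M c) :=
  (chartPartition n M c).contMDiff

theorem continuous_chartPartition (c : M) : Continuous (chartPartition n M c) :=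
  (contMDiff_chartPartition c).continuous

variable (n M) in
theorem exists_activeCharts : ∃ S : Finset M, ∀ c ∉ S, ∀ p, chartPartition n M c p = 0 := by
  have h := (chartPartition n M).locallyFinite.finite_nonempty_of_compact
  refine ⟨h.toFinset, fun c hc p => ?_⟩
  by_contra hp
  exact hc (h.mem_toFinset.2 ⟨p, hp⟩)

variable (n M) in
/-- The finitely many charts on which the partition of unity does not vanish. -/
def activeCharts : Finset M := (exists_activeCharts n M).choose

theorem chartPartition_eq_zero {c : M} (hc : c ∉ activeCharts n M) (p : M) :
    chartPartition n M c p = 0 :=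
  (exists_activeCharts n M).choose_spec c hc p

theorem sum_chartPartition (p : M) : ∑ c ∈ activeCharts n M, chartPartition n M c p = 1 := by
  rw [← (chartPartition n M).sum_eq_one (mem_univ p)]
  refine (finsum_eq_sum_of_support_subset _ fun c hc => ?_).symm
  by_contra h
  exact hc (chartPartition_eq_zero (by simpa using h) p)

theorem surfaceIntegral_eq_sum (x : M → Amb n) (φ : M → ℝ) :
    surfaceIntegral x φ = ∑ c ∈ activeCharts n M, ∫ u in (extChartAt (𝓡∂ n) c).target,
      chartPartition n M c ((extChartAt (𝓡∂ n) c).symm u) * φ ((extChartAt (𝓡∂ n) c).symm u) *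
        Real.sqrt (pairing c x x ((extChartAt (𝓡∂ n) c).symm u)).det := by
  refine finsum_eq_sum_of_support_subset _ fun c hc => ?_
  by_contra h
  refine hc ?_
  simp only [chartPartition_eq_zero (show c ∉ activeCharts n M by simpa using h), zero_mul,
    integral_zero]

theorem bdryIntegral_eq_sum (x : M → Amb n) (φ : M → ℝ) :
    bdryIntegral x φ = ∑ c ∈ activeCharts n M,
      ∫ v in (bdryIncl ⁻¹' (extChartAt (𝓡∂ n) c).target),
      chartPartition n M c ((extChartAt (𝓡∂ n) c).symm (bdryIncl v)) *
        φ ((extChartAt (𝓡∂ n) c).symm (bdryIncl v)) *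
        Real.sqrt (bdryPairing c x x ((extChartAt (𝓡∂ n) c).symm (bdryIncl v))).det := by
  refine finsum_eq_sum_of_support_subset _ fun c hc => ?_
  by_contra h
  refine hc ?_
  simp only [chartPartition_eq_zero (show c ∉ activeCharts n M by simpa using h), zero_mul,
    integral_zero]

theorem integrableOn_chart {c : M} {ψ : EuclideanSpace ℝ (Fin n) → ℝ}
    (hψ : ContinuousOn ψ (extChartAt (𝓡∂ n) c).target) {K : Set M} (hK : IsCompact K)
    (hKc : K ⊆ (chartAt (EuclideanHalfSpace n) c).source)
    (h0 : ∀ u ∈ (extChartAt (𝓡∂ n) c).target, (extChartAt (𝓡∂ n) c).symm u ∉ K → ψ u = 0) :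
    IntegrableOn ψ (extChartAt (𝓡∂ n) c).target := by
  have hKc' : K ⊆ (extChartAt (𝓡∂ n) c).source := by rwa [extChartAt_source]
  have hK' : IsCompact (extChartAt (𝓡∂ n) c '' K) :=
    hK.image_of_continuousOn ((continuousOn_extChartAt c).mono hKc')
  have hsub : extChartAt (𝓡∂ n) c '' K ⊆ (extChartAt (𝓡∂ n) c).target := by
    rintro _ ⟨p, hp, rfl⟩
    exact chart_mem_target (hKc hp)
  refine IntegrableOn.of_forall_sdiff_eq_zero ((hψ.mono hsub).integrableOn_compact hK')
    (measurableSet_target c) fun u hu => h0 u hu.1 fun h => hu.2 ?_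
  exact ⟨_, h, (extChartAt (𝓡∂ n) c).right_inv hu.1⟩

theorem continuousOn_sqrt_det (hx : IsCapillary θ x ν) (c : M) :
    ContinuousOn (fun u => Real.sqrt (pairing c x x ((extChartAt (𝓡∂ n) c).symm u)).det)
      (extChartAt (𝓡∂ n) c).target := by
  have h1 : ContinuousOn (fun u => |areaForm x ν c ((extChartAt (𝓡∂ n) c).symm u)|)
      (extChartAt (𝓡∂ n) c).target :=
    ((hx.continuousOn_areaForm c).comp (continuousOn_chart_symm c)
      fun u hu => chart_symm_mem hu).abs
  exact h1.congr fun u hu => hx.sqrt_det (chart_symm_mem hu)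

theorem integrableOn_chart_mul (hx : IsCapillary θ x ν) {ψ : M → ℝ} (hψ : Continuous ψ) {c : M}
    (hc : tsupport ψ ⊆ (chartAt (EuclideanHalfSpace n) c).source) :
    IntegrableOn (fun u => ψ ((extChartAt (𝓡∂ n) c).symm u) *
      Real.sqrt (pairing c x x ((extChartAt (𝓡∂ n) c).symm u)).det)
      (extChartAt (𝓡∂ n) c).target := by
  refine integrableOn_chart ?_ (isClosed_tsupport ψ).isCompact hc fun u _ h => ?_
  · exact (hψ.comp_continuousOn (continuousOn_chart_symm c)).mul (continuousOn_sqrt_det hx c)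
  · simp only [image_eq_zero_of_notMem_tsupport h, zero_mul]

theorem tsupport_chartPartition_mul_subset (c : M) (φ : M → ℝ) :
    tsupport (fun p => chartPartition n M c p * φ p) ⊆
      (chartAt (EuclideanHalfSpace n) c).source :=
  (tsupport_mul_subset_left (f := chartPartition n M c) (g := φ)).trans
    (tsupport_chartPartition_subset c)

theorem integrableOn_surface (hx : IsCapillary θ x ν) {φ : M → ℝ} (hφ : Continuous φ) (c : M) :
    IntegrableOn (fun u => chartPartition n M c ((extChartAt (𝓡∂ n) c).symm u) *
      φ ((extChartAt (𝓡∂ n) c).symm u) *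
      Real.sqrt (pairing c x x ((extChartAt (𝓡∂ n) c).symm u)).det)
      (extChartAt (𝓡∂ n) c).target :=
  integrableOn_chart_mul hx ((continuous_chartPartition c).mul hφ)
    (tsupport_chartPartition_mul_subset c φ)

theorem surfaceIntegral_add (hx : IsCapillary θ x ν) {φ ψ : M → ℝ} (hφ : Continuous φ)
    (hψ : Continuous ψ) :
    surfaceIntegral x (fun p => φ p + ψ p) = surfaceIntegral x φ + surfaceIntegral x ψ := by
  simp only [surfaceIntegral_eq_sum, ← Finset.sum_add_distrib]
  refine Finset.sum_congr rfl fun c _ => ?_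
  rw [← integral_add (integrableOn_surface hx hφ c) (integrableOn_surface hx hψ c)]
  congr 1
  ext1 u
  ring

theorem surfaceIntegral_const_mul (r : ℝ) (φ : M → ℝ) :
    surfaceIntegral x (fun p => r * φ p) = r * surfaceIntegral x φ := by
  simp only [surfaceIntegral_eq_sum, Finset.mul_sum]
  refine Finset.sum_congr rfl fun c _ => ?_
  rw [← integral_const_mul]
  congr 1
  ext1 u
  ring

theorem surfaceIntegral_sum (hx : IsCapillary θ x ν) {α : Type*} (s : Finset α) {φ : α → M → ℝ}
    (hφ : ∀ k ∈ s, Continuous (φ k)) :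
    surfaceIntegral x (fun p => ∑ k ∈ s, φ k p) = ∑ k ∈ s, surfaceIntegral x (φ k) := by
  classical
  induction s using Finset.induction_on with
  | empty =>
    simp only [Finset.sum_empty]
    simpa using surfaceIntegral_const_mul (x := x) 0 (fun _ => 0)
  | insert a s ha ih =>
    simp only [Finset.sum_insert ha]
    rw [surfaceIntegral_add hx (hφ a (Finset.mem_insert_self a s))
      (continuous_finsetSum _ fun k hk => hφ k (Finset.mem_insert_of_mem hk)),
      ih fun k hk => hφ k (Finset.mem_insert_of_mem hk)]

theorem surfaceIntegral_nonneg {φ : M → ℝ} (hφ : ∀ p, 0 ≤ φ p) : 0 ≤ surfaceIntegral x φ := by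
  rw [surfaceIntegral_eq_sum]
  refine Finset.sum_nonneg fun c _ => integral_nonneg fun u => ?_
  exact mul_nonneg (mul_nonneg ((chartPartition n M).nonneg c _) (hφ _)) (Real.sqrt_nonneg _)

/-- The integral over one chart, of a function supported in two charts, is the same in both. -/
theorem chartIntegral_congr (hx : IsCapillary θ x ν) {ψ : M → ℝ} {c c' : M}
    (hc : tsupport ψ ⊆ (chartAt (EuclideanHalfSpace n) c).source)
    (hc' : tsupport ψ ⊆ (chartAt (EuclideanHalfSpace n) c').source) :
    ∫ u in (extChartAt (𝓡∂ n) c').target, ψ ((extChartAt (𝓡∂ n) c').symm u) *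
      Real.sqrt (pairing c' x x ((extChartAt (𝓡∂ n) c').symm u)).det =
    ∫ u in (extChartAt (𝓡∂ n) c).target, ψ ((extChartAt (𝓡∂ n) c).symm u) *
      Real.sqrt (pairing c x x ((extChartAt (𝓡∂ n) c).symm u)).det := by
  set O : Set M := (chartAt (EuclideanHalfSpace n) c).source ∩
    (chartAt (EuclideanHalfSpace n) c').source with hO
  have hOo : IsOpen O := (chartAt (EuclideanHalfSpace n) c).open_source.inter
    (chartAt (EuclideanHalfSpace n) c').open_source
  have hψ : ∀ p ∉ O, ψ p = 0 := fun p hp =>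
    image_eq_zero_of_notMem_tsupport fun h => hp ⟨hc h, hc' h⟩
  have hmeas : ∀ d : M, MeasurableSet ((extChartAt (𝓡∂ n) d).target ∩
      (extChartAt (𝓡∂ n) d).symm ⁻¹' O) := by
    intro d
    obtain ⟨u, hu, hu'⟩ := continuousOn_iff'.1 (continuousOn_chart_symm (n := n) d) O hOo
    rw [inter_comm, hu']
    exact hu.measurableSet.inter (measurableSet_target d)
  have hrestrict : ∀ d : M, ∫ u in (extChartAt (𝓡∂ n) d).target,
      ψ ((extChartAt (𝓡∂ n) d).symm u) *
        Real.sqrt (pairing d x x ((extChartAt (𝓡∂ n) d).symm u)).det =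
      ∫ u in (extChartAt (𝓡∂ n) d).target ∩ (extChartAt (𝓡∂ n) d).symm ⁻¹' O,
        ψ ((extChartAt (𝓡∂ n) d).symm u) *
        Real.sqrt (pairing d x x ((extChartAt (𝓡∂ n) d).symm u)).det := by
    intro d
    refine setIntegral_eq_of_subset_of_forall_sdiff_eq_zero (measurableSet_target d)
      inter_subset_left fun u hu => ?_
    rw [hψ _ fun h => hu.2 ⟨hu.1, h⟩, zero_mul]
  rw [hrestrict c, hrestrict c']
  have himage : (extChartAt (𝓡∂ n) c ∘ (extChartAt (𝓡∂ n) c').symm) ''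
      ((extChartAt (𝓡∂ n) c').target ∩ (extChartAt (𝓡∂ n) c').symm ⁻¹' O) =
      (extChartAt (𝓡∂ n) c).target ∩ (extChartAt (𝓡∂ n) c).symm ⁻¹' O := by
    ext v
    constructor
    · rintro ⟨u, ⟨hu, huO⟩, rfl⟩
      refine ⟨chart_mem_target huO.1, ?_⟩
      simp only [mem_preimage, Function.comp_apply, chart_left_inv huO.1]
      exact huO
    · rintro ⟨hv, hvO⟩
      refine ⟨extChartAt (𝓡∂ n) c' ((extChartAt (𝓡∂ n) c).symm v),
        ⟨chart_mem_target hvO.2, ?_⟩, ?_⟩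
      · simp only [mem_preimage, chart_left_inv hvO.2]
        exact hvO
      · simp only [Function.comp_apply, chart_left_inv hvO.2]
        exact (extChartAt (𝓡∂ n) c).right_inv hv
  rw [← himage, integral_image_eq_integral_abs_det_fderiv_smul volume (hmeas c')
    (f' := fun u => tangentCoordChange (𝓡∂ n) c' c ((extChartAt (𝓡∂ n) c').symm u))]
  · refine setIntegral_congr_fun (hmeas c') fun u hu => ?_
    obtain ⟨hu, huO⟩ := hu
    simp only [Function.comp_apply, chart_left_inv huO.1, smul_eq_mul]
    rw [hx.sqrt_det huO.1, hx.sqrt_det huO.2,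
      show areaForm x ν c' ((extChartAt (𝓡∂ n) c').symm u) = _ from
        isTopForm_frameDet ν hx.smooth c' c _ huO.2 huO.1, abs_mul]
    rw [areaForm]
    ring
  · intro u hu
    have := hasFDerivWithinAt_tangentCoordChange (I := 𝓡∂ n) (x := c') (y := c)
      (z := (extChartAt (𝓡∂ n) c').symm u)
      (by rw [extChartAt_source, extChartAt_source]; exact ⟨hu.2.2, hu.2.1⟩)
    rw [(extChartAt (𝓡∂ n) c').right_inv hu.1] at this
    exact this.mono (inter_subset_left.trans (extChartAt_target_subset_range c'))
  · intro u hu v hv huv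
    simp only [Function.comp_apply] at huv
    have h1 := congrArg (extChartAt (𝓡∂ n) c).symm huv
    rw [chart_left_inv hu.2.1, chart_left_inv hv.2.1] at h1
    have h2 := congrArg (extChartAt (𝓡∂ n) c') h1
    rwa [(extChartAt (𝓡∂ n) c').right_inv hu.1, (extChartAt (𝓡∂ n) c').right_inv hv.1] at h2

theorem surfaceIntegral_eq_chartIntegral (hx : IsCapillary θ x ν) {ψ : M → ℝ} (hψ : Continuous ψ)
    {c : M} (hc : tsupport ψ ⊆ (chartAt (EuclideanHalfSpace n) c).source) :
    surfaceIntegral x ψ = ∫ u in (extChartAt (𝓡∂ n) c).target,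
      ψ ((extChartAt (𝓡∂ n) c).symm u) *
      Real.sqrt (pairing c x x ((extChartAt (𝓡∂ n) c).symm u)).det := by
  have hsub : ∀ c' : M, tsupport (fun p => chartPartition n M c' p * ψ p) ⊆
      (chartAt (EuclideanHalfSpace n) c).source := fun c' =>
    (tsupport_mul_subset_right (f := chartPartition n M c') (g := ψ)).trans hc
  rw [surfaceIntegral_eq_sum, Finset.sum_congr rfl fun c' _ => chartIntegral_congr hx (hsub c')
    (tsupport_chartPartition_mul_subset (n := n) c' ψ),
    ← integral_finsetSum]
  · congr 1
    ext1 u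
    rw [← Finset.sum_mul, ← Finset.sum_mul, sum_chartPartition, one_mul]
  · intro c' _
    exact integrableOn_chart_mul hx ((continuous_chartPartition c').mul hψ) (hsub c')

end Integrals

/-! ### Stokes' theorem -/

section Stokes

open MeasureTheory

variable {n : ℕ} [NeZero n] {M : Type*} [TopologicalSpace M] [ChartedSpace (EuclideanHalfSpace n) M]
  [IsManifold (𝓡∂ n) ∞ M] {θ : ℝ} {x ν : M → Amb n}

/-- The divergence of the vector field with components `det (b, ∂y with a in place of ∂_i y)`. -/
def divForm (b a y : M → Amb n) (c p : M) : ℝ :=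
  frameVar (b p) (coordDeriv c y p) (coordDeriv c a p) -
    frameVar (a p) (coordDeriv c y p) (coordDeriv c b p)

theorem isTopForm_divForm {b a y : M → Amb n} (hb : ContMDiff (𝓡∂ n) 𝓘(ℝ, Amb n) ∞ b)
    (ha : ContMDiff (𝓡∂ n) 𝓘(ℝ, Amb n) ∞ a) (hy : ContMDiff (𝓡∂ n) 𝓘(ℝ, Amb n) ∞ y) :
    IsTopForm n (divForm b a y) :=
  (isTopForm_frameVar b hy ha).sub (isTopForm_frameVar a hy hb)

theorem continuousOn_divForm {b a y : M → Amb n} (hb : ContMDiff (𝓡∂ n) 𝓘(ℝ, Amb n) ∞ b)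
    (ha : ContMDiff (𝓡∂ n) 𝓘(ℝ, Amb n) ∞ a) (hy : ContMDiff (𝓡∂ n) 𝓘(ℝ, Amb n) ∞ y) (c : M) :
    ContinuousOn (divForm b a y c) (chartAt (EuclideanHalfSpace n) c).source :=
  (continuousOn_frameVar hb.continuous.continuousOn (continuousOn_coordDeriv hy c)
    (continuousOn_coordDeriv ha c)).sub
  (continuousOn_frameVar ha.continuous.continuousOn (continuousOn_coordDeriv hy c)
    (continuousOn_coordDeriv hb c))

theorem IsCapillary.eventually_orient_eq (hx : IsCapillary θ x ν) {c : M}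
    {u : EuclideanSpace ℝ (Fin n)} (hu : u ∈ (extChartAt (𝓡∂ n) c).target) :
    ∀ᶠ v in 𝓝[(extChartAt (𝓡∂ n) c).target] u,
      orient x ν c ((extChartAt (𝓡∂ n) c).symm v) =
        orient x ν c ((extChartAt (𝓡∂ n) c).symm u) := by
  have h1 : ContinuousOn (fun v => areaForm x ν c ((extChartAt (𝓡∂ n) c).symm v))
      (extChartAt (𝓡∂ n) c).target :=
    (hx.continuousOn_areaForm c).comp (continuousOn_chart_symm c) fun u hu => chart_symm_mem hu
  rcases lt_or_gt_of_ne (hx.areaForm_ne_zero (chart_symm_mem hu)) with h | h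
  · filter_upwards [(h1 u hu).eventually (gt_mem_nhds h)] with v hv
    rw [orient, orient, abs_of_neg h, abs_of_neg hv, div_neg, div_neg, div_self h.ne,
      div_self hv.ne]
  · filter_upwards [(h1 u hu).eventually (lt_mem_nhds h)] with v hv
    rw [orient, orient, abs_of_pos h, abs_of_pos hv, div_self h.ne', div_self hv.ne']

theorem IsCapillary.continuousOn_orient (hx : IsCapillary θ x ν) (c : M) :
    ContinuousOn (fun u => orient x ν c ((extChartAt (𝓡∂ n) c).symm u))
      (extChartAt (𝓡∂ n) c).target := by
  intro u hu
  exact continuousWithinAt_const.congr_of_eventuallyEq (hx.eventually_orient_eq hu) rfl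

theorem hasFDerivAt_flux {b a y : M → Amb n} (hb : ContMDiff (𝓡∂ n) 𝓘(ℝ, Amb n) ∞ b)
    (ha : ContMDiff (𝓡∂ n) 𝓘(ℝ, Amb n) ∞ a) (hy : ContMDiff (𝓡∂ n) 𝓘(ℝ, Amb n) ∞ y) {c : M}
    {u : EuclideanSpace ℝ (Fin n)} (hu : u ∈ (extChartAt (𝓡∂ n) c).target) (h0 : 0 < u 0) :
    ∃ D : Fin n → EuclideanSpace ℝ (Fin n) →L[ℝ] ℝ,
      (∀ i, HasFDerivAt (fun v => frameDet (b ((extChartAt (𝓡∂ n) c).symm v))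
        (Function.update (coordDeriv c y ((extChartAt (𝓡∂ n) c).symm v)) i
          (a ((extChartAt (𝓡∂ n) c).symm v)))) (D i) u) ∧
      ∑ i, D i (stdVec i) = divForm b a y c ((extChartAt (𝓡∂ n) c).symm u) := by
  set T := (extChartAt (𝓡∂ n) c).target
  set p := (extChartAt (𝓡∂ n) c).symm u with hp
  have hT : T ∈ 𝓝 u := target_mem_nhds hu h0
  let y2 : Fin n → EuclideanSpace ℝ (Fin n) →L[ℝ] Amb n := fun j =>
    fderivWithin ℝ (fun v => coordDeriv c y ((extChartAt (𝓡∂ n) c).symm v) j) T u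
  have hy2 : ∀ j, HasFDerivAt (fun v => coordDeriv c y ((extChartAt (𝓡∂ n) c).symm v) j)
      (y2 j) u := fun j =>
    ((contDiffOn_coordDeriv hy c j).differentiableOn (by simp) u
      hu).hasFDerivWithinAt.hasFDerivAt hT
  have hb' := hasFDerivAt_chart hb hu h0
  have ha' := hasFDerivAt_chart ha hu h0
  have h1 : ∀ i, ∃ D : EuclideanSpace ℝ (Fin n) →L[ℝ] ℝ,
      HasFDerivAt (fun v => frameDet (b ((extChartAt (𝓡∂ n) c).symm v))
        (Function.update (coordDeriv c y ((extChartAt (𝓡∂ n) c).symm v)) i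
          (a ((extChartAt (𝓡∂ n) c).symm v)))) D u ∧
      D (stdVec i) = frameDet (coordDeriv c b p i) (Function.update (coordDeriv c y p) i (a p)) +
        (frameDet (b p) (Function.update (coordDeriv c y p) i (coordDeriv c a p i)) +
        ∑ j ∈ Finset.univ.erase i, frameDet (b p)
          (Function.update (Function.update (coordDeriv c y p) i (a p)) j (y2 j (stdVec i)))) := by
    intro i
    obtain ⟨D, hD, hD'⟩ := hasFDerivAt_frameDet
      (v := fun j => Function.update (fun j v => coordDeriv c y ((extChartAt (𝓡∂ n) c).symm v) j) i
        (a ∘ (extChartAt (𝓡∂ n) c).symm) j)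
      (v' := Function.update y2 i (chartDeriv c a p)) hb' (fun j => by
        by_cases h : j = i
        · subst h; rw [Function.update_self, Function.update_self]; exact ha'
        · simpa [Function.update_of_ne h] using hy2 j)
    have e1 : ∀ v, (fun j => Function.update
        (fun j v => coordDeriv c y ((extChartAt (𝓡∂ n) c).symm v) j) i
        (a ∘ (extChartAt (𝓡∂ n) c).symm) j v) =
        Function.update (coordDeriv c y ((extChartAt (𝓡∂ n) c).symm v)) i
          (a ((extChartAt (𝓡∂ n) c).symm v)) := by
      intro v
      ext1 j
      by_cases h : j = i
      · subst h; simp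
      · simp [Function.update_of_ne h]
    simp only [e1] at hD hD'
    refine ⟨D, hD, ?_⟩
    rw [hD']
    congr 1
    rw [← Finset.add_sum_erase _ _ (Finset.mem_univ i)]
    congr 1
    · simp only [Function.update_self, Function.update_idem]
      rfl
    · refine Finset.sum_congr rfl fun j hj => ?_
      rw [Function.update_of_ne (Finset.ne_of_mem_erase hj)]
      rfl
  choose D hD hD' using h1
  refine ⟨D, hD, ?_⟩
  have hsym := sum_frameDet_update_update_eq_zero (b p) (a p) (coordDeriv c y p)
    (fun i j => y2 j (stdVec i)) (fun i j => fderivWithin_coordDeriv_symm hy hu j i)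
  simp only [hD', Finset.sum_add_distrib]
  rw [hsym, divForm, frameVar, frameVar, add_zero, sub_eq_add_neg, add_comm,
    ← Finset.sum_neg_distrib]
  congr 1
  exact Finset.sum_congr rfl fun i _ => frameDet_swap_update _ _ _ _

variable [CompactSpace M] [T2Space M]

theorem chart_stokes (hx : IsCapillary θ x ν) {b a y : M → Amb n}
    (hb : ContMDiff (𝓡∂ n) 𝓘(ℝ, Amb n) ∞ b) (ha : ContMDiff (𝓡∂ n) 𝓘(ℝ, Amb n) ∞ a)
    (hy : ContMDiff (𝓡∂ n) 𝓘(ℝ, Amb n) ∞ y) {c : M}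
    (hac : tsupport a ⊆ (chartAt (EuclideanHalfSpace n) c).source) :
    ∫ u in (extChartAt (𝓡∂ n) c).target, orient x ν c ((extChartAt (𝓡∂ n) c).symm u) *
      divForm b a y c ((extChartAt (𝓡∂ n) c).symm u) =
    - ∫ v in bdryIncl ⁻¹' (extChartAt (𝓡∂ n) c).target,
      orient x ν c ((extChartAt (𝓡∂ n) c).symm (bdryIncl v)) *
      frameDet (b ((extChartAt (𝓡∂ n) c).symm (bdryIncl v)))
        (Function.update (coordDeriv c y ((extChartAt (𝓡∂ n) c).symm (bdryIncl v))) 0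
          (a ((extChartAt (𝓡∂ n) c).symm (bdryIncl v)))) := by
  set T := (extChartAt (𝓡∂ n) c).target with hTdef
  have hTm : MeasurableSet T := measurableSet_target c
  let g : Fin n → EuclideanSpace ℝ (Fin n) → ℝ := fun i v =>
    frameDet (b ((extChartAt (𝓡∂ n) c).symm v))
        (Function.update (coordDeriv c y ((extChartAt (𝓡∂ n) c).symm v)) i
          (a ((extChartAt (𝓡∂ n) c).symm v)))
  let o : EuclideanSpace ℝ (Fin n) → ℝ := fun u => orient x ν c ((extChartAt (𝓡∂ n) c).symm u)
  let V : Fin n → EuclideanSpace ℝ (Fin n) → ℝ := fun i => T.indicator (fun u => o u * g i u)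
  let K := extChartAt (𝓡∂ n) c '' tsupport a
  have hac' : tsupport a ⊆ (extChartAt (𝓡∂ n) c).source := by rwa [extChartAt_source]
  have hK : IsCompact K := (isClosed_tsupport a).isCompact.image_of_continuousOn
    ((continuousOn_extChartAt c).mono hac')
  have ha0 : ∀ u ∈ T, u ∉ K → a ((extChartAt (𝓡∂ n) c).symm u) = 0 := by
    intro u hu huK
    refine image_eq_zero_of_notMem_tsupport fun h => huK ?_
    exact ⟨_, h, (extChartAt (𝓡∂ n) c).right_inv hu⟩
  have hg0 : ∀ i, ∀ u ∈ T, u ∉ K → g i u = 0 := by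
    intro i u hu huK
    have := frameDet_update_smul (b ((extChartAt (𝓡∂ n) c).symm u))
      (coordDeriv c y ((extChartAt (𝓡∂ n) c).symm u)) i 0 0
    simp only [g, ha0 u hu huK]
    simpa using this
  have hVK : ∀ i, ∀ u ∉ K, V i u = 0 := by
    intro i u huK
    by_cases hu : u ∈ T
    · simp only [V, indicator_of_mem hu, hg0 i u hu huK, mul_zero]
    · exact indicator_of_notMem hu _
  have hVnear : ∀ i, ∀ u ∉ K, V i =ᶠ[𝓝 u] fun _ => 0 := by
    intro i u huK
    filter_upwards [hK.isClosed.isOpen_compl.mem_nhds huK] with v hv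
    exact hVK i v hv
  have hV'K : ∀ i, ∀ u ∉ K, fderiv ℝ (V i) u = 0 := by
    intro i u huK
    rw [(hVnear i u huK).fderiv_eq]
    simp
  have hKT : K ⊆ T := by
    rintro _ ⟨q, hq, rfl⟩
    exact (extChartAt (𝓡∂ n) c).map_source (hac' hq)
  have hgc : ∀ i, ContinuousOn (g i) T := by
    intro i
    have h1 : ContinuousOn (fun q => frameDet (b q)
        (Function.update (coordDeriv c y q) i (a q)))
        (chartAt (EuclideanHalfSpace n) c).source := by
      refine continuousOn_frameDet hb.continuous.continuousOn fun j => ?_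
      by_cases h : j = i
      · subst h; simpa using ha.continuous.continuousOn
      · simpa [Function.update_of_ne h] using continuousOn_coordDeriv hy c j
    exact h1.comp (continuousOn_chart_symm c) fun u hu => chart_symm_mem hu
  have hVc : ∀ i, ContinuousOn (V i) {u | 0 ≤ u 0} := by
    intro i u hu
    by_cases huK : u ∈ K
    · have h1 : ContinuousWithinAt (fun u => o u * g i u) T u :=
        ((hx.continuousOn_orient c) u (hKT huK)).mul (hgc i u (hKT huK))
      have h2 : ContinuousWithinAt (V i) T u :=
        h1.congr (fun v hv => indicator_of_mem hv _) (indicator_of_mem (hKT huK) _)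
      refine h2.mono_of_mem_nhdsWithin ?_
      have := target_mem_nhdsWithin (hKT huK)
      rwa [range_modelWithCornersEuclideanHalfSpace] at this
    · exact (continuousAt_const.congr (hVnear i u huK).symm).continuousWithinAt
  have hderiv : ∀ u ∈ T, 0 < u 0 → ∃ D : Fin n → EuclideanSpace ℝ (Fin n) →L[ℝ] ℝ,
      (∀ i, HasFDerivAt (V i) (D i) u) ∧ ∑ i, D i (stdVec i) =
        o u * divForm b a y c ((extChartAt (𝓡∂ n) c).symm u) := by
    intro u hu h0
    obtain ⟨D, hD, hD'⟩ := hasFDerivAt_flux hb ha hy hu h0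
    refine ⟨fun i => o u • D i, fun i => ?_, ?_⟩
    · have h1 := (hD i).const_mul (o u)
      refine h1.congr_of_eventuallyEq ?_
      have h2 := hx.eventually_orient_eq hu
      rw [nhdsWithin_eq_nhds.2 (target_mem_nhds hu h0)] at h2
      filter_upwards [h2, target_mem_nhds hu h0] with v hv hvT
      rw [show V i v = o v * g i v from indicator_of_mem (show v ∈ T from hvT) _]
      simp only [o, hv, g]
    · simp only [_root_.smul_apply, smul_eq_mul, ← Finset.mul_sum, hD']
  have hVd : ∀ i u, 0 < u 0 → HasFDerivAt (V i) (fderiv ℝ (V i) u) u := by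
    intro i u h0
    by_cases hu : u ∈ T
    · obtain ⟨D, hD, -⟩ := hderiv u hu h0
      exact (hD i).differentiableAt.hasFDerivAt
    · have huK : u ∉ K := fun h => hu (hKT h)
      exact ((differentiableAt_const (0 : ℝ)).congr_of_eventuallyEq
        (hVnear i u huK)).hasFDerivAt
  let G : EuclideanSpace ℝ (Fin n) → ℝ := T.indicator fun u =>
    o u * divForm b a y c ((extChartAt (𝓡∂ n) c).symm u)
  have hdivG : ∀ u : EuclideanSpace ℝ (Fin n), 0 < u 0 →
      ∑ i, fderiv ℝ (V i) u (stdVec i) = G u := by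
    intro u h0
    by_cases hu : u ∈ T
    · obtain ⟨D, hD, hD'⟩ := hderiv u hu h0
      simp only [G, indicator_of_mem hu, ← hD', (hD _).fderiv]
    · have huK : u ∉ K := fun h => hu (hKT h)
      simp [G, indicator_of_notMem hu, hV'K _ u huK]
  have hae : (fun u => ∑ i, fderiv ℝ (V i) u (stdVec i)) =ᵐ[volume.restrict {u | 0 ≤ u 0}] G := by
    have h1 : ∀ᵐ u : EuclideanSpace ℝ (Fin n), u 0 ≠ 0 := by
      rw [ae_iff]
      simpa using volume_coord_eq (n := n) 0 0
    have hHm : MeasurableSet {u : EuclideanSpace ℝ (Fin n) | 0 ≤ u 0} :=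
      (isClosed_le continuous_const (PiLp.continuous_apply 2 _ 0)).measurableSet
    rw [Filter.EventuallyEq, ae_restrict_iff' hHm]
    filter_upwards [h1] with u hu hu'
    exact hdivG u (lt_of_le_of_ne hu' (Ne.symm hu))
  have hGT : IntegrableOn (fun u => o u * divForm b a y c ((extChartAt (𝓡∂ n) c).symm u)) T := by
    refine integrableOn_chart ?_ (isClosed_tsupport a).isCompact hac ?_
    · exact (hx.continuousOn_orient c).mul ((continuousOn_divForm hb ha hy c).comp
        (continuousOn_chart_symm c) fun u hu => chart_symm_mem hu)
    · intro u hu hua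
      have hau : a ((extChartAt (𝓡∂ n) c).symm u) = 0 := image_eq_zero_of_notMem_tsupport hua
      have h1 : chartDeriv c a ((extChartAt (𝓡∂ n) c).symm u) = 0 := by
        have h2 : a ∘ (extChartAt (𝓡∂ n) c).symm =ᶠ[𝓝[range (𝓡∂ n)] u] fun _ => 0 := by
          have huK : u ∉ K := by
            rintro ⟨q, hq, rfl⟩
            rw [(extChartAt (𝓡∂ n) c).left_inv (hac' hq)] at hua
            exact hua hq
          filter_upwards [target_mem_nhdsWithin hu,
            mem_nhdsWithin_of_mem_nhds (hK.isClosed.isOpen_compl.mem_nhds huK)] with v hv hvK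
          exact ha0 v hv hvK
        rw [chartDeriv, (extChartAt (𝓡∂ n) c).right_inv hu,
          h2.fderivWithin_eq hau]
        simp
      have h3 : coordDeriv c a ((extChartAt (𝓡∂ n) c).symm u) = 0 := by
        ext1 i; rw [coordDeriv_eq, h1]; rfl
      simp only [divForm, h3, hau, frameVar_zero_left, frameVar_zero_right, sub_zero, mul_zero]
  have hHm : T ⊆ {u : EuclideanSpace ℝ (Fin n) | 0 ≤ u 0} := target_subset_halfSpace c
  have hGint : IntegrableOn G {u | 0 ≤ u 0} :=
    ((integrable_indicator_iff hTm).2 hGT).integrableOn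
  have key := integral_divergence_halfSpace V (fun i u => fderiv ℝ (V i) u) hK.isBounded hVK hV'K
    hVc hVd (hGint.congr hae.symm)
  rw [integral_congr_ae hae, setIntegral_indicator hTm, inter_eq_self_of_subset_right hHm] at key
  rw [key]
  congr 1
  have hbm : MeasurableSet (bdryIncl ⁻¹' T) := continuous_bdryIncl.measurable hTm
  rw [← integral_indicator hbm]
  rfl

/-- **Stokes' theorem** on a capillary hypersurface. -/
theorem surface_stokes (hx : IsCapillary θ x ν) {b a y : M → Amb n}
    (hb : ContMDiff (𝓡∂ n) 𝓘(ℝ, Amb n) ∞ b) (ha : ContMDiff (𝓡∂ n) 𝓘(ℝ, Amb n) ∞ a)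
    (hy : ContMDiff (𝓡∂ n) 𝓘(ℝ, Amb n) ∞ y) :
    surfaceIntegral x (density x ν (divForm b a y)) =
    - ∑ c ∈ activeCharts n M, ∫ v in bdryIncl ⁻¹' (extChartAt (𝓡∂ n) c).target,
      chartPartition n M c ((extChartAt (𝓡∂ n) c).symm (bdryIncl v)) *
      (orient x ν c ((extChartAt (𝓡∂ n) c).symm (bdryIncl v)) *
      frameDet (b ((extChartAt (𝓡∂ n) c).symm (bdryIncl v)))
        (Function.update (coordDeriv c y ((extChartAt (𝓡∂ n) c).symm (bdryIncl v))) 0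
          (a ((extChartAt (𝓡∂ n) c).symm (bdryIncl v))))) := by
  let A : M → M → Amb n := fun c p => chartPartition n M c p • a p
  have hA : ∀ c, ContMDiff (𝓡∂ n) 𝓘(ℝ, Amb n) ∞ (A c) := fun c =>
    (contMDiff_chartPartition c).smul ha
  have hAs : ∀ c, tsupport (A c) ⊆ (chartAt (EuclideanHalfSpace n) c).source := fun c =>
    (tsupport_smul_subset_left _ _).trans (tsupport_chartPartition_subset c)
  have hsum : a = fun p => ∑ c ∈ activeCharts n M, A c p := by
    ext1 p
    simp only [A, ← Finset.sum_smul, sum_chartPartition, one_smul]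
  have hdiv : ∀ p, density x ν (divForm b a y) p =
      ∑ c ∈ activeCharts n M, density x ν (divForm b (A c) y) p := by
    intro p
    simp only [density, ← Finset.sum_div]
    congr 1
    have e1 : coordDeriv p a p = fun i => ∑ c ∈ activeCharts n M, coordDeriv p (A c) p i := by
      ext1 i
      conv_lhs => rw [hsum]
      exact coordDeriv_sum _ _ (fun c _ => hA c) (mem_chart_source' p) i
    have e2 : a p = ∑ c ∈ activeCharts n M, A c p := congrFun hsum p
    simp only [divForm, Finset.sum_sub_distrib]
    rw [e1, frameVar_sum_right, ← frameVar_sum_left, ← e2]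
  have hcd : ∀ c, Continuous (density x ν (divForm b (A c) y)) := fun c =>
    hx.continuous_density (isTopForm_divForm hb (hA c) hy) (continuousOn_divForm hb (hA c) hy)
  have hts : ∀ c, tsupport (density x ν (divForm b (A c) y)) ⊆
      (chartAt (EuclideanHalfSpace n) c).source := by
    intro c
    refine (closure_minimal (fun p hp => ?_) (isClosed_tsupport (A c))).trans (hAs c)
    by_contra h
    apply hp
    have h0 : A c p = 0 := image_eq_zero_of_notMem_tsupport h
    have h1 : coordDeriv p (A c) p = 0 := by
      have h2 : A c ∘ (extChartAt (𝓡∂ n) p).symm =ᶠ[𝓝[range (𝓡∂ n)] (extChartAt (𝓡∂ n) p p)]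
          fun _ => 0 := by
        have h3 : ContinuousWithinAt (extChartAt (𝓡∂ n) p).symm (range (𝓡∂ n))
            (extChartAt (𝓡∂ n) p p) := (continuousAt_extChartAt_symm p).continuousWithinAt
        have h4 : (tsupport (A c))ᶜ ∈ 𝓝 ((extChartAt (𝓡∂ n) p).symm (extChartAt (𝓡∂ n) p p)) := by
          rw [chart_left_inv (mem_chart_source' p)]
          exact (isClosed_tsupport (A c)).isOpen_compl.mem_nhds h
        filter_upwards [h3 h4] with v hv
        exact image_eq_zero_of_notMem_tsupport (f := A c) hv
      ext1 i
      rw [coordDeriv, h2.fderivWithin_eq (by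
        simp only [Function.comp_apply, chart_left_inv (mem_chart_source' p), h0])]
      simp
    simp only [density, divForm, h0, h1, frameVar_zero_left, frameVar_zero_right, sub_zero,
      zero_div]
  have hfun : density x ν (divForm b a y) =
      fun p => ∑ c ∈ activeCharts n M, density x ν (divForm b (A c) y) p := funext hdiv
  rw [hfun, surfaceIntegral_sum hx _ fun c _ => hcd c, ← Finset.sum_neg_distrib]
  refine Finset.sum_congr rfl fun c _ => ?_
  rw [surfaceIntegral_eq_chartIntegral hx (hcd c) (hts c)]
  have h1 := chart_stokes hx hb (hA c) hy (hAs c)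
  rw [setIntegral_congr_fun (measurableSet_target c) fun u hu =>
    hx.density_mul_sqrt (isTopForm_divForm hb (hA c) hy) (chart_symm_mem hu), h1]
  congr 1
  congr 1
  ext1 v
  simp only [A, frameDet_update_smul]
  ring

end Stokes

/-! ### The curvature polynomial and the Minkowski formulas -/

theorem exists_coeff_extraction (N : ℕ) : ∃ L : ℕ → ℕ → ℝ, ∀ a : ℕ → ℝ, ∀ k < N,
    a k = ∑ j ∈ Finset.range N, L k j * ∑ i ∈ Finset.range N, (j : ℝ) ^ i * a i := by
  set V := Matrix.vandermonde (fun i : Fin N => ((i : ℕ) : ℝ)) with hV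
  have hdet : IsUnit V.det := by
    rw [isUnit_iff_ne_zero, hV, Matrix.det_vandermonde_ne_zero_iff]
    intro i j h
    exact Fin.ext (Nat.cast_injective (R := ℝ) h)
  refine ⟨fun k j => if h : k < N ∧ j < N then V⁻¹ ⟨k, h.1⟩ ⟨j, h.2⟩ else 0, fun a k hk => ?_⟩
  have h1 : V⁻¹.mulVec (V.mulVec fun i : Fin N => a i) = fun i : Fin N => a i := by
    rw [Matrix.mulVec_mulVec, Matrix.nonsing_inv_mul _ hdet, Matrix.one_mulVec]
  have h2 := congrFun h1 ⟨k, hk⟩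
  rw [Finset.sum_range, ← show _ = a k from h2]
  simp only [Matrix.mulVec, dotProduct]
  refine Finset.sum_congr rfl fun j _ => ?_
  rw [dif_pos ⟨hk, j.2⟩, Finset.sum_range]
  rfl

theorem eq_zero_of_sum_pow_eq_zero {N : ℕ} {a : ℕ → ℝ}
    (h : ∀ s : ℝ, ∑ i ∈ Finset.range N, s ^ i * a i = 0) : ∀ k < N, a k = 0 := by
  obtain ⟨L, hL⟩ := exists_coeff_extraction N
  intro k hk
  rw [hL a k hk]
  exact Finset.sum_eq_zero fun j _ => by rw [h, mul_zero]

section Minkowski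

variable {n : ℕ} [NeZero n] {M : Type*} [TopologicalSpace M] [ChartedSpace (EuclideanHalfSpace n) M]

/-- The capillary normal `ν + cos θ e`, which is horizontal along the boundary. -/
def tilt (θ : ℝ) (ν : M → Amb n) : M → Amb n := ν + fun _ => Real.cos θ • downVec n

/-- The position vector of the parallel capillary hypersurface. -/
def shift (θ s : ℝ) (x ν : M → Amb n) : M → Amb n := x + s • tilt θ ν

/-- The function `1 + cos θ ⟨ν, e⟩`. -/
def tiltWeight (θ : ℝ) (ν : M → Amb n) (p : M) : ℝ :=
  1 + Real.cos θ * inner ℝ (ν p) (downVec n)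

/-- The Steiner polynomial `det (1 + s W)` of the Weingarten map. -/
def curvPoly (x ν : M → Amb n) (s : ℝ) (p : M) : ℝ :=
  ∑ k ∈ Finset.range (n + 1), s ^ k * (n.choose k * meanCurv k x ν p)

/-- Its derivative in `s`. -/
def curvPolyDeriv (x ν : M → Amb n) (s : ℝ) (p : M) : ℝ :=
  ∑ k ∈ Finset.range n, s ^ k * ((k + 1 : ℝ) * n.choose (k + 1) * meanCurv (k + 1) x ν p)

theorem hasDerivAt_curvPoly (x ν : M → Amb n) (s : ℝ) (p : M) :
    HasDerivAt (fun r => curvPoly x ν r p) (curvPolyDeriv x ν s p) s := by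
  have h := HasDerivAt.fun_sum (u := Finset.range (n + 1)) fun k _ =>
    (hasDerivAt_pow k s).mul_const (n.choose k * meanCurv k x ν p)
  refine h.congr_deriv ?_
  rw [Finset.sum_range_succ']
  simp only [Nat.cast_zero, zero_mul, add_zero, curvPolyDeriv, Nat.add_sub_cancel]
  refine Finset.sum_congr rfl fun k _ => ?_
  push_cast
  ring

variable [IsManifold (𝓡∂ n) ∞ M] {θ : ℝ} {x ν : M → Amb n}

theorem contMDiff_tilt (hν : ContMDiff (𝓡∂ n) 𝓘(ℝ, Amb n) ∞ ν) :
    ContMDiff (𝓡∂ n) 𝓘(ℝ, Amb n) ∞ (tilt θ ν) := hν.add (contMDiff_const (c := Real.cos θ • downVec n))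

theorem contMDiff_shift (hx : IsCapillary θ x ν) (s : ℝ) :
    ContMDiff (𝓡∂ n) 𝓘(ℝ, Amb n) ∞ (shift θ s x ν) :=
  hx.smooth.add ((contMDiff_const (I' := 𝓘(ℝ, ℝ)) (c := s)).smul (contMDiff_tilt hx.smooth_normal))

theorem coordDeriv_tilt (hν : ContMDiff (𝓡∂ n) 𝓘(ℝ, Amb n) ∞ ν) {c p : M}
    (hp : p ∈ (chartAt (EuclideanHalfSpace n) c).source) :
    coordDeriv c (tilt θ ν) p = coordDeriv c ν p := by
  rw [tilt, coordDeriv_add (differentiableWithinAt_chart hν hp)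
    (differentiableWithinAt_chart contMDiff_const hp), coordDeriv_const, add_zero]

theorem coordDeriv_shift (hx : IsCapillary θ x ν) (s : ℝ) {c p : M}
    (hp : p ∈ (chartAt (EuclideanHalfSpace n) c).source) :
    coordDeriv c (shift θ s x ν) p = coordDeriv c x p + s • coordDeriv c ν p := by
  have h1 : ContMDiff (𝓡∂ n) 𝓘(ℝ, Amb n) ∞ (s • tilt θ ν) :=
    (contMDiff_const (I' := 𝓘(ℝ, ℝ)) (c := s)).smul (contMDiff_tilt hx.smooth_normal)
  rw [shift, coordDeriv_add (differentiableWithinAt_chart hx.smooth hp)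
    (differentiableWithinAt_chart h1 hp), coordDeriv_const_smul,
    coordDeriv_tilt hx.smooth_normal hp]

theorem IsCapillary.frameDet_mul_areaForm (hx : IsCapillary θ x ν) (a : Amb n) (s : ℝ) (p : M) :
    frameDet a (coordDeriv p x p + s • coordDeriv p ν p) =
      areaForm x ν p p * (inner ℝ a (ν p) * curvPoly x ν s p) := by
  have hp := mem_chart_source' (n := n) p
  have h1 : frameDet a (coordDeriv p x p + s • coordDeriv p ν p) * areaForm x ν p p =
      inner ℝ a (ν p) * (pairing p x x p + s • pairing p ν x p).det := by
    rw [areaForm, frameDet_mul_of_orthogonal]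
    · congr 2
      ext i j
      simp [pairing, inner_add_left, inner_smul_left]
    · intro i
      simp [inner_add_left, inner_smul_left, hx.inner_coordDeriv hp,
        hx.inner_coordDeriv_normal hp]
  rw [det_add_smul_eq_sum (hx.posDef hp) (hx.pairing_isHermitian hp), ← hx.areaForm_sq hp] at h1
  have h2 : ∑ k ∈ Finset.range (Fintype.card (Fin n) + 1), ((Fintype.card (Fin n)).choose k : ℝ) *
      s ^ k * normSym k (pairing p x x p) (pairing p ν x p) = curvPoly x ν s p := by
    rw [Fintype.card_fin, curvPoly]
    refine Finset.sum_congr rfl fun k _ => ?_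
    rw [meanCurv]; ring
  rw [h2] at h1
  exact mul_right_cancel₀ (hx.areaForm_ne_zero hp) (by rw [h1]; ring)

theorem IsCapillary.frameVar_eq (hx : IsCapillary θ x ν) (a : Amb n) (s : ℝ) (p : M) :
    frameVar a (coordDeriv p x p + s • coordDeriv p ν p) (coordDeriv p ν p) =
      areaForm x ν p p * (inner ℝ a (ν p) * curvPolyDeriv x ν s p) := by
  have h1 := hasDerivAt_frameVar a (coordDeriv p x p) (coordDeriv p ν p) s
  simp only [hx.frameDet_mul_areaForm] at h1
  exact h1.unique (((hasDerivAt_curvPoly x ν s p).const_mul _).const_mul _)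

theorem IsCapillary.density_frameDet_shift (hx : IsCapillary θ x ν) (a : M → Amb n) (s : ℝ)
    (p : M) : density x ν (fun c q => frameDet (a q) (coordDeriv c (shift θ s x ν) q)) p =
      inner ℝ (a p) (ν p) * curvPoly x ν s p := by
  have hp := mem_chart_source' (n := n) p
  rw [density, coordDeriv_shift hx s hp, hx.frameDet_mul_areaForm,
    mul_div_cancel_left₀ _ (hx.areaForm_ne_zero hp)]

theorem frameVar_self (b : Amb n) (v : Fin n → Amb n) : frameVar b v v = n * frameDet b v := by
  simp [frameVar]

theorem IsCapillary.continuous_curvPoly (hx : IsCapillary θ x ν) (s : ℝ) :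
    Continuous (curvPoly x ν s) := by
  have h := hx.continuous_density (isTopForm_frameDet ν (contMDiff_shift hx s))
    fun c => continuousOn_frameDet hx.smooth_normal.continuous.continuousOn
      (continuousOn_coordDeriv (contMDiff_shift hx s) c)
  refine h.congr fun p => ?_
  rw [hx.density_frameDet_shift, real_inner_self_eq_norm_sq, hx.unit_normal]
  ring

theorem IsCapillary.continuous_meanCurv (hx : IsCapillary θ x ν) {k : ℕ} (hk : k ≤ n) :
    Continuous (meanCurv k x ν) := by
  obtain ⟨L, hL⟩ := exists_coeff_extraction (n + 1)
  have hc : (n.choose k : ℝ) ≠ 0 := by exact_mod_cast (Nat.choose_pos hk).ne'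
  have h1 : meanCurv k x ν = fun p => (n.choose k : ℝ)⁻¹ *
      ∑ j ∈ Finset.range (n + 1), L k j * curvPoly x ν j p := by
    ext1 p
    have h := hL (fun k => n.choose k * meanCurv k x ν p) k (by omega)
    simp only [curvPoly]
    rw [← h, inv_mul_cancel_left₀ hc]
  rw [h1]
  exact continuous_const.mul (continuous_finsetSum _ fun j _ =>
    continuous_const.mul (hx.continuous_curvPoly j))

theorem IsCapillary.continuous_inner_normal (hx : IsCapillary θ x ν) :
    Continuous (fun p => inner ℝ (x p) (ν p)) :=
  hx.smooth.continuous.inner hx.smooth_normal.continuous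

theorem IsCapillary.continuous_tiltWeight (hx : IsCapillary θ x ν) :
    Continuous (tiltWeight θ ν) :=
  continuous_const.add (continuous_const.mul (hx.smooth_normal.continuous.inner continuous_const))

theorem IsCapillary.inner_tilt (hx : IsCapillary θ x ν) (p : M) :
    inner ℝ (tilt θ ν p) (ν p) = tiltWeight θ ν p := by
  rw [real_inner_comm]
  simp [tilt, tiltWeight, inner_add_right, inner_smul_right,
    hx.unit_normal]

theorem inner_downVec (v : Amb n) : inner ℝ v (downVec n) = - v (Fin.last n) := by
  simp [downVec, EuclideanSpace.inner_single_right]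

theorem IsCapillary.tilt_last (hx : IsCapillary θ x ν) {p : M} (hp : p ∈ (𝓡∂ n).boundary M) :
    tilt θ ν p (Fin.last n) = 0 := by
  have h := hx.contact_angle p hp
  rw [inner_downVec, Real.cos_pi_sub] at h
  simp [tilt, downVec]
  linarith

theorem IsCapillary.shift_last (hx : IsCapillary θ x ν) (s : ℝ) {p : M}
    (hp : p ∈ (𝓡∂ n).boundary M) : shift θ s x ν p (Fin.last n) = 0 := by
  simp [shift, hx.tilt_last hp, hx.boundary_zero p hp]

/-! ### Boundary points in charts -/

theorem chart_symm_mem_boundary {c : M} {u : EuclideanSpace ℝ (Fin n)}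
    (hu : u ∈ (extChartAt (𝓡∂ n) c).target) (h0 : u 0 = 0) :
    (extChartAt (𝓡∂ n) c).symm u ∈ (𝓡∂ n).boundary M := by
  have h1 := chart_symm_mem hu
  rw [← ModelWithCorners.compl_interior, ModelWithCorners.interior, mem_compl_iff, mem_ofPred_eq,
    ModelWithCorners.isInteriorPoint_iff_of_mem_atlas (n := ∞) (by simp) (chart_mem_atlas _ c) h1]
  change extChartAt (𝓡∂ n) c _ ∉ interior (extChartAt (𝓡∂ n) c).target
  rw [(extChartAt (𝓡∂ n) c).right_inv hu]
  intro h
  have h2 := interior_mono (extChartAt_target_subset_range c) h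
  rw [interior_range_modelWithCornersEuclideanHalfSpace] at h2
  exact (show 0 < u 0 from h2).ne' h0

theorem chart_symm_mem_interior {c : M} {u : EuclideanSpace ℝ (Fin n)}
    (hu : u ∈ (extChartAt (𝓡∂ n) c).target) (h0 : 0 < u 0) :
    (extChartAt (𝓡∂ n) c).symm u ∈ (𝓡∂ n).interior M := by
  rw [ModelWithCorners.interior, mem_ofPred_eq,
    ModelWithCorners.isInteriorPoint_iff_of_mem_atlas (n := ∞) (by simp) (chart_mem_atlas _ c)
      (chart_symm_mem hu)]
  change extChartAt (𝓡∂ n) c _ ∈ interior (extChartAt (𝓡∂ n) c).target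
  rw [(extChartAt (𝓡∂ n) c).right_inv hu]
  exact mem_interior_iff_mem_nhds.2 (target_mem_nhds hu h0)

theorem line_mem_range {u : EuclideanSpace ℝ (Fin n)} (h0 : u 0 = 0) {j : Fin n} (hj : j ≠ 0)
    (s : ℝ) : u + s • (stdVec j : EuclideanSpace ℝ (Fin n)) ∈ range (𝓡∂ n) := by
  rw [range_modelWithCornersEuclideanHalfSpace]
  simp [h0, stdVec, hj.symm]

theorem hasDerivAt_line {F : Type*} [NormedAddCommGroup F] [NormedSpace ℝ F]
    {f : EuclideanSpace ℝ (Fin n) → F} {f' : EuclideanSpace ℝ (Fin n) →L[ℝ] F}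
    {u : EuclideanSpace ℝ (Fin n)} (hf : HasFDerivWithinAt f f' (range (𝓡∂ n)) u) (h0 : u 0 = 0)
    {j : Fin n} (hj : j ≠ 0) :
    HasDerivAt (fun s : ℝ => f (u + s • stdVec j)) (f' (stdVec j)) 0 := by
  have h2 : HasDerivAt (fun s : ℝ => u + s • (stdVec j : EuclideanSpace ℝ (Fin n))) (stdVec j) 0 := by
    simpa using ((hasDerivAt_id (0 : ℝ)).smul_const (stdVec j)).const_add u
  exact HasFDerivWithinAt.comp_hasDerivAt (x := (0 : ℝ))
    (f := fun s : ℝ => u + s • (stdVec j : EuclideanSpace ℝ (Fin n)))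
    (by simp only [zero_smul, add_zero]; exact hf) h2
    (Filter.Eventually.of_forall fun s => line_mem_range h0 hj s)

theorem eventually_line_boundary {c : M} {u : EuclideanSpace ℝ (Fin n)}
    (hu : u ∈ (extChartAt (𝓡∂ n) c).target) (h0 : u 0 = 0) {j : Fin n} (hj : j ≠ 0) :
    ∀ᶠ s : ℝ in 𝓝 0, u + s • stdVec j ∈ (extChartAt (𝓡∂ n) c).target ∧
      (extChartAt (𝓡∂ n) c).symm (u + s • stdVec j) ∈ (𝓡∂ n).boundary M := by
  have h4 : Filter.Tendsto (fun s : ℝ => u + s • (stdVec j : EuclideanSpace ℝ (Fin n))) (𝓝 0)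
      (𝓝[range (𝓡∂ n)] u) := by
    refine tendsto_nhdsWithin_iff.2 ⟨?_, Filter.Eventually.of_forall fun s =>
      line_mem_range h0 hj s⟩
    have : Continuous (fun s : ℝ => u + s • (stdVec j : EuclideanSpace ℝ (Fin n))) := by fun_prop
    simpa using this.tendsto 0
  filter_upwards [h4 (target_mem_nhdsWithin hu)] with s hs
  exact ⟨hs, chart_symm_mem_boundary hs (by simp [h0, stdVec, hj.symm])⟩

/-- Functions that agree on the boundary have the same tangential derivatives there. -/
theorem fderivWithin_eq_of_eq_boundary {F : Type*} [NormedAddCommGroup F] [NormedSpace ℝ F]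
    {c : M} {f g : M → F} {f' g' : EuclideanSpace ℝ (Fin n) →L[ℝ] F}
    {u : EuclideanSpace ℝ (Fin n)} (hu : u ∈ (extChartAt (𝓡∂ n) c).target) (h0 : u 0 = 0)
    (hf : HasFDerivWithinAt (f ∘ (extChartAt (𝓡∂ n) c).symm) f' (range (𝓡∂ n)) u)
    (hg : HasFDerivWithinAt (g ∘ (extChartAt (𝓡∂ n) c).symm) g' (range (𝓡∂ n)) u)
    {j : Fin n} (hj : j ≠ 0) (hfg : ∀ p ∈ (chartAt (EuclideanHalfSpace n) c).source,
      p ∈ (𝓡∂ n).boundary M → f p = g p) :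
    f' (stdVec j) = g' (stdVec j) := by
  refine (hasDerivAt_line hf h0 hj).unique ((hasDerivAt_line hg h0 hj).congr_of_eventuallyEq ?_)
  filter_upwards [eventually_line_boundary hu h0 hj] with s hs
  exact hfg _ (chart_symm_mem hs.1) hs.2

theorem coordDeriv_last_eq_zero {g : M → Amb n} (hg : ContMDiff (𝓡∂ n) 𝓘(ℝ, Amb n) ∞ g)
    (hb : ∀ p ∈ (𝓡∂ n).boundary M, g p (Fin.last n) = 0) {c : M} {u : EuclideanSpace ℝ (Fin n)}
    (hu : u ∈ (extChartAt (𝓡∂ n) c).target) (h0 : u 0 = 0) {j : Fin n} (hj : j ≠ 0) :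
    coordDeriv c g ((extChartAt (𝓡∂ n) c).symm u) j (Fin.last n) = 0 := by
  have h1 := hasFDerivWithinAt_chart hg (chart_symm_mem hu)
  rw [(extChartAt (𝓡∂ n) c).right_inv hu] at h1
  have h2 := (PiLp.hasFDerivAt_apply (𝕜 := ℝ) 2 _ (Fin.last n)).comp_hasFDerivWithinAt u h1
  exact fderivWithin_eq_of_eq_boundary (f := fun p => g p (Fin.last n)) (g := fun _ => (0 : ℝ)) hu
    h0 h2
    (hasFDerivWithinAt_const (0 : ℝ) u _) hj fun p _ hp => hb p hp

/-- The integral `∫ H_k (1 + cos θ ⟨ν, e⟩) dA`. -/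
def weightedCurv [CompactSpace M] [T2Space M] (θ : ℝ) (k : ℕ) (x ν : M → Amb n) : ℝ :=
  surfaceIntegral x fun p => meanCurv k x ν p * tiltWeight θ ν p

variable [CompactSpace M] [T2Space M]

theorem IsCapillary.density_divForm_shift (hx : IsCapillary θ x ν) (s : ℝ) (p : M) :
    density x ν (divForm (shift θ s x ν) (tilt θ ν) (shift θ s x ν)) p =
      inner ℝ (shift θ s x ν p) (ν p) * curvPolyDeriv x ν s p -
        n * (tiltWeight θ ν p * curvPoly x ν s p) := by
  have hp := mem_chart_source' (n := n) p
  rw [density, divForm, coordDeriv_shift hx s hp, coordDeriv_tilt hx.smooth_normal hp,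
    frameVar_self, hx.frameVar_eq, hx.frameDet_mul_areaForm, hx.inner_tilt]
  field_simp [hx.areaForm_ne_zero hp]

theorem curvPoly_minkowski_eq (x ν : M → Amb n) (a w s : ℝ) (p : M) :
    (a + s * w) * curvPolyDeriv x ν s p - n * (w * curvPoly x ν s p) =
      ∑ k ∈ Finset.range n, s ^ k * (((n - k : ℝ) * n.choose k) *
        (meanCurv (k + 1) x ν p * a - meanCurv k x ν p * w)) := by
  have h1 : s * curvPolyDeriv x ν s p = 
      ∑ k ∈ Finset.range (n + 1), s ^ k * (k * (n.choose k * meanCurv k x ν p)) := by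
    rw [Finset.sum_range_succ', curvPolyDeriv, Finset.mul_sum]
    simp only [Nat.cast_zero, zero_mul, mul_zero, add_zero]
    refine Finset.sum_congr rfl fun k _ => ?_
    push_cast
    ring
  have h2 : s * curvPolyDeriv x ν s p - n * curvPoly x ν s p =
      ∑ k ∈ Finset.range n, s ^ k * (-((n - k : ℝ) * n.choose k) * meanCurv k x ν p) := by
    rw [h1, curvPoly, Finset.mul_sum, ← Finset.sum_sub_distrib, Finset.sum_range_succ]
    rw [show ∀ A B : ℝ, B = 0 → A + B = A from fun A B h => by rw [h, add_zero]]
    · exact Finset.sum_congr rfl fun k _ => by ring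
    · ring
  have h3 : curvPolyDeriv x ν s p = ∑ k ∈ Finset.range n,
      s ^ k * (((n - k : ℝ) * n.choose k) * meanCurv (k + 1) x ν p) := by
    refine Finset.sum_congr rfl fun k hk => ?_
    have h4 := Nat.choose_succ_right_eq n k
    have h5 : (n.choose (k + 1) : ℝ) * (k + 1) = n.choose k * (n - k) := by
      rw [← Nat.cast_sub (Finset.mem_range.1 hk).le]
      exact_mod_cast h4
    linear_combination s ^ k * meanCurv (k + 1) x ν p * h5
  calc (a + s * w) * curvPolyDeriv x ν s p - n * (w * curvPoly x ν s p)
      = a * curvPolyDeriv x ν s p +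
        w * (s * curvPolyDeriv x ν s p - n * curvPoly x ν s p) := by ring
    _ = _ := by
      rw [h2, h3, Finset.mul_sum, Finset.mul_sum, ← Finset.sum_add_distrib]
      exact Finset.sum_congr rfl fun k _ => by ring

theorem IsCapillary.inner_shift (hx : IsCapillary θ x ν) (s : ℝ) (p : M) :
    inner ℝ (shift θ s x ν p) (ν p) = inner ℝ (x p) (ν p) + s * tiltWeight θ ν p := by
  rw [← hx.inner_tilt]
  simp [shift, inner_add_left, inner_smul_left]

theorem frameDet_update_eq_zero_of_boundary {b a y : M → Amb n}
    (hy : ContMDiff (𝓡∂ n) 𝓘(ℝ, Amb n) ∞ y)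
    (hb0 : ∀ p ∈ (𝓡∂ n).boundary M, b p (Fin.last n) = 0)
    (ha0 : ∀ p ∈ (𝓡∂ n).boundary M, a p (Fin.last n) = 0)
    (hy0 : ∀ p ∈ (𝓡∂ n).boundary M, y p (Fin.last n) = 0) {c : M}
    {u : EuclideanSpace ℝ (Fin n)} (hu : u ∈ (extChartAt (𝓡∂ n) c).target) (h0 : u 0 = 0) :
    frameDet (b ((extChartAt (𝓡∂ n) c).symm u))
        (Function.update (coordDeriv c y ((extChartAt (𝓡∂ n) c).symm u)) 0
          (a ((extChartAt (𝓡∂ n) c).symm u))) = 0 := by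
  have hp := chart_symm_mem_boundary hu h0
  refine frameDet_eq_zero_of_horizontal (hb0 _ hp) fun j => ?_
  by_cases hj : j = 0
  · subst hj; simpa using ha0 _ hp
  · rw [Function.update_of_ne hj]
    exact coordDeriv_last_eq_zero hy hy0 hu h0 hj

/-- Stokes' theorem for fields that are horizontal along the boundary. -/
theorem surface_stokes_horizontal (hx : IsCapillary θ x ν) {b a y : M → Amb n}
    (hb : ContMDiff (𝓡∂ n) 𝓘(ℝ, Amb n) ∞ b) (ha : ContMDiff (𝓡∂ n) 𝓘(ℝ, Amb n) ∞ a)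
    (hy : ContMDiff (𝓡∂ n) 𝓘(ℝ, Amb n) ∞ y)
    (hb0 : ∀ p ∈ (𝓡∂ n).boundary M, b p (Fin.last n) = 0)
    (ha0 : ∀ p ∈ (𝓡∂ n).boundary M, a p (Fin.last n) = 0)
    (hy0 : ∀ p ∈ (𝓡∂ n).boundary M, y p (Fin.last n) = 0) :
    surfaceIntegral x (density x ν (divForm b a y)) = 0 := by
  rw [surface_stokes hx hb ha hy, neg_eq_zero]
  refine Finset.sum_eq_zero fun c _ => ?_
  refine MeasureTheory.setIntegral_eq_zero_of_forall_eq_zero fun v hv => ?_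
  rw [frameDet_update_eq_zero_of_boundary hy hb0 ha0 hy0 hv (bdryIncl_apply_zero v), mul_zero,
    mul_zero]

/-- The **Minkowski formula** for capillary hypersurfaces. -/
theorem IsCapillary.minkowski (hx : IsCapillary θ x ν) {k : ℕ} (hk : k < n) :
    surfaceIntegral x (fun p => meanCurv (k + 1) x ν p * inner ℝ (x p) (ν p)) =
      weightedCurv θ k x ν := by
  have hcont : ∀ k < n, Continuous fun p => meanCurv (k + 1) x ν p * inner ℝ (x p) (ν p) -
      meanCurv k x ν p * tiltWeight θ ν p := fun k hk =>
    ((hx.continuous_meanCurv hk).mul hx.continuous_inner_normal).sub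
      ((hx.continuous_meanCurv hk.le).mul hx.continuous_tiltWeight)
  have h1 : ∀ s : ℝ, ∑ k ∈ Finset.range n, s ^ k * (((n - k : ℝ) * n.choose k) *
      surfaceIntegral x (fun p => meanCurv (k + 1) x ν p * inner ℝ (x p) (ν p) -
        meanCurv k x ν p * tiltWeight θ ν p)) = 0 := by
    intro s
    have h2 := surface_stokes_horizontal hx (contMDiff_shift hx s)
      (contMDiff_tilt hx.smooth_normal) (contMDiff_shift hx s) (fun p hp => hx.shift_last s hp)
      (fun p hp => hx.tilt_last hp) (fun p hp => hx.shift_last s hp)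
    simp only [funext (hx.density_divForm_shift s), hx.inner_shift, curvPoly_minkowski_eq] at h2
    have h3 : ∀ k ∈ Finset.range n, Continuous fun p => s ^ k * (((n - k : ℝ) * n.choose k) *
        (meanCurv (k + 1) x ν p * inner ℝ (x p) (ν p) - meanCurv k x ν p * tiltWeight θ ν p)) :=
      fun k hk => continuous_const.mul (continuous_const.mul (hcont k (Finset.mem_range.1 hk)))
    rw [surfaceIntegral_sum hx _ h3] at h2
    simpa only [surfaceIntegral_const_mul] using h2
  have h2 := eq_zero_of_sum_pow_eq_zero h1 k hk
  have h3 : ((n - k : ℝ) * n.choose k) ≠ 0 := by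
    refine mul_ne_zero (sub_ne_zero.2 ?_) ?_
    · exact_mod_cast hk.ne'
    · exact_mod_cast (Nat.choose_pos hk.le).ne'
  have h4 := (mul_eq_zero.1 h2).resolve_left h3
  have h5 := surfaceIntegral_add hx (hcont k hk) (ψ := fun p => meanCurv k x ν p *
    tiltWeight θ ν p) ((hx.continuous_meanCurv hk.le).mul hx.continuous_tiltWeight)
  simp only [sub_add_cancel] at h5
  rw [h5, h4, zero_add, weightedCurv]

end Minkowski

/-! ### The boundary of a capillary hypersurface -/

section Boundary

open MeasureTheory

theorem det_eq_of_column_zero {n : ℕ} [NeZero n] (A : Matrix (Fin n) (Fin n) ℝ)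
    (h : ∀ i, i ≠ 0 → A i 0 = 0) :
    A.det = A 0 0 * (A.submatrix (Subtype.val : {i : Fin n // i ≠ 0} → Fin n) Subtype.val).det := by
  obtain ⟨m, rfl⟩ := Nat.exists_eq_succ_of_ne_zero (NeZero.ne n)
  rw [Matrix.det_succ_column_zero, Finset.sum_eq_single 0]
  · have e : Fin m ≃ {i : Fin (m + 1) // i ≠ 0} := finSuccAboveEquiv 0
    have h2 : (A.submatrix (Subtype.val : {i : Fin (m + 1) // i ≠ 0} → Fin (m + 1))
        Subtype.val).det = (A.submatrix (Fin.succAbove 0) Fin.succ).det := by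
      rw [← Matrix.det_submatrix_equiv_self (finSuccAboveEquiv 0)]
      rfl
    rw [h2]
    simp
  · intro i _ hi
    rw [h i hi]; simp
  · simp

theorem card_ne_zero_fin (n : ℕ) [NeZero n] : Fintype.card {i : Fin n // i ≠ 0} = n - 1 := by
  simp [Fintype.card_subtype_compl]

variable {n : ℕ} [NeZero n] {M : Type*} [TopologicalSpace M] [ChartedSpace (EuclideanHalfSpace n) M]
  [IsManifold (𝓡∂ n) ∞ M] {θ : ℝ} {x ν : M → Amb n}

theorem chart_boundary_zero {c p : M} (hp : p ∈ (chartAt (EuclideanHalfSpace n) c).source)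
    (hb : p ∈ (𝓡∂ n).boundary M) : extChartAt (𝓡∂ n) c p 0 = 0 := by
  have hu := chart_mem_target hp
  by_contra h
  have h1 := chart_symm_mem_interior hu (lt_of_le_of_ne (target_subset_halfSpace c hu) (Ne.symm h))
  rw [chart_left_inv hp] at h1
  rw [← ModelWithCorners.compl_interior] at hb
  exact hb h1

theorem tangentCoordChange_apply_zero {c c' p : M}
    (hp : p ∈ (chartAt (EuclideanHalfSpace n) c).source)
    (hp' : p ∈ (chartAt (EuclideanHalfSpace n) c').source) (hb : p ∈ (𝓡∂ n).boundary M)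
    {j : Fin n} (hj : j ≠ 0) : tangentCoordChange (𝓡∂ n) c c' p (stdVec j) 0 = 0 := by
  have h2 := hasFDerivWithinAt_tangentCoordChange (I := 𝓡∂ n) (x := c) (y := c') (z := p)
    (by rw [extChartAt_source, extChartAt_source]; exact ⟨hp, hp'⟩)
  have h3 := hasDerivAt_line ((PiLp.hasFDerivAt_apply (𝕜 := ℝ) 2 _ 0).comp_hasFDerivWithinAt _ h2)
    (chart_boundary_zero hp hb) hj
  refine h3.unique ((hasDerivAt_const (0 : ℝ) (0 : ℝ)).congr_of_eventuallyEq ?_)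
  have h4 := eventually_line_boundary (chart_mem_target hp) (chart_boundary_zero hp hb) hj
  have h5 : Filter.Tendsto (fun s : ℝ => (extChartAt (𝓡∂ n) c).symm (extChartAt (𝓡∂ n) c p +
      s • (stdVec j : EuclideanSpace ℝ (Fin n)))) (𝓝 0) (𝓝 p) := by
    have h6 := (continuousAt_extChartAt_symm' (I := 𝓡∂ n) (x := c) (x' := p)
      (by rwa [extChartAt_source])).tendsto
    rw [chart_left_inv hp] at h6
    refine h6.comp ?_
    have : Continuous (fun s : ℝ => extChartAt (𝓡∂ n) c p +
      s • (stdVec j : EuclideanSpace ℝ (Fin n))) := by fun_prop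
    simpa using this.tendsto 0
  filter_upwards [h4, h5 ((chartAt (EuclideanHalfSpace n) c').open_source.mem_nhds hp')] with s hs hs'
  exact chart_boundary_zero hs' hs.2

theorem coordDeriv_boundary_change {g : M → Amb n} (hg : ContMDiff (𝓡∂ n) 𝓘(ℝ, Amb n) ∞ g)
    {c c' p : M} (hp : p ∈ (chartAt (EuclideanHalfSpace n) c).source)
    (hp' : p ∈ (chartAt (EuclideanHalfSpace n) c').source) (hb : p ∈ (𝓡∂ n).boundary M)
    {j : Fin n} (hj : j ≠ 0) :
    coordDeriv c g p j = ∑ i : {i : Fin n // i ≠ 0},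
      tangentCoordChange (𝓡∂ n) c c' p (stdVec j) i.1 • coordDeriv c' g p i.1 := by
  set w := tangentCoordChange (𝓡∂ n) c c' p (stdVec j) with hw
  have h0 : w 0 = 0 := tangentCoordChange_apply_zero hp hp' hb hj
  rw [coordDeriv_eq, chartDeriv_comp hg hp hp', ContinuousLinearMap.comp_apply, ← hw]
  conv_lhs => rw [eq_sum_stdVec w, map_sum, Fintype.sum_eq_add_sum_subtype_ne _ 0, h0]
  simp [coordDeriv_eq]

/-- The tangential Jacobian of a change of charts at a boundary point. -/
def bdryJacobian (c c' p : M) : Matrix {i : Fin n // i ≠ 0} {i : Fin n // i ≠ 0} ℝ :=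
  Matrix.of fun i j => tangentCoordChange (𝓡∂ n) c c' p (stdVec j.1) i.1

theorem bdryPairing_change {g : M → Amb n} (hg : ContMDiff (𝓡∂ n) 𝓘(ℝ, Amb n) ∞ g)
    (hx : ContMDiff (𝓡∂ n) 𝓘(ℝ, Amb n) ∞ x)
    {c c' p : M} (hp : p ∈ (chartAt (EuclideanHalfSpace n) c).source)
    (hp' : p ∈ (chartAt (EuclideanHalfSpace n) c').source) (hb : p ∈ (𝓡∂ n).boundary M) :
    bdryPairing c g x p =
      (bdryJacobian c c' p).transpose * bdryPairing c' g x p * bdryJacobian c c' p := by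
  ext i j
  simp only [bdryPairing, pairing, Matrix.submatrix_apply, Matrix.of_apply, Matrix.mul_apply,
    Matrix.transpose_apply, bdryJacobian]
  rw [coordDeriv_boundary_change hg hp hp' hb i.2, coordDeriv_boundary_change hx hp hp' hb j.2,
    inner_sum]
  refine Finset.sum_congr rfl fun a _ => ?_
  rw [sum_inner, Finset.sum_mul]
  refine Finset.sum_congr rfl fun b _ => ?_
  rw [inner_smul_left, inner_smul_right, RCLike.conj_to_real]
  ring

theorem IsCapillary.bdryPairing_posDef (hx : IsCapillary θ x ν) {c p : M}
    (hp : p ∈ (chartAt (EuclideanHalfSpace n) c).source) : (bdryPairing c x x p).PosDef :=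
  (hx.posDef hp).submatrix Subtype.val_injective

theorem IsCapillary.bdryPairing_isHermitian (hx : IsCapillary θ x ν) {c p : M}
    (hp : p ∈ (chartAt (EuclideanHalfSpace n) c).source) : (bdryPairing c ν x p).IsHermitian :=
  (hx.pairing_isHermitian hp).submatrix _

theorem IsCapillary.norm_tilt (hx : IsCapillary θ x ν) (hθ : 0 ≤ Real.sin θ) {p : M}
    (hp : p ∈ (𝓡∂ n).boundary M) : ‖tilt θ ν p‖ = Real.sin θ := by
  have h := hx.contact_angle p hp
  rw [Real.cos_pi_sub] at h
  have h2 : ‖tilt θ ν p‖ ^ 2 = Real.sin θ ^ 2 := by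
    have h3 : ‖downVec n‖ = 1 := by simp [downVec]
    rw [tilt, Pi.add_apply, norm_add_sq_real, hx.unit_normal, inner_smul_right, h, norm_smul, h3,
      Real.sin_sq, Real.norm_eq_abs, mul_one, sq_abs]
    ring
  exact (sq_eq_sq₀ (norm_nonneg _) hθ).1 h2

theorem IsCapillary.bdryNormal_eq (hx : IsCapillary θ x ν) (hθ : 0 ≤ Real.sin θ) {p : M}
    (hp : p ∈ (𝓡∂ n).boundary M) : bdryNormal ν p = (Real.sin θ)⁻¹ • tilt θ ν p := by
  have h := hx.contact_angle p hp
  rw [Real.cos_pi_sub] at h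
  have h2 : ν p - inner ℝ (ν p) (downVec n) • downVec n = tilt θ ν p := by
    rw [h, tilt, Pi.add_apply, neg_smul, sub_neg_eq_add]
  rw [bdryNormal, h2, hx.norm_tilt hθ hp]

theorem IsCapillary.bdryPairing_bdryNormal (hx : IsCapillary θ x ν) (hθ : 0 < Real.sin θ) {p : M}
    (hb : p ∈ (𝓡∂ n).boundary M) :
    bdryPairing p (bdryNormal ν) x p = (Real.sin θ)⁻¹ • bdryPairing p ν x p := by
  have hp := mem_chart_source' (n := n) p
  have hu := chart_mem_target hp
  ext i j
  simp only [bdryPairing, pairing, Matrix.submatrix_apply, Matrix.of_apply, Matrix.smul_apply,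
    smul_eq_mul]
  have h1 := hasFDerivWithinAt_chart (contMDiff_tilt (θ := θ) hx.smooth_normal) hp
  have h2 : DifferentiableWithinAt ℝ (bdryNormal ν ∘ (extChartAt (𝓡∂ n) p).symm) (range (𝓡∂ n))
      (extChartAt (𝓡∂ n) p p) := by
    have h3 := differentiableWithinAt_chart hx.smooth_normal hp
    have h4 : DifferentiableWithinAt ℝ (fun u => ν ((extChartAt (𝓡∂ n) p).symm u) -
        inner ℝ (ν ((extChartAt (𝓡∂ n) p).symm u)) (downVec n) • downVec n) (range (𝓡∂ n))
        (extChartAt (𝓡∂ n) p p) :=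
      h3.sub ((h3.inner ℝ (differentiableWithinAt_const _)).smul_const _)
    refine ((h4.norm ℝ ?_).inv ?_).smul h4
    all_goals
      simp only [chart_left_inv hp]
      have h5 := hx.contact_angle p hb
      rw [Real.cos_pi_sub] at h5
      have h6 : ν p - inner ℝ (ν p) (downVec n) • downVec n = tilt θ ν p := by
        rw [h5, tilt, Pi.add_apply, neg_smul, sub_neg_eq_add]
      have h7 := hx.norm_tilt hθ.le hb
      rw [h6]
    · rw [← norm_ne_zero_iff, h7]; exact hθ.ne'
    · rw [h7]; exact hθ.ne'
  have h3 := fderivWithin_eq_of_eq_boundary (g := fun q => (Real.sin θ)⁻¹ • tilt θ ν q) hu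
    (chart_boundary_zero hp hb) h2.hasFDerivWithinAt (h1.const_smul (Real.sin θ)⁻¹) i.2
    fun q _ hq => hx.bdryNormal_eq hθ.le hq
  have h4 : coordDeriv p (bdryNormal ν) p i.1 = (Real.sin θ)⁻¹ • coordDeriv p ν p i.1 := by
    rw [← coordDeriv_tilt (θ := θ) hx.smooth_normal hp]
    exact h3
  rw [h4, inner_smul_left, RCLike.conj_to_real]

/-- The Steiner polynomial of the boundary. -/
def bdryPoly (θ : ℝ) (x ν : M → Amb n) (s : ℝ) (p : M) : ℝ :=
  ∑ k ∈ Finset.range n, s ^ k * ((n - 1).choose k * Real.sin θ ^ k * bdryMeanCurv k x ν p)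

theorem IsCapillary.det_bdryPairing_add (hx : IsCapillary θ x ν) (hθ : 0 < Real.sin θ) {c p : M}
    (hp : p ∈ (chartAt (EuclideanHalfSpace n) c).source) (hb : p ∈ (𝓡∂ n).boundary M) (s : ℝ) :
    (bdryPairing c x x p + s • bdryPairing c ν x p).det =
      (bdryPairing c x x p).det * bdryPoly θ x ν s p := by
  have hp' := mem_chart_source' (n := n) p
  have h1 : (bdryPairing p x x p + s • bdryPairing p ν x p).det =
      (bdryPairing p x x p).det * bdryPoly θ x ν s p := by
    have h2 : s • bdryPairing p ν x p =
        (s * Real.sin θ) • bdryPairing p (bdryNormal ν) x p := by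
      rw [hx.bdryPairing_bdryNormal hθ hb, smul_smul, mul_assoc, mul_inv_cancel₀ hθ.ne', mul_one]
    have h3 : (bdryPairing p (bdryNormal ν) x p).IsHermitian := by
      rw [hx.bdryPairing_bdryNormal hθ hb]
      have := hx.bdryPairing_isHermitian hp'
      rw [Matrix.IsHermitian] at this ⊢
      rw [Matrix.conjTranspose_smul, this, star_trivial]
    rw [h2, det_add_smul_eq_sum (hx.bdryPairing_posDef hp') h3, card_ne_zero_fin,
      Nat.sub_add_cancel (NeZero.one_le), bdryPoly]
    congr 1
    refine Finset.sum_congr rfl fun k _ => ?_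
    rw [bdryMeanCurv, mul_pow]
    ring
  have h2 : bdryPairing c x x p + s • bdryPairing c ν x p = (bdryJacobian c p p).transpose *
      (bdryPairing p x x p + s • bdryPairing p ν x p) * bdryJacobian c p p := by
    rw [bdryPairing_change hx.smooth hx.smooth hp hp' hb,
      bdryPairing_change hx.smooth_normal hx.smooth hp hp' hb, mul_add, add_mul,
      Matrix.mul_smul, Matrix.smul_mul]
  rw [h2, bdryPairing_change hx.smooth hx.smooth hp hp' hb]
  simp only [Matrix.det_mul, Matrix.det_transpose, h1]
  ring

/-- The flux through the boundary that occurs in the boundary formula. -/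
def bdryFlux (θ s : ℝ) (x ν : M → Amb n) (c p : M) : ℝ :=
  frameDet (downVec n) (Function.update (coordDeriv c (shift θ s x ν) p) 0 (tilt θ ν p))

theorem inner_eq_zero_of_last {v : Amb n} (hv : v (Fin.last n) = 0) :
    inner ℝ v (downVec n) = 0 := by rw [inner_downVec, hv, neg_zero]

theorem IsCapillary.bdryFlux_mul (hx : IsCapillary θ x ν) (hθ : 0 < Real.sin θ) {c : M}
    {u : EuclideanSpace ℝ (Fin n)} (hu : u ∈ (extChartAt (𝓡∂ n) c).target) (h0 : u 0 = 0) (s : ℝ) :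
    bdryFlux θ s x ν c ((extChartAt (𝓡∂ n) c).symm u) *
      bdryFlux θ 0 x ν c ((extChartAt (𝓡∂ n) c).symm u) = Real.sin θ ^ 2 *
      ((bdryPairing c x x ((extChartAt (𝓡∂ n) c).symm u)).det *
        bdryPoly θ x ν s ((extChartAt (𝓡∂ n) c).symm u)) := by
  set p := (extChartAt (𝓡∂ n) c).symm u with hpu
  have hp : p ∈ (chartAt (EuclideanHalfSpace n) c).source := chart_symm_mem hu
  have hb : p ∈ (𝓡∂ n).boundary M := chart_symm_mem_boundary hu h0
  have hlast : ∀ r : ℝ, ∀ j ≠ 0, coordDeriv c (shift θ r x ν) p j (Fin.last n) = 0 :=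
    fun r j hj => coordDeriv_last_eq_zero (contMDiff_shift hx r) (fun q hq => hx.shift_last r hq)
      hu h0 hj
  have hw := hx.tilt_last hb
  rw [bdryFlux, bdryFlux, frameDet_mul_of_orthogonal, det_eq_of_column_zero,
    ← hx.det_bdryPairing_add hθ hp hb]
  · have h1 : inner ℝ (downVec n) (downVec n) = (1 : ℝ) := by
      simp [downVec]
    simp only [Matrix.of_apply, Function.update_self, h1, real_inner_self_eq_norm_sq,
      hx.norm_tilt hθ.le hb, one_mul]
    congr 1
    congr 1
    ext i j
    simp only [Matrix.submatrix_apply, Matrix.of_apply, Function.update_of_ne i.2,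
      Function.update_of_ne j.2, Matrix.add_apply, Matrix.smul_apply, bdryPairing, pairing,
      coordDeriv_shift hx s hp, coordDeriv_shift hx 0 hp, zero_smul, add_zero, Pi.add_apply,
      Pi.smul_apply, inner_add_left, inner_smul_left, RCLike.conj_to_real, smul_eq_mul]
  · intro i hi
    simp only [Matrix.of_apply, Function.update_self, Function.update_of_ne hi]
    rw [tilt, Pi.add_apply, inner_add_right, inner_smul_right, inner_eq_zero_of_last (hlast s i hi),
      coordDeriv_shift hx s hp, Pi.add_apply, Pi.smul_apply, inner_add_left, inner_smul_left,
      hx.inner_coordDeriv hp, hx.inner_coordDeriv_normal hp]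
    simp
  · intro i
    by_cases hi : i = 0
    · subst hi
      rw [Function.update_self]
      exact inner_eq_zero_of_last hw
    · rw [Function.update_of_ne hi]
      exact inner_eq_zero_of_last (hlast s i hi)

theorem IsCapillary.last_nonneg (hx : IsCapillary θ x ν) (p : M) : 0 ≤ x p (Fin.last n) := by
  rcases (𝓡∂ n).isInteriorPoint_or_isBoundaryPoint p with h | h
  · exact (hx.interior_pos p h).le
  · exact (hx.boundary_zero p h).ge

theorem IsCapillary.coordDeriv_zero_last_nonneg (hx : IsCapillary θ x ν) {c : M}
    {u : EuclideanSpace ℝ (Fin n)} (hu : u ∈ (extChartAt (𝓡∂ n) c).target) (h0 : u 0 = 0) :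
    0 ≤ coordDeriv c x ((extChartAt (𝓡∂ n) c).symm u) 0 (Fin.last n) := by
  have h1 := hasFDerivWithinAt_chart hx.smooth (chart_symm_mem hu)
  rw [(extChartAt (𝓡∂ n) c).right_inv hu] at h1
  have h2 := (PiLp.hasFDerivAt_apply (𝕜 := ℝ) 2 _ (Fin.last n)).comp_hasFDerivWithinAt u h1
  have h3 : IsLocalMinOn ((fun v : Amb n => v (Fin.last n)) ∘ x ∘ (extChartAt (𝓡∂ n) c).symm)
      (range (𝓡∂ n)) u := by
    refine Filter.Eventually.of_forall fun v => ?_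
    simp only [Function.comp_apply]
    rw [hx.boundary_zero _ (chart_symm_mem_boundary hu h0)]
    exact hx.last_nonneg _
  refine h3.hasFDerivWithinAt_nonneg h2 (mem_posTangentConeAt_of_segment_subset (y := stdVec 0) ?_)
  rw [range_modelWithCornersEuclideanHalfSpace]
  refine Convex.segment_subset (convex_halfSpace_ge ?_ 0) ?_ ?_
  · exact ⟨fun _ _ => rfl, fun _ _ => rfl⟩
  · exact h0.ge
  · simp [stdVec, h0]

theorem IsCapillary.orient_mul_bdryFlux (hx : IsCapillary θ x ν) (hθ : 0 < Real.sin θ) {c : M}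
    {u : EuclideanSpace ℝ (Fin n)} (hu : u ∈ (extChartAt (𝓡∂ n) c).target) (h0 : u 0 = 0) (s : ℝ) :
    orient x ν c ((extChartAt (𝓡∂ n) c).symm u) *
      bdryFlux θ s x ν c ((extChartAt (𝓡∂ n) c).symm u) = Real.sin θ *
      (bdryPoly θ x ν s ((extChartAt (𝓡∂ n) c).symm u) *
      Real.sqrt (bdryPairing c x x ((extChartAt (𝓡∂ n) c).symm u)).det) := by
  set p := (extChartAt (𝓡∂ n) c).symm u with hpu
  have hp : p ∈ (chartAt (EuclideanHalfSpace n) c).source := chart_symm_mem hu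
  have hb : p ∈ (𝓡∂ n).boundary M := chart_symm_mem_boundary hu h0
  have hd := (hx.bdryPairing_posDef hp).det_pos
  have h1 := hx.bdryFlux_mul hθ hu h0 0
  have h2 := hx.bdryFlux_mul hθ hu h0 s
  rw [← hpu] at h1 h2
  set d := (bdryPairing c x x p).det
  set β := bdryFlux θ 0 x ν c p
  have hpoly : bdryPoly θ x ν 0 p = 1 := by
    have h3 := hx.det_bdryPairing_add hθ hp hb 0
    rw [zero_smul, add_zero] at h3
    exact mul_left_cancel₀ hd.ne' (by rw [← h3, mul_one])
  rw [hpoly, mul_one] at h1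
  have hβ : β ≠ 0 := by
    intro h
    rw [h, mul_zero] at h1
    have : 0 < Real.sin θ ^ 2 * d := by positivity
    exact this.ne h1
  have harea := hx.areaForm_ne_zero hp
  have hlast : ∀ j ≠ 0, coordDeriv c x p j (Fin.last n) = 0 := fun j hj =>
    coordDeriv_last_eq_zero hx.smooth hx.boundary_zero hu h0 hj
  have h4 : 0 ≤ areaForm x ν c p * β := by
    have e1 : β = -frameDet (ν p) (Function.update (coordDeriv c x p) 0 (downVec n)) := by
      simp only [β, bdryFlux, coordDeriv_shift hx 0 hp, zero_smul, add_zero, tilt, Pi.add_apply]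
      have e0 := frameDet_swap_update (downVec n) (downVec n) (coordDeriv c x p) 0
      rw [frameDet_update_add, frameDet_update_smul,
        show frameDet (downVec n) (Function.update (coordDeriv c x p) 0 (downVec n)) = 0 by linarith,
        mul_zero, add_zero, frameDet_swap_update]
    have e2 : areaForm x ν c p * frameDet (ν p) (Function.update (coordDeriv c x p) 0 (downVec n)) =
        -(coordDeriv c x p 0 (Fin.last n)) * d := by
      rw [areaForm, frameDet_mul_of_orthogonal fun i => hx.inner_coordDeriv hp i,
        real_inner_self_eq_norm_sq, hx.unit_normal, det_eq_of_column_zero]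
      · simp only [Matrix.of_apply, Function.update_self, inner_downVec, one_pow, one_mul]
        congr 1
        simp only [d]
        congr 1
        ext i j
        simp [bdryPairing, pairing, Function.update_of_ne j.2]
      · intro i hi
        simp only [Matrix.of_apply, Function.update_self]
        exact inner_eq_zero_of_last (hlast i hi)
    rw [e1, mul_neg, e2, neg_mul, neg_neg]
    exact mul_nonneg (hx.coordDeriv_zero_last_nonneg hu h0) hd.le
  have h5 : areaForm x ν c p * β = |areaForm x ν c p| * |β| := by
    rw [← abs_mul, abs_of_nonneg h4]
  have h6 : |β| = Real.sin θ * Real.sqrt d := by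
    rw [← Real.sqrt_sq_eq_abs, sq, h1, Real.sqrt_mul (sq_nonneg _), Real.sqrt_sq hθ.le]
  have h7 : orient x ν c p * β = |β| := by
    rw [orient, div_mul_eq_mul_div, h5, mul_div_cancel_left₀ _ (abs_ne_zero.2 harea)]
  refine mul_right_cancel₀ (mul_ne_zero hβ hβ) ?_
  calc orient x ν c p * bdryFlux θ s x ν c p * (β * β)
      = (orient x ν c p * β) * (bdryFlux θ s x ν c p * β) := by ring
    _ = _ := by rw [h7, h6, h2, h1]; ring

/-! ### The boundary formula -/

theorem isCompact_preimage_bdryIncl {K : Set (EuclideanSpace ℝ (Fin n))} (hK : IsCompact K) :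
    IsCompact (bdryIncl ⁻¹' K) := by
  refine Metric.isCompact_of_isClosed_isBounded (hK.isClosed.preimage continuous_bdryIncl) ?_
  obtain ⟨R, hR⟩ := hK.isBounded.exists_norm_le
  exact isBounded_iff_forall_norm_le.2 ⟨R, fun v hv => by
    rw [← norm_bdryIncl]; exact hR _ hv⟩

variable [CompactSpace M] [T2Space M]

theorem IsCapillary.integrableOn_bdryFlux (hx : IsCapillary θ x ν) (s : ℝ) (c : M) :
    IntegrableOn (fun v => chartPartition n M c ((extChartAt (𝓡∂ n) c).symm (bdryIncl v)) *
      (orient x ν c ((extChartAt (𝓡∂ n) c).symm (bdryIncl v)) *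
        bdryFlux θ s x ν c ((extChartAt (𝓡∂ n) c).symm (bdryIncl v))))
      (bdryIncl ⁻¹' (extChartAt (𝓡∂ n) c).target) := by
  set T := (extChartAt (𝓡∂ n) c).target
  have hK' : tsupport (chartPartition n M c) ⊆ (extChartAt (𝓡∂ n) c).source := by
    rw [extChartAt_source]; exact tsupport_chartPartition_subset c
  have hK := isCompact_preimage_bdryIncl ((isCompact_tsupport_chartPartition (n := n) c).image_of_continuousOn
    ((continuousOn_extChartAt c).mono hK'))
  have hsub : extChartAt (𝓡∂ n) c '' tsupport (chartPartition n M c) ⊆ T := by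
    rintro _ ⟨p, hp, rfl⟩
    exact (extChartAt (𝓡∂ n) c).map_source (hK' hp)
  have hcont : ContinuousOn (fun u => chartPartition n M c ((extChartAt (𝓡∂ n) c).symm u) *
      (orient x ν c ((extChartAt (𝓡∂ n) c).symm u) *
        bdryFlux θ s x ν c ((extChartAt (𝓡∂ n) c).symm u))) T := by
    refine ((continuous_chartPartition c).comp_continuousOn (continuousOn_chart_symm c)).mul
      ((hx.continuousOn_orient c).mul ?_)
    have h1 : ContinuousOn (bdryFlux θ s x ν c) (chartAt (EuclideanHalfSpace n) c).source := by
      refine continuousOn_frameDet continuousOn_const fun j => ?_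
      by_cases h : j = 0
      · subst h; simpa using (contMDiff_tilt hx.smooth_normal).continuous.continuousOn
      · simpa [Function.update_of_ne h] using continuousOn_coordDeriv (contMDiff_shift hx s) c j
    exact h1.comp (continuousOn_chart_symm c) fun u hu => chart_symm_mem hu
  refine IntegrableOn.of_forall_sdiff_eq_zero (s := bdryIncl ⁻¹' (extChartAt (𝓡∂ n) c ''
    tsupport (chartPartition n M c))) ((hcont.comp continuous_bdryIncl.continuousOn
      fun v hv => hsub hv).integrableOn_compact hK)
    (continuous_bdryIncl.measurable (measurableSet_target c)) fun v hv => ?_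
  have h0 : chartPartition n M c ((extChartAt (𝓡∂ n) c).symm (bdryIncl v)) = 0 := by
    refine image_eq_zero_of_notMem_tsupport fun h => hv.2 ?_
    exact ⟨_, h, (extChartAt (𝓡∂ n) c).right_inv hv.1⟩
  simp only [h0, zero_mul]

theorem IsCapillary.integrableOn_bdryMeanCurv (hx : IsCapillary θ x ν) (hθ : 0 < Real.sin θ)
    {k : ℕ} (hk : k < n) (c : M) :
    IntegrableOn (fun v => chartPartition n M c ((extChartAt (𝓡∂ n) c).symm (bdryIncl v)) *
        bdryMeanCurv k x ν ((extChartAt (𝓡∂ n) c).symm (bdryIncl v)) *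
        Real.sqrt (bdryPairing c x x ((extChartAt (𝓡∂ n) c).symm (bdryIncl v))).det)
      (bdryIncl ⁻¹' (extChartAt (𝓡∂ n) c).target) := by
  obtain ⟨L, hL⟩ := exists_coeff_extraction n
  have h1 : IntegrableOn (fun v => ((n - 1).choose k * Real.sin θ ^ k * Real.sin θ)⁻¹ *
      ∑ j ∈ Finset.range n, L k j *
      (chartPartition n M c ((extChartAt (𝓡∂ n) c).symm (bdryIncl v)) *
      (orient x ν c ((extChartAt (𝓡∂ n) c).symm (bdryIncl v)) *
        bdryFlux θ j x ν c ((extChartAt (𝓡∂ n) c).symm (bdryIncl v)))))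
      (bdryIncl ⁻¹' (extChartAt (𝓡∂ n) c).target) := by
    refine Integrable.const_mul (integrable_finsetSum _ fun j _ => ?_) _
    exact Integrable.const_mul (hx.integrableOn_bdryFlux j c) _
  refine h1.congr_fun (fun v hv => ?_) (continuous_bdryIncl.measurable (measurableSet_target c))
  have hc : ((n - 1).choose k * Real.sin θ ^ k * Real.sin θ : ℝ) ≠ 0 := by
    have h2 : ((n - 1).choose k : ℝ) ≠ 0 := by exact_mod_cast (Nat.choose_pos (by omega)).ne'
    positivity
  simp only
  rw [inv_mul_eq_iff_eq_mul₀ hc]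
  set p := (extChartAt (𝓡∂ n) c).symm (bdryIncl v)
  have h2 := hL (fun k => (n - 1).choose k * Real.sin θ ^ k * bdryMeanCurv k x ν p) k hk
  calc ∑ j ∈ Finset.range n, L k j * (chartPartition n M c p * (orient x ν c p *
        bdryFlux θ j x ν c p))
      = Real.sin θ * chartPartition n M c p * Real.sqrt (bdryPairing c x x p).det *
        ∑ j ∈ Finset.range n, L k j * bdryPoly θ x ν j p := by
        rw [Finset.mul_sum]
        refine Finset.sum_congr rfl fun j _ => ?_
        rw [hx.orient_mul_bdryFlux hθ hv (bdryIncl_apply_zero v)]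
        ring
    _ = _ := by
        simp only [bdryPoly]
        rw [← h2]
        ring

theorem IsCapillary.density_divForm_downVec (hx : IsCapillary θ x ν) (s : ℝ) (p : M) :
    density x ν (divForm (fun _ => downVec n) (tilt θ ν) (shift θ s x ν)) p =
      inner ℝ (ν p) (downVec n) * curvPolyDeriv x ν s p := by
  have hp := mem_chart_source' (n := n) p
  rw [density, divForm, coordDeriv_shift hx s hp, coordDeriv_tilt hx.smooth_normal hp,
    coordDeriv_const, frameVar_zero_right, sub_zero, hx.frameVar_eq, real_inner_comm,
    mul_div_cancel_left₀ _ (hx.areaForm_ne_zero hp)]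

/-- The boundary integrals of the mean curvatures in terms of surface integrals. -/
theorem IsCapillary.bdryIntegral_bdryMeanCurv (hx : IsCapillary θ x ν) (hθ : 0 < Real.sin θ)
    {k : ℕ} (hk : k < n) :
    Real.sin θ ^ (k + 1) / n * bdryIntegral x (bdryMeanCurv k x ν) =
      -surfaceIntegral x (fun p => inner ℝ (ν p) (downVec n) * meanCurv (k + 1) x ν p) := by
  have hcont : Continuous fun p => inner ℝ (ν p) (downVec n) :=
    hx.smooth_normal.continuous.inner continuous_const
  have h1 : ∀ s : ℝ, ∑ k ∈ Finset.range n, s ^ k * ((n * (n - 1).choose k : ℝ) *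
      surfaceIntegral x (fun p => inner ℝ (ν p) (downVec n) * meanCurv (k + 1) x ν p) +
      (n - 1).choose k * Real.sin θ ^ (k + 1) * bdryIntegral x (bdryMeanCurv k x ν)) = 0 := by
    intro s
    have h2 := surface_stokes hx (contMDiff_const (c := downVec n))
      (contMDiff_tilt (θ := θ) hx.smooth_normal) (contMDiff_shift hx s)
    have h3 : surfaceIntegral x (fun p => inner ℝ (ν p) (downVec n) * curvPolyDeriv x ν s p) =
        ∑ k ∈ Finset.range n, s ^ k * ((n * (n - 1).choose k : ℝ) *
        surfaceIntegral x (fun p => inner ℝ (ν p) (downVec n) * meanCurv (k + 1) x ν p)) := by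
      have h4 : ∀ k ∈ Finset.range n, Continuous fun p => s ^ k * ((n * (n - 1).choose k : ℝ) *
          (inner ℝ (ν p) (downVec n) * meanCurv (k + 1) x ν p)) := fun k hk =>
        continuous_const.mul (continuous_const.mul
          (hcont.mul (hx.continuous_meanCurv (Finset.mem_range.1 hk))))
      simp only [← surfaceIntegral_const_mul]
      rw [← surfaceIntegral_sum hx _ h4]
      congr 1
      ext1 p
      rw [curvPolyDeriv, Finset.mul_sum]
      refine Finset.sum_congr rfl fun k hk => ?_
      have h5 := Nat.add_one_mul_choose_eq (n - 1) k
      rw [Nat.sub_add_cancel NeZero.one_le] at h5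
      have h6 : (n : ℝ) * (n - 1).choose k = n.choose (k + 1) * (k + 1) := by exact_mod_cast h5
      linear_combination (-s ^ k * inner ℝ (ν p) (downVec n) * meanCurv (k + 1) x ν p) * h6
    have h4 : ∀ c ∈ activeCharts n M, ∫ v in bdryIncl ⁻¹' (extChartAt (𝓡∂ n) c).target,
        chartPartition n M c ((extChartAt (𝓡∂ n) c).symm (bdryIncl v)) *
        (orient x ν c ((extChartAt (𝓡∂ n) c).symm (bdryIncl v)) *
          bdryFlux θ s x ν c ((extChartAt (𝓡∂ n) c).symm (bdryIncl v))) =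
        ∑ k ∈ Finset.range n, s ^ k * ((n - 1).choose k * Real.sin θ ^ (k + 1) *
        ∫ v in bdryIncl ⁻¹' (extChartAt (𝓡∂ n) c).target,
        chartPartition n M c ((extChartAt (𝓡∂ n) c).symm (bdryIncl v)) *
        bdryMeanCurv k x ν ((extChartAt (𝓡∂ n) c).symm (bdryIncl v)) *
        Real.sqrt (bdryPairing c x x ((extChartAt (𝓡∂ n) c).symm (bdryIncl v))).det) := by
      intro c _
      simp only [← integral_const_mul]
      rw [← integral_finsetSum _ fun k hk => Integrable.const_mul (Integrable.const_mul
        (hx.integrableOn_bdryMeanCurv hθ (Finset.mem_range.1 hk) c) _) _]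
      refine setIntegral_congr_fun (continuous_bdryIncl.measurable (measurableSet_target c))
        fun v hv => ?_
      rw [hx.orient_mul_bdryFlux hθ hv (bdryIncl_apply_zero v), bdryPoly, Finset.sum_mul,
        Finset.mul_sum, Finset.mul_sum]
      refine Finset.sum_congr rfl fun k _ => ?_
      ring
    rw [funext (hx.density_divForm_downVec s), h3] at h2
    change _ = -∑ c ∈ activeCharts n M, ∫ v in bdryIncl ⁻¹' (extChartAt (𝓡∂ n) c).target,
        chartPartition n M c ((extChartAt (𝓡∂ n) c).symm (bdryIncl v)) *
        (orient x ν c ((extChartAt (𝓡∂ n) c).symm (bdryIncl v)) *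
          bdryFlux θ s x ν c ((extChartAt (𝓡∂ n) c).symm (bdryIncl v))) at h2
    rw [Finset.sum_congr rfl h4, Finset.sum_comm] at h2
    simp only [mul_add, Finset.sum_add_distrib, h2, bdryIntegral_eq_sum, Finset.mul_sum]
    rw [neg_add_cancel]
  have h2 := eq_zero_of_sum_pow_eq_zero h1 k hk
  have h3 : ((n - 1).choose k : ℝ) ≠ 0 := by exact_mod_cast (Nat.choose_pos (by omega)).ne'
  have h4 : (n : ℝ) ≠ 0 := by exact_mod_cast NeZero.ne n
  refine mul_left_cancel₀ (mul_ne_zero h4 h3) ?_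
  rw [div_mul_eq_mul_div, mul_comm (n : ℝ), mul_assoc, mul_div_cancel₀ _ h4]
  linear_combination h2

theorem IsCapillary.quermass_add_two (hx : IsCapillary θ x ν) (hθ : 0 < Real.sin θ) {k : ℕ}
    (hk : k < n) :
    quermass θ (k + 2) x ν = 1 / (n + 1 : ℝ) * weightedCurv θ (k + 1) x ν := by
  have hcont : Continuous fun p => inner ℝ (ν p) (downVec n) :=
    hx.smooth_normal.continuous.inner continuous_const
  have h1 := hx.bdryIntegral_bdryMeanCurv hθ hk
  have h2 := surfaceIntegral_add hx (hx.continuous_meanCurv hk)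
    (ψ := fun p => Real.cos θ * (inner ℝ (ν p) (downVec n) * meanCurv (k + 1) x ν p))
    (continuous_const.mul (hcont.mul (hx.continuous_meanCurv hk)))
  rw [surfaceIntegral_const_mul] at h2
  have h3 : weightedCurv θ (k + 1) x ν = surfaceIntegral x fun p => meanCurv (k + 1) x ν p +
      Real.cos θ * (inner ℝ (ν p) (downVec n) * meanCurv (k + 1) x ν p) := by
    rw [weightedCurv]
    congr 1
    ext1 p
    rw [tiltWeight]; ring
  rw [h3, h2]
  simp only [quermass]
  linear_combination (-(1 / (n + 1 : ℝ)) * Real.cos θ) * h1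

end Boundary

/-! ### The enclosed region along vertical lines -/

section Enclosed

variable {n : ℕ}

/-- The projection to the supporting hyperplane. -/
def horiz (n : ℕ) : Amb n →L[ℝ] EuclideanSpace ℝ (Fin n) :=
  LinearMap.toContinuousLinearMap
    { toFun := fun v => WithLp.toLp 2 fun i => v i.castSucc
      map_add' := fun _ _ => rfl
      map_smul' := fun _ _ => rfl }

theorem horiz_apply (v : Amb n) (i : Fin n) : horiz n v i = v i.castSucc := rfl

/-- The point at height `h` over the point `y` of the supporting hyperplane. -/
def lift (y : EuclideanSpace ℝ (Fin n)) (h : ℝ) : Amb n :=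
  WithLp.toLp 2 (Fin.snoc (α := fun _ => ℝ) (fun i => y i) h)

theorem lift_last (y : EuclideanSpace ℝ (Fin n)) (h : ℝ) : lift y h (Fin.last n) = h := by
  simp [lift]

theorem lift_castSucc (y : EuclideanSpace ℝ (Fin n)) (h : ℝ) (i : Fin n) :
    lift y h i.castSucc = y i := by
  simp [lift]

theorem horiz_lift (y : EuclideanSpace ℝ (Fin n)) (h : ℝ) : horiz n (lift y h) = y := by
  ext i
  rw [horiz_apply, lift_castSucc]

theorem lift_horiz (v : Amb n) : lift (horiz n v) (v (Fin.last n)) = v := by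
  ext i
  refine Fin.lastCases ?_ (fun i => ?_) i
  · rw [lift_last]
  · rw [lift_castSucc, horiz_apply]

theorem lift_add_smul (y : EuclideanSpace ℝ (Fin n)) (h s : ℝ) :
    lift y h + s • -downVec n = lift y (h + s) := by
  ext i
  refine Fin.lastCases ?_ (fun i => ?_) i
  · simp [lift_last, downVec]
  · simp [lift_castSucc, downVec, (Fin.castSucc_lt_last i).ne]

theorem continuous_lift (h : ℝ) : Continuous fun y : EuclideanSpace ℝ (Fin n) => lift y h := by
  refine (PiLp.continuous_toLp 2 _).comp (continuous_pi fun i => ?_)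
  refine Fin.lastCases ?_ (fun i => ?_) i
  · simpa using continuous_const
  · simpa using PiLp.continuous_apply 2 _ i

theorem lift_eq_add (y : EuclideanSpace ℝ (Fin n)) (h : ℝ) :
    lift y h = lift y 0 + h • -downVec n := by
  rw [lift_add_smul, zero_add]

theorem continuous_lift_right (y : EuclideanSpace ℝ (Fin n)) : Continuous (lift y) := by
  have h : lift y = fun h => lift y 0 + h • -downVec n := funext (lift_eq_add y)
  rw [h]
  fun_prop

theorem mem_enclosed_iff_of_isPreconnected {S C : Set (Amb n)} (hC : IsPreconnected C)
    (hCS : C ⊆ offSurface S) {a b : Amb n} (ha : a ∈ C) (hb : b ∈ C) :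
    a ∈ enclosed S ↔ b ∈ enclosed S := by
  have h := connectedComponentIn_eq (hC.subset_connectedComponentIn ha hCS hb)
  have hb' := hCS hb
  have ha' := hCS ha
  simp only [enclosed, mem_ofPred_eq, ha', hb', true_and, h]

theorem isOpen_offSurface {S : Set (Amb n)} (hS : IsClosed S) : IsOpen (offSurface S) :=
  (isOpen_lt continuous_const (PiLp.continuous_apply 2 _ (Fin.last n))).inter hS.isOpen_compl

theorem isOpen_enclosed {S : Set (Amb n)} (hS : IsClosed S) : IsOpen (enclosed S) := by
  rw [isOpen_iff_mem_nhds]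
  intro q hq
  obtain ⟨r, hr, hrS⟩ := Metric.isOpen_iff.1 (isOpen_offSurface hS) q hq.1
  filter_upwards [Metric.ball_mem_nhds q hr] with a ha
  exact (mem_enclosed_iff_of_isPreconnected (convex_ball q r).isPreconnected hrS
    (Metric.mem_ball_self hr) ha).1 hq

theorem notMem_enclosed_of_ray {S : Set (Amb n)} {y : EuclideanSpace ℝ (Fin n)} {h : ℝ}
    (hh : 0 < h) (hS : ∀ h' ≥ h, lift y h' ∉ S) : lift y h ∉ enclosed S := by
  intro hmem
  have hC : lift y '' Ici h ⊆ offSurface S := by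
    rintro _ ⟨h', hh', rfl⟩
    exact ⟨by rw [lift_last]; exact hh.trans_le hh', hS h' hh'⟩
  have h1 : IsPreconnected (lift y '' Ici h) :=
    isPreconnected_Ici.image _ (continuous_lift_right y).continuousOn
  have h2 := hmem.2.subset (h1.subset_connectedComponentIn (mem_image_of_mem _ self_mem_Ici) hC)
  obtain ⟨R, hR⟩ := h2.exists_norm_le
  have h3 := hR _ (mem_image_of_mem _ (mem_Ici.2 (le_max_left h (R + 1))))
  have h4 := (PiLp.norm_apply_le (lift y (max h (R + 1))) (Fin.last n)).trans h3
  rw [lift_last, Real.norm_eq_abs] at h4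
  linarith [le_abs_self (max h (R + 1)), le_max_right h (R + 1)]

theorem mem_wetted_iff {S : Set (Amb n)} (hS : IsClosed S) {y : EuclideanSpace ℝ (Fin n)}
    (hy : lift y 0 ∉ S) : ∀ᶠ h in 𝓝[>] (0 : ℝ), (lift y h ∈ enclosed S ↔ y ∈ wetted S) := by
  obtain ⟨r, hr, hrS⟩ := Metric.isOpen_iff.1 hS.isOpen_compl _ hy
  set B := Metric.ball (lift y 0) r ∩ {q : Amb n | 0 < q (Fin.last n)} with hB
  have hBc : Convex ℝ B := (convex_ball _ _).inter
    (convex_halfSpace_gt ⟨fun _ _ => rfl, fun _ _ => rfl⟩ 0)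
  have hBS : B ⊆ offSurface S := fun q hq => ⟨hq.2, hrS hq.1⟩
  have hev : ∀ᶠ h in 𝓝[>] (0 : ℝ), lift y h ∈ B := by
    have h1 := (continuous_lift_right y).tendsto 0 (Metric.ball_mem_nhds _ hr)
    filter_upwards [mem_nhdsWithin_of_mem_nhds h1, self_mem_nhdsWithin] with h hh hh0
    exact ⟨hh, by rw [mem_ofPred_eq, lift_last]; exact hh0⟩
  filter_upwards [hev] with h hh
  constructor
  · intro hmem
    change lift y 0 ∈ frontier (enclosed S)
    rw [(isOpen_enclosed hS).frontier_eq]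
    refine ⟨?_, fun h0 => ?_⟩
    · have h1 : Filter.Tendsto (lift y) (𝓝[>] 0) (𝓝 (lift y 0)) :=
        ((continuous_lift_right y).tendsto 0).mono_left nhdsWithin_le_nhds
      refine mem_closure_of_tendsto h1 ?_
      filter_upwards [hev] with h' hh'
      exact (mem_enclosed_iff_of_isPreconnected hBc.isPreconnected hBS hh hh').1 hmem
    · have := h0.1.1
      rw [lift_last] at this
      exact lt_irrefl _ this
  · intro hmem
    have h1 : lift y 0 ∈ closure (enclosed S) := frontier_subset_closure hmem
    obtain ⟨q, hq, hq'⟩ := mem_closure_iff_nhds.1 h1 _ (Metric.ball_mem_nhds _ hr)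
    exact (mem_enclosed_iff_of_isPreconnected hBc.isPreconnected hBS ⟨hq, hq'.1.1⟩ hh).1 hq'

theorem measurableSet_wetted (S : Set (Amb n)) : MeasurableSet (wetted S) :=
  (isClosed_frontier.preimage (continuous_lift 0)).measurableSet

/-- The jumps of a locally constant function on an interval add up. -/
theorem sum_jumps_eq {g j : ℝ → ℝ} (H : Finset ℝ)
    (hj : ∀ h ∈ H, ∀ᶠ ε in 𝓝[>] (0 : ℝ), g (h - ε) - g (h + ε) = j h) :
    ∀ a b : ℝ, a < b → (∀ h ∈ H, a < h ∧ h < b) →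
    (∀ a' b', a ≤ a' → a' ≤ b' → b' ≤ b → (∀ h ∈ H, h ∉ Icc a' b') → g a' = g b') →
    g a - g b = ∑ h ∈ H, j h := by
  induction H using Finset.induction_on_max with
  | empty =>
    intro a b hab _ hg
    rw [hg a b le_rfl hab.le le_rfl (by simp), sub_self, Finset.sum_empty]
  | insert m s hm ih =>
    intro a b hab hH hg
    have hms : m ∉ s := fun h => lt_irrefl _ (hm m h)
    have ha := hH m (Finset.mem_insert_self m s)
    have hsmall : ∀ᶠ ε in 𝓝[>] (0 : ℝ), (a < m - ε ∧ m + ε < b) ∧ ∀ h ∈ s, h < m - ε := by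
      have h1 : ∀ r < m, ∀ᶠ ε in 𝓝[>] (0 : ℝ), r < m - ε := fun r hr => by
        filter_upwards [Ioo_mem_nhdsGT (sub_pos.2 hr)] with ε hε
        linarith [hε.2]
      have h2 : ∀ᶠ ε in 𝓝[>] (0 : ℝ), m + ε < b := by
        filter_upwards [Ioo_mem_nhdsGT (sub_pos.2 ha.2)] with ε hε
        linarith [hε.2]
      exact ((h1 a ha.1).and h2).and ((Filter.eventually_all_finset s).2 fun h hh => h1 h (hm h hh))
    obtain ⟨ε, ⟨⟨⟨h1, h2⟩, h3⟩, h4⟩, h5⟩ := ((hsmall.and (hj m (Finset.mem_insert_self m s))).and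
      self_mem_nhdsWithin).exists
    have hε : 0 < ε := h5
    rw [Finset.sum_insert hms, ← h4, ← ih (fun h hh => hj h (Finset.mem_insert_of_mem hh)) a (m - ε)
      h1 (fun h hh => ⟨(hH h (Finset.mem_insert_of_mem hh)).1, h3 h hh⟩)
      (fun a' b' ha' hab' hb' hs => hg a' b' ha' hab' (by linarith) fun h hh => by
        rcases Finset.mem_insert.1 hh with rfl | hh
        · exact fun h' => by linarith [h'.2]
        · exact hs h hh),
      hg (m + ε) b (by linarith) h2.le le_rfl fun h hh => by
        rcases Finset.mem_insert.1 hh with rfl | hh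
        · exact fun h' => by linarith [h'.1]
        · exact fun h' => by linarith [h'.1, h3 h hh]]
    ring

end Enclosed

section Crossing

variable {n : ℕ} [NeZero n] {M : Type*} [TopologicalSpace M] [ChartedSpace (EuclideanHalfSpace n) M]
  [IsManifold (𝓡∂ n) ∞ M] [CompactSpace M] {θ : ℝ} {x ν : M → Amb n}

theorem IsCapillary.isClosed_range (hx : IsCapillary θ x ν) : IsClosed (range x) :=
  (isCompact_range hx.smooth.continuous).isClosed

/-- The hypersurface is tangent to its tangent plane. -/
theorem IsCapillary.eventually_inner_le (hx : IsCapillary θ x ν) (p : M) {c : ℝ} (hc : 0 < c) :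
    ∀ᶠ q in 𝓝 p, |inner ℝ (x q - x p) (ν p)| ≤ c * ‖x q - x p‖ := by
  have hp := mem_chart_source' (n := n) p
  set L := chartDeriv p x p with hL
  obtain ⟨K, hK, hKL⟩ := (L : EuclideanSpace ℝ (Fin n) →ₗ[ℝ] Amb n).exists_antilipschitzWith
    (LinearMap.ker_eq_bot.2 (hx.chartDeriv_injective hp))
  have hKL' : ∀ v, ‖v‖ ≤ K * ‖L v‖ := fun v => by
    simpa using hKL.le_mul_dist v 0
  have hK0 : (0 : ℝ) < K := hK
  have h1 := (hasFDerivWithinAt_chart hx.smooth hp).isLittleO.def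
    (show 0 < min (1 / (2 * K : ℝ)) (c / (2 * K)) by positivity)
  have h2 : Filter.Tendsto (extChartAt (𝓡∂ n) p) (𝓝 p)
      (𝓝[range (𝓡∂ n)] (extChartAt (𝓡∂ n) p p)) :=
    tendsto_nhdsWithin_iff.2 ⟨continuousAt_extChartAt p,
      Filter.Eventually.of_forall fun q => mem_range_self _⟩
  filter_upwards [h2 h1, (chartAt (EuclideanHalfSpace n) p).open_source.mem_nhds hp] with q hq hqs
  simp only [mem_preimage, mem_ofPred_eq, Function.comp_apply, chart_left_inv hp,
    chart_left_inv hqs] at hq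
  set w := extChartAt (𝓡∂ n) p q - extChartAt (𝓡∂ n) p p
  have h3 : ‖x q - x p - L w‖ ≤ 1 / (2 * K) * ‖w‖ :=
    hq.trans (mul_le_mul_of_nonneg_right (min_le_left _ _) (norm_nonneg _))
  have h4 : ‖x q - x p - L w‖ ≤ c / (2 * K) * ‖w‖ :=
    hq.trans (mul_le_mul_of_nonneg_right (min_le_right _ _) (norm_nonneg _))
  have h5 : ‖L w‖ ≤ ‖x q - x p‖ + 1 / (2 * K) * ‖w‖ := by
    have := norm_sub_le (x q - x p) (x q - x p - L w)
    rw [sub_sub_cancel] at this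
    linarith
  have h6 : ‖w‖ ≤ 2 * K * ‖x q - x p‖ := by
    have h7 := (hKL' w).trans (mul_le_mul_of_nonneg_left h5 hK0.le)
    have h8 : (K : ℝ) * (1 / (2 * K) * ‖w‖) = ‖w‖ / 2 := by field_simp
    rw [mul_add, h8] at h7
    linarith
  have h7 : inner ℝ (x q - x p) (ν p) = inner ℝ (x q - x p - L w) (ν p) := by
    rw [inner_sub_left (x q - x p), real_inner_comm (ν p) (L w), hx.inner_chartDeriv hp, sub_zero]
  rw [h7]
  calc |inner ℝ (x q - x p - L w) (ν p)| ≤ ‖x q - x p - L w‖ * ‖ν p‖ := abs_real_inner_le_norm _ _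
    _ ≤ c / (2 * K) * (2 * K * ‖x q - x p‖) := by
        rw [hx.unit_normal, mul_one]
        exact h4.trans (mul_le_mul_of_nonneg_left h6 (by positivity))
    _ = c * ‖x q - x p‖ := by field_simp

/-- Close to a point, a hypersurface does not meet a cone around its normal line. -/
theorem IsCapillary.exists_cone (hx : IsCapillary θ x ν) (p : M) {c : ℝ} (hc : 0 < c) :
    ∃ δ > 0, ∀ v : Amb n, v ≠ 0 → ‖v‖ < δ → c * ‖v‖ < |inner ℝ v (ν p)| → x p + v ∉ range x := by
  have h1 := hx.eventually_inner_le p hc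
  rw [(hx.smooth.continuous.isClosedEmbedding hx.injective).isInducing.nhds_eq_comap p,
    Filter.eventually_comap] at h1
  obtain ⟨δ, hδ, h2⟩ := Metric.eventually_nhds_iff.1 h1
  refine ⟨δ, hδ, fun v _ hv hcv => ?_⟩
  rintro ⟨q, hq⟩
  have h3 := @h2 (x p + v) (by simpa using hv) q hq
  rw [hq, add_sub_cancel_left] at h3
  linarith

/-- A transversal line crosses from the enclosed region to its complement. -/
theorem IsCapillary.eventually_crossing (hx : IsCapillary θ x ν) {p : M}
    (hp : p ∈ (𝓡∂ n).interior M) {d : Amb n} (hd : 0 < inner ℝ d (ν p)) :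
    ∀ᶠ s : ℝ in 𝓝[>] 0, x p - s • d ∈ enclosed (range x) ∧ x p + s • d ∉ enclosed (range x) := by
  set m := min (inner ℝ d (ν p)) 1 with hm
  set C := max ‖d‖ 1 with hC
  have hm0 : 0 < m := lt_min hd one_pos
  have hC0 : 0 < C := lt_max_of_lt_right one_pos
  obtain ⟨δ, hδ, hcone⟩ := hx.exists_cone p (c := m / (2 * C)) (by positivity)
  have hpos := hx.interior_pos p hp
  have hseg : ∀ᶠ s : ℝ in 𝓝[>] 0, ∀ σ : ℝ, |σ| = 1 → ∀ e ∈ segment ℝ d (ν p),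
      x p + (σ * s) • e ∈ offSurface (range x) := by
    filter_upwards [Ioo_mem_nhdsGT (show 0 < min (δ / C) (x p (Fin.last n) / C) by positivity)]
      with s hs σ hσ e he
    have hs0 : 0 < s := hs.1
    have he1 : ‖e‖ ≤ C := by
      have h1 := (convex_closedBall (0 : Amb n) C).segment_subset (x := d) (y := ν p)
        (by simp [hC]) (by simp [hC, hx.unit_normal]) he
      simpa using h1
    have he2 : m ≤ inner ℝ e (ν p) := by
      obtain ⟨a, b, ha, hb, hab, rfl⟩ := he
      rw [inner_add_left, inner_smul_left, inner_smul_left, real_inner_self_eq_norm_sq,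
        hx.unit_normal, RCLike.conj_to_real, RCLike.conj_to_real]
      have h1 : m ≤ inner ℝ d (ν p) := min_le_left _ _
      have h2 : m ≤ 1 := min_le_right _ _
      nlinarith
    have hn : ‖(σ * s) • e‖ ≤ s * C := by
      rw [norm_smul, Real.norm_eq_abs, abs_mul, hσ, one_mul, abs_of_pos hs0]
      exact mul_le_mul_of_nonneg_left he1 hs0.le
    have hs1 : s * C < δ := by
      have := hs.2.trans_le (min_le_left _ _)
      rwa [lt_div_iff₀ hC0] at this
    have hs2 : s * C < x p (Fin.last n) := by
      have := hs.2.trans_le (min_le_right _ _)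
      rwa [lt_div_iff₀ hC0] at this
    have hin : s * m ≤ |inner ℝ ((σ * s) • e) (ν p)| := by
      rw [inner_smul_left, RCLike.conj_to_real, abs_mul, abs_mul, hσ, one_mul, abs_of_pos hs0]
      exact mul_le_mul_of_nonneg_left (he2.trans (le_abs_self _)) hs0.le
    refine ⟨?_, hcone _ ?_ (hn.trans_lt hs1) ?_⟩
    · have h1 := PiLp.norm_apply_le ((σ * s) • e) (Fin.last n)
      rw [Real.norm_eq_abs] at h1
      have h2 := neg_abs_le (((σ * s) • e) (Fin.last n))
      rw [PiLp.add_apply]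
      linarith
    · intro h0
      rw [h0, inner_zero_left, abs_zero] at hin
      have : 0 < s * m := by positivity
      linarith
    · refine lt_of_lt_of_le ?_ hin
      calc m / (2 * C) * ‖(σ * s) • e‖ ≤ m / (2 * C) * (s * C) :=
            mul_le_mul_of_nonneg_left hn (by positivity)
        _ = s * m / 2 := by field_simp
        _ < s * m := by
          have : 0 < s * m := by positivity
          linarith
  filter_upwards [hseg, hx.outward p hp] with s hs hout
  have key : ∀ σ : ℝ, |σ| = 1 →
      (x p + (σ * s) • d ∈ enclosed (range x) ↔ x p + (σ * s) • ν p ∈ enclosed (range x)) := by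
    intro σ hσ
    have h1 : IsPreconnected ((fun e => x p + (σ * s) • e) '' segment ℝ d (ν p)) :=
      (convex_segment d (ν p)).isPreconnected.image _ (by fun_prop)
    refine mem_enclosed_iff_of_isPreconnected h1 ?_ (mem_image_of_mem _ (left_mem_segment ℝ _ _))
      (mem_image_of_mem _ (right_mem_segment ℝ _ _))
    rintro _ ⟨e, he, rfl⟩
    exact hs σ hσ e he
  have k1 := key 1 (by simp)
  have k2 := key (-1) (by simp)
  rw [one_mul] at k1
  rw [neg_one_mul, neg_smul, neg_smul, ← sub_eq_add_neg, ← sub_eq_add_neg] at k2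
  exact ⟨k2.2 hout.1, fun h => hout.2 (k1.1 h)⟩

open scoped Classical in
/-- The points of a generic vertical line where it leaves the enclosed region are one more than the
points where it enters, if the line starts in the enclosed region, and equally many otherwise. -/
theorem IsCapillary.card_fiber (hx : IsCapillary θ x ν) {y : EuclideanSpace ℝ (Fin n)}
    (hb : ∀ p ∈ (𝓡∂ n).boundary M, horiz n (x p) ≠ y)
    (hν : ∀ p, horiz n (x p) = y → ν p (Fin.last n) ≠ 0) :
    ∃ F : Finset M, (∀ p, p ∈ F ↔ p ∈ (𝓡∂ n).interior M ∧ horiz n (x p) = y) ∧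
      (F.filter fun p => 0 < ν p (Fin.last n)).card =
        (F.filter fun p => ν p (Fin.last n) < 0).card + if y ∈ wetted (range x) then 1 else 0 := by
  have hint : ∀ p, horiz n (x p) = y → p ∈ (𝓡∂ n).interior M := fun p hp => by
    by_contra h
    rw [← mem_compl_iff, ModelWithCorners.compl_interior] at h
    exact hb p h hp
  have hxp : ∀ p, horiz n (x p) = y → x p = lift y (x p (Fin.last n)) := fun p hp => by
    rw [← hp, lift_horiz]
  have hup : ∀ p, inner ℝ (-downVec n) (ν p) = ν p (Fin.last n) := fun p => by
    rw [inner_neg_left, real_inner_comm, inner_downVec, neg_neg]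
  -- isolated points of the fibre
  have hiso : ∀ p, horiz n (x p) = y →
      ∀ᶠ h in 𝓝[≠] (x p (Fin.last n)), lift y h ∉ range x := by
    intro p hp
    have hne := abs_pos.2 (hν p hp)
    have hnd : ‖-downVec n‖ = 1 := by simp [downVec]
    obtain ⟨δ, hδ, hcone⟩ := hx.exists_cone p (half_pos hne)
    filter_upwards [mem_nhdsWithin_of_mem_nhds (Metric.ball_mem_nhds (x p (Fin.last n)) hδ),
      self_mem_nhdsWithin] with h hh hh'
    set s := h - x p (Fin.last n) with hs
    have hs0 : s ≠ 0 := sub_ne_zero.2 hh'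
    have h1 : lift y h = x p + s • -downVec n := by
      conv_rhs => rw [hxp p hp, lift_add_smul]
      rw [hs, add_sub_cancel]
    rw [h1]
    refine hcone _ ?_ ?_ ?_
    · rw [← norm_ne_zero_iff, norm_smul, hnd, mul_one]
      exact norm_ne_zero_iff.2 hs0
    · rw [norm_smul, hnd, mul_one]
      simpa [Real.dist_eq] using hh
    · rw [norm_smul, hnd, mul_one, inner_smul_left, RCLike.conj_to_real, hup, abs_mul,
        Real.norm_eq_abs]
      have := abs_pos.2 hs0
      nlinarith
  have hHc : IsCompact (lift y ⁻¹' range x) := by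
    refine Metric.isCompact_of_isClosed_isBounded
      (hx.isClosed_range.preimage (continuous_lift_right y)) ?_
    obtain ⟨R, hR⟩ := (isCompact_range hx.smooth.continuous).isBounded.exists_norm_le
    refine isBounded_iff_forall_norm_le.2 ⟨R, fun h hh => ?_⟩
    have := (PiLp.norm_apply_le (lift y h) (Fin.last n)).trans (hR _ hh)
    rwa [lift_last] at this
  have hHf : (lift y ⁻¹' range x).Finite := by
    by_contra hinf
    obtain ⟨h, hh, hacc⟩ := Set.Infinite.exists_accPt_of_subset_isCompact hinf hHc subset_rfl
    obtain ⟨p, hp⟩ := hh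
    rw [accPt_iff_frequently_nhdsNE] at hacc
    have h1 := hiso p (by rw [hp, horiz_lift])
    rw [hp, lift_last] at h1
    exact hacc (h1.mono fun _ h2 h3 => h2 h3)
  have hFf : {p | horiz n (x p) = y}.Finite := by
    refine Set.Finite.of_finite_image (f := fun p => x p (Fin.last n)) (hHf.subset ?_) ?_
    · rintro _ ⟨p, hp, rfl⟩
      exact ⟨p, hxp p hp⟩
    · intro p hp q hq hpq
      refine hx.injective ?_
      rw [hxp p hp, hxp q hq]
      exact congrArg _ hpq
  set F := hFf.toFinset with hF
  have hmem : ∀ p, p ∈ F ↔ horiz n (x p) = y := fun p => by simp [hF]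
  refine ⟨F, fun p => by rw [hmem]; exact ⟨fun h => ⟨hint p h, h⟩, fun h => h.2⟩, ?_⟩
  set H := F.image fun p => x p (Fin.last n) with hH
  have hHmem : ∀ h, lift y h ∈ range x → h ∈ H := by
    rintro h ⟨p, hp⟩
    exact Finset.mem_image.2 ⟨p, (hmem p).2 (by rw [hp, horiz_lift]), by rw [hp, lift_last]⟩
  have hHpos : ∀ h ∈ H, 0 < h := by
    intro h hh
    obtain ⟨p, hp, rfl⟩ := Finset.mem_image.1 hh
    exact hx.interior_pos p (hint p ((hmem p).1 hp))
  let g : ℝ → ℝ := fun h => if lift y h ∈ enclosed (range x) then 1 else 0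
  let j : ℝ → ℝ := fun h => if ∃ p, x p = lift y h ∧ 0 < ν p (Fin.last n) then 1 else -1
  have hjp : ∀ p ∈ F, j (x p (Fin.last n)) = if 0 < ν p (Fin.last n) then 1 else -1 := by
    intro p hp
    simp only [j, ← hxp p ((hmem p).1 hp)]
    congr 1
    refine propext ⟨?_, fun h => ⟨p, rfl, h⟩⟩
    rintro ⟨q, hq, hq'⟩
    rwa [← hx.injective hq]
  have hjump : ∀ h ∈ H, ∀ᶠ ε in 𝓝[>] (0 : ℝ), g (h - ε) - g (h + ε) = j h := by
    intro h hh
    obtain ⟨p, hp, rfl⟩ := Finset.mem_image.1 hh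
    have hpy := (hmem p).1 hp
    rw [hjp p hp]
    have e1 : ∀ ε, lift y (x p (Fin.last n) + ε) = x p + ε • -downVec n := fun ε => by
      conv_rhs => rw [hxp p hpy, lift_add_smul]
    have e2 : ∀ ε, lift y (x p (Fin.last n) - ε) = x p - ε • -downVec n := fun ε => by
      rw [sub_eq_add_neg, e1, neg_smul, sub_eq_add_neg]
    rcases lt_or_gt_of_ne (hν p hpy) with h1 | h1
    · filter_upwards [hx.eventually_crossing (hint p hpy) (d := downVec n)
        (by rw [← neg_neg (downVec n), inner_neg_left, hup]; linarith)] with ε hε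
      have h2 : lift y (x p (Fin.last n) + ε) ∈ enclosed (range x) := by
        rw [e1, smul_neg, ← sub_eq_add_neg]; exact hε.1
      have h3 : lift y (x p (Fin.last n) - ε) ∉ enclosed (range x) := by
        rw [e2, smul_neg, sub_neg_eq_add]; exact hε.2
      simp only [g, h2, h3, if_true, if_false, h1.not_gt]
      norm_num
    · filter_upwards [hx.eventually_crossing (hint p hpy) (d := -downVec n)
        (by rw [hup]; exact h1)] with ε hε
      have h2 : lift y (x p (Fin.last n) - ε) ∈ enclosed (range x) := by rw [e2]; exact hε.1
      have h3 : lift y (x p (Fin.last n) + ε) ∉ enclosed (range x) := by rw [e1]; exact hε.2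
      simp only [g, h2, h3, if_true, if_false, h1]
      norm_num
  have hbase : lift y 0 ∉ range x := fun h => lt_irrefl _ (hHpos 0 (hHmem 0 h))
  have hsmall : ∀ᶠ a in 𝓝[>] (0 : ℝ), ∀ h ∈ H, a < h :=
    (Filter.eventually_all_finset H).2 fun h hh => by
      filter_upwards [Ioo_mem_nhdsGT (hHpos h hh)] with a ha using ha.2
  obtain ⟨a, ⟨ha1, ha2⟩, ha0⟩ := (((mem_wetted_iff hx.isClosed_range hbase).and hsmall).and
    self_mem_nhdsWithin).exists
  obtain ⟨b, hb1⟩ := (insert a H).bddAbove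
  have ha0' : 0 < a := ha0
  have hab : a < b + 1 := by linarith [hb1 (Finset.mem_coe.2 (Finset.mem_insert_self a H))]
  have hHb : ∀ h ∈ H, h < b + 1 := fun h hh => by
    linarith [hb1 (Finset.mem_coe.2 (Finset.mem_insert_of_mem hh))]
  have key := sum_jumps_eq H hjump a (b + 1) hab (fun h hh => ⟨ha2 h hh, hHb h hh⟩) (by
    intro a' b' haa hab' _ hno
    have h1 : lift y '' Icc a' b' ⊆ offSurface (range x) := by
      rintro _ ⟨h, hh, rfl⟩
      exact ⟨by rw [lift_last]; linarith [hh.1], fun h2 => hno h (hHmem h h2) hh⟩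
    have h2 := mem_enclosed_iff_of_isPreconnected
      (isPreconnected_Icc.image _ (continuous_lift_right y).continuousOn) h1
      (mem_image_of_mem _ (left_mem_Icc.2 hab')) (mem_image_of_mem _ (right_mem_Icc.2 hab'))
    simp only [g, h2])
  have hgb : g (b + 1) = 0 := by
    have h1 := notMem_enclosed_of_ray (S := range x) (y := y) (h := b + 1) (by linarith)
      fun h' hh' h2 => by linarith [hHb h' (hHmem h' h2), show b + 1 ≤ h' from hh']
    simp only [g, h1, if_false]
  have hga : g a = if y ∈ wetted (range x) then 1 else 0 := by simp only [g, ha1]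
  rw [hgb, hga, sub_zero, hH, Finset.sum_image (by
    intro p hp q hq hpq
    refine hx.injective ?_
    rw [hxp p ((hmem p).1 hp), hxp q ((hmem q).1 hq)]
    exact congrArg _ hpq), Finset.sum_congr rfl hjp, Finset.sum_ite, Finset.sum_const,
    Finset.sum_const] at key
  have hneg : (F.filter fun p => ¬ 0 < ν p (Fin.last n)) = F.filter fun p => ν p (Fin.last n) < 0 := by
    refine Finset.filter_congr fun p hp => ?_
    rw [not_lt]
    exact ⟨fun h => lt_of_le_of_ne h (hν p ((hmem p).1 hp)), fun h => h.le⟩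
  rw [hneg] at key
  have key2 : ((F.filter fun p => 0 < ν p (Fin.last n)).card : ℝ) =
      (F.filter fun p => ν p (Fin.last n) < 0).card + if y ∈ wetted (range x) then 1 else 0 := by
    rw [key]; simp
  split_ifs at key2 ⊢ <;> exact_mod_cast key2

end Crossing

/-! ### The area formula with multiplicity -/

section AreaFormula

open MeasureTheory
open scoped ENNReal

variable {E : Type*} [NormedAddCommGroup E] [NormedSpace ℝ E] [FiniteDimensional ℝ E]
  [MeasurableSpace E] [BorelSpace E] {f : E → E} {f' : E → E →L[ℝ] E} {A : Set E} {w : E → ℝ≥0∞}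

theorem exists_partition_injOn (hf' : ∀ u ∈ A, HasFDerivWithinAt f (f' u) A u)
    (hdet : ∀ u ∈ A, (f' u).det ≠ 0) :
    ∃ t : ℕ → Set E, Pairwise (Function.onFun Disjoint t) ∧ (∀ n, MeasurableSet (t n)) ∧
      (A ⊆ ⋃ n, t n) ∧ ∀ n, InjOn f (A ∩ t n) := by
  obtain ⟨t, L, h1, h2, h3, h4, h5⟩ := exists_partition_approximatesLinearOn_of_hasFDerivWithinAt
    f A f' hf' (fun L => (‖L.inverse‖₊ + 1)⁻¹) fun L => by positivity
  refine ⟨t, h1, h2, h3, fun k => ?_⟩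
  rcases A.eq_empty_or_nonempty with rfl | hA
  · simp
  obtain ⟨y, hy, hLy⟩ := h5 hA k
  have h6 := h4 k
  have h7 : L k = ((f' y).toContinuousLinearEquivOfDetNeZero (hdet y hy) : E →L[ℝ] E) := by
    rw [hLy]; rfl
  set e := (f' y).toContinuousLinearEquivOfDetNeZero (hdet y hy)
  rw [h7, ContinuousLinearMap.inverse_equiv] at h6
  refine h6.injOn ?_
  rcases e.subsingleton_or_nnnorm_symm_pos with h | h
  · exact Or.inl h
  · exact Or.inr (inv_strictAnti₀ h (lt_add_one _))

theorem measurable_and_lintegral_of_injOn {μ : Measure E} [μ.IsAddHaarMeasure] {D : Set E}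
    (hD : MeasurableSet D) (hf' : ∀ u ∈ D, HasFDerivWithinAt f (f' u) D u) (hf : InjOn f D)
    (hw : Measurable (D.domRestrict w)) :
    Measurable (fun y => ∑' u, (D ∩ f ⁻¹' {y}).indicator w u) ∧
    ∫⁻ u in D, ENNReal.ofReal |(f' u).det| * w u ∂μ =
      ∫⁻ y, ∑' u, (D ∩ f ⁻¹' {y}).indicator w u ∂μ := by
  set G : E → ℝ≥0∞ := fun y => ∑' u, (D ∩ f ⁻¹' {y}).indicator w u
  have hG1 : ∀ u ∈ D, G (f u) = w u := by
    intro u hu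
    simp only [G]
    rw [tsum_eq_single u, indicator_of_mem]
    · exact ⟨hu, rfl⟩
    · intro v hv
      exact indicator_of_notMem (fun h => hv (hf h.1 hu h.2)) _
  have hG2 : ∀ y ∉ f '' D, G y = 0 := by
    intro y hy
    simp only [G, ENNReal.tsum_eq_zero]
    intro u
    exact indicator_of_notMem (fun h => hy ⟨u, h.1, h.2⟩) _
  have hemb := measurableEmbedding_of_fderivWithin hD hf' hf
  constructor
  · have h1 : G = Function.extend (D.domRestrict f) (D.domRestrict w) fun _ => 0 := by
      ext1 y
      by_cases hy : y ∈ f '' D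
      · obtain ⟨u, hu, rfl⟩ := hy
        rw [hG1 u hu, show f u = D.domRestrict f ⟨u, hu⟩ from rfl, hemb.injective.extend_apply]
        rfl
      · rw [hG2 y hy, Function.extend_apply']
        rintro ⟨⟨u, hu⟩, rfl⟩
        exact hy ⟨u, hu, rfl⟩
    rw [h1]
    exact hemb.measurable_extend hw measurable_const
  · have himg : MeasurableSet (f '' D) := measurable_image_of_fderivWithin hD hf' hf
    rw [setLIntegral_congr_fun hD fun u hu => by rw [← hG1 u hu],
      ← lintegral_image_eq_lintegral_abs_det_fderiv_mul μ hD hf' hf G, ← lintegral_indicator himg]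
    congr 1
    ext1 y
    by_cases hy : y ∈ f '' D
    · rw [indicator_of_mem hy]
    · rw [indicator_of_notMem hy, hG2 y hy]

theorem measurable_and_lintegral_area {μ : Measure E} [μ.IsAddHaarMeasure]
    (hA : MeasurableSet A) (hf' : ∀ u ∈ A, HasFDerivWithinAt f (f' u) A u)
    (hdet : ∀ u ∈ A, (f' u).det ≠ 0) (hw : Measurable (A.domRestrict w)) :
    Measurable (fun y => ∑' u, (A ∩ f ⁻¹' {y}).indicator w u) ∧
    ∫⁻ u in A, ENNReal.ofReal |(f' u).det| * w u ∂μ =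
      ∫⁻ y, ∑' u, (A ∩ f ⁻¹' {y}).indicator w u ∂μ := by
  obtain ⟨t, h1, h2, h3, h4⟩ := exists_partition_injOn hf' hdet
  have hD : ∀ k, MeasurableSet (A ∩ t k) := fun k => hA.inter (h2 k)
  have h5 : ∀ k, _ ∧ _ := fun k => measurable_and_lintegral_of_injOn (μ := μ) (w := w) (hD k)
    (fun u hu => (hf' u hu.1).mono inter_subset_left) (h4 k)
    (hw.comp (measurable_inclusion (inter_subset_left : A ∩ t k ⊆ A)))
  have h6 : (fun y => ∑' u, (A ∩ f ⁻¹' {y}).indicator w u) =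
      fun y => ∑' k, ∑' u, (A ∩ t k ∩ f ⁻¹' {y}).indicator w u := by
    ext1 y
    rw [ENNReal.tsum_comm]
    refine tsum_congr fun u => ?_
    by_cases hu : u ∈ A ∩ f ⁻¹' {y}
    · obtain ⟨k, hk⟩ := mem_iUnion.1 (h3 hu.1)
      rw [tsum_eq_single k, indicator_of_mem hu, indicator_of_mem]
      · exact ⟨⟨hu.1, hk⟩, hu.2⟩
      · intro j hj
        refine indicator_of_notMem (fun h => ?_) _
        exact disjoint_left.1 (h1 hj) h.1.2 hk
    · rw [indicator_of_notMem hu]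
      symm
      rw [ENNReal.tsum_eq_zero]
      exact fun k => indicator_of_notMem (fun h => hu ⟨h.1.1, h.2⟩) _
  have h7 : A = ⋃ k, A ∩ t k := by
    rw [← inter_iUnion, inter_eq_self_of_subset_left h3]
  rw [h6]
  refine ⟨Measurable.tsum fun k => (h5 k).1, ?_⟩
  rw [lintegral_tsum fun k => (h5 k).1.aemeasurable]
  conv_lhs => rw [h7]
  rw [lintegral_iUnion hD (fun i j hij => (h1 hij).mono inter_subset_right inter_subset_right)]
  exact tsum_congr fun k => (h5 k).2

end AreaFormula

/-! ### The area of the wetted region -/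

section Wetted

open MeasureTheory
open scoped ENNReal

theorem inner_lift_zero {n : ℕ} (y : EuclideanSpace ℝ (Fin n)) (v : Amb n) :
    inner ℝ (lift y 0) v = ∑ i, y i * v i.castSucc := by
  rw [PiLp.inner_apply, Fin.sum_univ_castSucc]
  simp [lift_last, lift_castSucc, mul_comm]

theorem abs_det_horiz_comp {n : ℕ} [NeZero n] (L : EuclideanSpace ℝ (Fin n) →L[ℝ] Amb n) :
    |((horiz n).comp L).det| = |frameDet (downVec n) fun i => L (stdVec i)| := by
  have hnd : ‖downVec n‖ = 1 := by simp [downVec]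
  have horth : ∀ i : Fin n, inner ℝ (lift (stdVec i) 0) (downVec n) = 0 := fun i => by
    rw [inner_downVec, lift_last, neg_zero]
  have h1 := frameDet_sq (v := fun i : Fin n => lift (stdVec i) 0) hnd horth
  have h2 : (Matrix.of fun i j : Fin n => inner ℝ (lift (stdVec i) 0) (lift (stdVec j) 0)).det =
      (1 : ℝ) := by
    rw [← Matrix.det_one (n := Fin n)]
    congr 1
    ext i j
    rw [Matrix.of_apply, inner_lift_zero]
    simp [lift_castSucc, stdVec, Matrix.one_apply, eq_comm]
  have h1' : |frameDet (downVec n) fun i : Fin n => lift (stdVec i) 0| = 1 := by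
    rw [← sq_eq_sq₀ (abs_nonneg _) zero_le_one, sq_abs, h1, one_pow, ← h2]
  have h3 := frameDet_mul_of_orthogonal (a := downVec n) (w := fun i => L (stdVec i)) horth
  have h4 : (Matrix.of fun i j : Fin n => inner ℝ (lift (stdVec i) 0) (L (stdVec j))).det =
      ((horiz n).comp L).det := by
    rw [ContinuousLinearMap.det,
      ← LinearMap.det_toMatrix (EuclideanSpace.basisFun (Fin n) ℝ).toBasis]
    congr 1
    ext i j
    rw [Matrix.of_apply, inner_lift_zero, LinearMap.toMatrix_apply]
    simp [stdVec, horiz_apply]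
  rw [real_inner_self_eq_norm_sq, hnd, h4] at h3
  have h5 := congrArg abs h3
  rw [abs_mul, h1', one_mul] at h5
  rw [h5]; norm_num

variable {n : ℕ} [NeZero n] {M : Type*} [TopologicalSpace M] [ChartedSpace (EuclideanHalfSpace n) M]
  [IsManifold (𝓡∂ n) ∞ M] {θ : ℝ} {x ν : M → Amb n}

theorem IsCapillary.abs_det_horiz_chartDeriv (hx : IsCapillary θ x ν) {c p : M}
    (hp : p ∈ (chartAt (EuclideanHalfSpace n) c).source) :
    |((horiz n).comp (chartDeriv c x p)).det| =
      |ν p (Fin.last n)| * Real.sqrt (pairing c x x p).det := by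
  rw [abs_det_horiz_comp, hx.sqrt_det hp, ← abs_mul]
  have h1 : frameDet (downVec n) (coordDeriv c x p) * areaForm x ν c p =
      inner ℝ (downVec n) (ν p) * (pairing c x x p).det :=
    frameDet_mul_of_orthogonal fun i => hx.inner_coordDeriv hp i
  rw [← hx.areaForm_sq hp, real_inner_comm, inner_downVec] at h1
  have h2 : frameDet (downVec n) (coordDeriv c x p) = -(ν p (Fin.last n) * areaForm x ν c p) :=
    mul_right_cancel₀ (hx.areaForm_ne_zero hp) (by rw [h1]; ring)
  rw [← abs_neg (ν p (Fin.last n) * _), ← h2]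
  rfl

/-- The part of the chart centred at `c` where the normal has a vertical component of the same sign
as `σ`. -/
def signedChart (σ : ℝ) (ν : M → Amb n) (c : M) : Set (EuclideanSpace ℝ (Fin n)) :=
  {u | u ∈ (extChartAt (𝓡∂ n) c).target ∧ 0 < u 0 ∧
    0 < σ * ν ((extChartAt (𝓡∂ n) c).symm u) (Fin.last n)}

/-- The interior points over `y` at which the normal has a vertical component of the same sign
as `σ`. -/
def signedFiber (σ : ℝ) (x ν : M → Amb n) (y : EuclideanSpace ℝ (Fin n)) : Set M :=
  {p | p ∈ (𝓡∂ n).interior M ∧ horiz n (x p) = y ∧ 0 < σ * ν p (Fin.last n)}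

theorem continuous_last {g : M → Amb n} (hg : Continuous g) :
    Continuous fun p => g p (Fin.last n) :=
  (PiLp.continuous_apply 2 _ (Fin.last n)).comp hg

theorem isOpen_signedChart (hν : Continuous ν) (σ : ℝ) (c : M) : IsOpen (signedChart σ ν c) := by
  rw [isOpen_iff_mem_nhds]
  intro u hu
  have h1 := target_mem_nhds hu.1 hu.2.1
  have h2 : ContinuousAt (fun u => σ * ν ((extChartAt (𝓡∂ n) c).symm u) (Fin.last n)) u :=
    ((((continuous_last hν).comp_continuousOn (continuousOn_chart_symm c)).continuousAt h1)).const_mul σ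
  filter_upwards [h1, (isOpen_lt continuous_const (PiLp.continuous_apply 2 _ 0)).mem_nhds hu.2.1,
    h2.eventually (lt_mem_nhds hu.2.2)] with v h3 h4 h5
  exact ⟨h3, h4, h5⟩

theorem mem_interior_iff_chart {c p : M} (hp : p ∈ (chartAt (EuclideanHalfSpace n) c).source) :
    p ∈ (𝓡∂ n).interior M ↔ 0 < extChartAt (𝓡∂ n) c p 0 := by
  constructor
  · intro h
    refine lt_of_le_of_ne (target_subset_halfSpace c (chart_mem_target hp)) fun h0 => ?_
    have h1 := chart_symm_mem_boundary (chart_mem_target hp) h0.symm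
    rw [chart_left_inv hp, ← ModelWithCorners.compl_interior] at h1
    exact h1 h
  · intro h
    have h1 := chart_symm_mem_interior (chart_mem_target hp) h
    rwa [chart_left_inv hp] at h1

theorem tsum_chart_eq (c : M) (F : M → ℝ≥0∞)
    (hF : ∀ p ∉ (chartAt (EuclideanHalfSpace n) c).source, F p = 0) :
    ∑' u, (extChartAt (𝓡∂ n) c).target.indicator (F ∘ (extChartAt (𝓡∂ n) c).symm) u =
      ∑' p, F p := by
  let g : (chartAt (EuclideanHalfSpace n) c).source → EuclideanSpace ℝ (Fin n) :=
    fun p => extChartAt (𝓡∂ n) c p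
  have hg : Function.Injective g := by
    intro p q hpq
    have := congrArg (extChartAt (𝓡∂ n) c).symm hpq
    simp only [g] at this
    rw [chart_left_inv p.2, chart_left_inv q.2] at this
    exact Subtype.ext this
  rw [← hg.tsum_eq, ← (Subtype.val_injective
    (p := (· ∈ (chartAt (EuclideanHalfSpace n) c).source))).tsum_eq (f := F)]
  · refine tsum_congr fun p => ?_
    rw [indicator_of_mem (chart_mem_target p.2), Function.comp_apply, chart_left_inv p.2]
  · intro p hp
    rw [Subtype.range_val]
    by_contra h
    exact hp (hF p h)
  · intro u hu
    have hu' : u ∈ (extChartAt (𝓡∂ n) c).target := by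
      by_contra h
      exact hu (indicator_of_notMem h _)
    exact ⟨⟨_, chart_symm_mem hu'⟩, (extChartAt (𝓡∂ n) c).right_inv hu'⟩

variable [CompactSpace M] [T2Space M]

theorem IsCapillary.lintegral_signedChart (hx : IsCapillary θ x ν) (σ : ℝ) (c : M) :
    Measurable (fun y => ∑' p, (signedFiber σ x ν y).indicator
      (fun p => ENNReal.ofReal (chartPartition n M c p)) p) ∧
    ∫⁻ u in signedChart σ ν c, ENNReal.ofReal (chartPartition n M c
      ((extChartAt (𝓡∂ n) c).symm u) * |ν ((extChartAt (𝓡∂ n) c).symm u) (Fin.last n)| *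
        Real.sqrt (pairing c x x ((extChartAt (𝓡∂ n) c).symm u)).det) =
    ∫⁻ y, ∑' p, (signedFiber σ x ν y).indicator
      (fun p => ENNReal.ofReal (chartPartition n M c p)) p := by
  have hopen := isOpen_signedChart hx.smooth_normal.continuous σ c
  have h1 := measurable_and_lintegral_area (μ := volume) (A := signedChart σ ν c)
    (f := horiz n ∘ x ∘ (extChartAt (𝓡∂ n) c).symm)
    (f' := fun u => (horiz n).comp (chartDeriv c x ((extChartAt (𝓡∂ n) c).symm u)))
    (w := fun u => ENNReal.ofReal (chartPartition n M c ((extChartAt (𝓡∂ n) c).symm u)))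
    hopen.measurableSet
    (fun u hu => ((horiz n).hasFDerivAt.comp u
      (hasFDerivAt_chart hx.smooth hu.1 hu.2.1)).hasFDerivWithinAt)
    (fun u hu => by
      rw [← abs_ne_zero, hx.abs_det_horiz_chartDeriv (chart_symm_mem hu.1),
        hx.sqrt_det (chart_symm_mem hu.1), ← abs_mul, abs_ne_zero]
      exact mul_ne_zero (fun h => hu.2.2.ne' (by rw [h, mul_zero]))
        (hx.areaForm_ne_zero (chart_symm_mem hu.1)))
    (ENNReal.measurable_ofReal.comp (ContinuousOn.domRestrict
      (((continuous_chartPartition c).comp_continuousOn (continuousOn_chart_symm c)).mono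
        fun u hu => hu.1)).measurable)
  have h2 : ∀ y, ∑' u, (signedChart σ ν c ∩
      (horiz n ∘ x ∘ (extChartAt (𝓡∂ n) c).symm) ⁻¹' {y}).indicator
      (fun u => ENNReal.ofReal (chartPartition n M c ((extChartAt (𝓡∂ n) c).symm u))) u =
      ∑' p, (signedFiber σ x ν y).indicator
      (fun p => ENNReal.ofReal (chartPartition n M c p)) p := by
    intro y
    rw [← tsum_chart_eq (n := n) c]
    · refine tsum_congr fun u => ?_
      by_cases hu : u ∈ (extChartAt (𝓡∂ n) c).target
      · rw [indicator_of_mem hu, Function.comp_apply]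
        have h3 : (u ∈ signedChart σ ν c ∩
            (horiz n ∘ x ∘ (extChartAt (𝓡∂ n) c).symm) ⁻¹' {y}) ↔
            (extChartAt (𝓡∂ n) c).symm u ∈ signedFiber σ x ν y := by
          have h4 := mem_interior_iff_chart (chart_symm_mem hu)
          rw [(extChartAt (𝓡∂ n) c).right_inv hu] at h4
          simp only [signedChart, signedFiber, mem_inter_iff, mem_ofPred_eq, mem_preimage,
            Function.comp_apply, mem_singleton_iff, h4, hu, true_and]
          tauto
        by_cases h5 : (extChartAt (𝓡∂ n) c).symm u ∈ signedFiber σ x ν y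
        · rw [indicator_of_mem h5, indicator_of_mem (h3.2 h5)]
        · rw [indicator_of_notMem h5, indicator_of_notMem fun h => h5 (h3.1 h)]
      · rw [indicator_of_notMem hu, indicator_of_notMem fun h => hu h.1.1]
    · intro p hp
      have h3 : chartPartition n M c p = 0 := by
        by_contra h
        exact hp (tsupport_chartPartition_subset (n := n) c (subset_tsupport _ h))
      by_cases h4 : p ∈ signedFiber σ x ν y
      · rw [indicator_of_mem h4, h3, ENNReal.ofReal_zero]
      · rw [indicator_of_notMem h4]
  simp only [h2] at h1
  refine ⟨h1.1, ?_⟩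
  rw [← h1.2]
  refine setLIntegral_congr_fun hopen.measurableSet fun u hu => ?_
  rw [← ENNReal.ofReal_mul (abs_nonneg _), hx.abs_det_horiz_chartDeriv (chart_symm_mem hu.1)]
  congr 1
  ring

/-- The integral of a signed part of the vertical component of the normal counts the points in the
fibres of the projection. -/
theorem IsCapillary.ofReal_surfaceIntegral_max (hx : IsCapillary θ x ν) {σ : ℝ} (hσ : |σ| = 1) :
    Measurable (fun y => ∑' p, (signedFiber σ x ν y).indicator (fun _ => (1 : ℝ≥0∞)) p) ∧
    ENNReal.ofReal (surfaceIntegral x fun p => max (σ * ν p (Fin.last n)) 0) =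
      ∫⁻ y, ∑' p, (signedFiber σ x ν y).indicator (fun _ => 1) p := by
  have hcont : Continuous fun p => max (σ * ν p (Fin.last n)) 0 :=
    (continuous_const.mul (continuous_last hx.smooth_normal.continuous)).max continuous_const
  have h1 : (fun y => ∑' p, (signedFiber σ x ν y).indicator (fun _ => (1 : ℝ≥0∞)) p) =
      fun y => ∑ c ∈ activeCharts n M, ∑' p, (signedFiber σ x ν y).indicator
      (fun p => ENNReal.ofReal (chartPartition n M c p)) p := by
    ext1 y
    rw [← Summable.tsum_finsetSum fun _ _ => ENNReal.summable]
    refine tsum_congr fun p => ?_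
    by_cases h : p ∈ signedFiber σ x ν y
    · simp only [indicator_of_mem h]
      rw [← ENNReal.ofReal_sum_of_nonneg fun c _ => (chartPartition n M).nonneg c p,
        sum_chartPartition, ENNReal.ofReal_one]
    · simp only [indicator_of_notMem h, Finset.sum_const_zero]
  rw [h1]
  refine ⟨Finset.measurable_fun_sum _ fun c _ => (hx.lintegral_signedChart σ c).1, ?_⟩
  rw [lintegral_finsetSum _ fun c _ => (hx.lintegral_signedChart σ c).1, surfaceIntegral_eq_sum,
    ENNReal.ofReal_sum_of_nonneg fun c _ => integral_nonneg fun u => mul_nonneg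
      (mul_nonneg ((chartPartition n M).nonneg c _) (le_max_right _ _)) (Real.sqrt_nonneg _)]
  refine Finset.sum_congr rfl fun c _ => ?_
  rw [← (hx.lintegral_signedChart σ c).2, ofReal_integral_eq_lintegral_ofReal
    (integrableOn_surface hx hcont c) (Filter.Eventually.of_forall fun u => mul_nonneg
      (mul_nonneg ((chartPartition n M).nonneg c _) (le_max_right _ _)) (Real.sqrt_nonneg _))]
  have hsub : signedChart σ ν c ⊆ (extChartAt (𝓡∂ n) c).target := fun u hu => hu.1
  have hmeas := (isOpen_signedChart hx.smooth_normal.continuous σ c).measurableSet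
  have h3 : ∀ᵐ u : EuclideanSpace ℝ (Fin n), u 0 ≠ 0 := by
    rw [ae_iff]
    simpa using volume_coord_eq (n := n) 0 0
  rw [← lintegral_indicator hmeas, ← lintegral_indicator (measurableSet_target c)]
  refine lintegral_congr_ae ?_
  filter_upwards [h3] with u hu
  by_cases huT : u ∈ (extChartAt (𝓡∂ n) c).target
  · rw [indicator_of_mem huT]
    by_cases huS : u ∈ signedChart σ ν c
    · rw [indicator_of_mem huS, max_eq_left huS.2.2.le]
      congr 3
      rw [← abs_of_pos huS.2.2, abs_mul, hσ, one_mul]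
    · rw [indicator_of_notMem huS, max_eq_right, mul_zero, zero_mul, ENNReal.ofReal_zero]
      by_contra h
      exact huS ⟨huT, lt_of_le_of_ne (target_subset_halfSpace c huT) (Ne.symm hu), not_le.1 h⟩
  · rw [indicator_of_notMem huT, indicator_of_notMem fun h => huT (hsub h)]

theorem exists_mem_activeCharts (p : M) :
    ∃ c ∈ activeCharts n M, p ∈ (chartAt (EuclideanHalfSpace n) c).source := by
  have h1 : ∑ c ∈ activeCharts n M, chartPartition n M c p ≠ 0 := by
    rw [sum_chartPartition]; exact one_ne_zero
  obtain ⟨c, hc, hcp⟩ := Finset.exists_ne_zero_of_sum_ne_zero h1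
  exact ⟨c, hc, tsupport_chartPartition_subset c (subset_tsupport _ hcp)⟩

/-- Almost all vertical lines meet the hypersurface transversally at interior points. -/
theorem IsCapillary.ae_regular (hx : IsCapillary θ x ν) :
    ∀ᵐ y : EuclideanSpace ℝ (Fin n), (∀ p ∈ (𝓡∂ n).boundary M, horiz n (x p) ≠ y) ∧
      ∀ p, horiz n (x p) = y → ν p (Fin.last n) ≠ 0 := by
  have hder : ∀ c : M, ∀ u ∈ (extChartAt (𝓡∂ n) c).target,
      HasFDerivWithinAt (horiz n ∘ x ∘ (extChartAt (𝓡∂ n) c).symm)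
        ((horiz n).comp (chartDeriv c x ((extChartAt (𝓡∂ n) c).symm u)))
        (extChartAt (𝓡∂ n) c).target u := by
    intro c u hu
    have h1 := hasFDerivWithinAt_chart hx.smooth (chart_symm_mem hu)
    rw [(extChartAt (𝓡∂ n) c).right_inv hu] at h1
    exact (horiz n).hasFDerivAt.comp_hasFDerivWithinAt u
      (h1.mono (extChartAt_target_subset_range c))
  have hb : ∀ c : M, volume ((horiz n ∘ x ∘ (extChartAt (𝓡∂ n) c).symm) ''
      ((extChartAt (𝓡∂ n) c).target ∩ {u | u 0 = 0})) = 0 := by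
    intro c
    refine addHaar_image_eq_zero_of_differentiableOn_of_addHaar_eq_zero volume
      (fun u hu => ((hder c u hu.1).mono inter_subset_left).differentiableWithinAt) ?_
    exact measure_mono_null inter_subset_right (volume_coord_eq (n := n) 0 0)
  have hs : ∀ c : M, volume ((horiz n ∘ x ∘ (extChartAt (𝓡∂ n) c).symm) ''
      ((extChartAt (𝓡∂ n) c).target ∩
        {u | ν ((extChartAt (𝓡∂ n) c).symm u) (Fin.last n) = 0})) = 0 := by
    intro c
    refine addHaar_image_eq_zero_of_det_fderivWithin_eq_zero volume
      (fun u hu => (hder c u hu.1).mono inter_subset_left) fun u hu => ?_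
    rw [← abs_eq_zero, hx.abs_det_horiz_chartDeriv (chart_symm_mem hu.1),
      show ν ((extChartAt (𝓡∂ n) c).symm u) (Fin.last n) = 0 from hu.2, abs_zero, zero_mul]
  have h1 : ∀ c ∈ activeCharts n M, ∀ᵐ y : EuclideanSpace ℝ (Fin n),
      y ∉ (horiz n ∘ x ∘ (extChartAt (𝓡∂ n) c).symm) ''
        ((extChartAt (𝓡∂ n) c).target ∩ {u | u 0 = 0}) ∧
      y ∉ (horiz n ∘ x ∘ (extChartAt (𝓡∂ n) c).symm) '' ((extChartAt (𝓡∂ n) c).target ∩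
        {u | ν ((extChartAt (𝓡∂ n) c).symm u) (Fin.last n) = 0}) := fun c _ =>
    (measure_eq_zero_iff_ae_notMem.1 (hb c)).and (measure_eq_zero_iff_ae_notMem.1 (hs c))
  have h2 := (Filter.eventually_all_finset (activeCharts n M)).2 h1
  filter_upwards [h2] with y hy
  constructor
  · intro p hp hpy
    obtain ⟨c, hc, hcp⟩ := exists_mem_activeCharts (n := n) p
    refine (hy c hc).1 ⟨extChartAt (𝓡∂ n) c p, ⟨chart_mem_target hcp,
      chart_boundary_zero hcp hp⟩, ?_⟩
    simp only [Function.comp_apply, chart_left_inv hcp, hpy]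
  · intro p hpy hp
    obtain ⟨c, hc, hcp⟩ := exists_mem_activeCharts (n := n) p
    refine (hy c hc).2 ⟨extChartAt (𝓡∂ n) c p, ⟨chart_mem_target hcp, ?_⟩, ?_⟩
    · rw [mem_ofPred_eq, chart_left_inv hcp, hp]
    · simp only [Function.comp_apply, chart_left_inv hcp, hpy]

/-- The area of the wetted region is the integral of the vertical component of the normal. -/
theorem IsCapillary.volume_wetted (hx : IsCapillary θ x ν) :
    (volume (wetted (range x))).toReal = surfaceIntegral x fun p => ν p (Fin.last n) := by
  have hcont : Continuous fun p => ν p (Fin.last n) := continuous_last hx.smooth_normal.continuous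
  have h1 := hx.ofReal_surfaceIntegral_max (σ := 1) (by simp)
  have h2 := hx.ofReal_surfaceIntegral_max (σ := -1) (by simp)
  have h3 : ∫⁻ y, ∑' p, (signedFiber 1 x ν y).indicator (fun _ => (1 : ℝ≥0∞)) p =
      (∫⁻ y, ∑' p, (signedFiber (-1) x ν y).indicator (fun _ => (1 : ℝ≥0∞)) p) +
        volume (wetted (range x)) := by
    rw [← lintegral_indicator_one (measurableSet_wetted (range x)), ← lintegral_add_left h2.1]
    refine lintegral_congr_ae ?_
    filter_upwards [hx.ae_regular] with y hy
    obtain ⟨F, hF, hcard⟩ := hx.card_fiber hy.1 hy.2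
    have h4 : ∀ (σ : ℝ) (G : Finset M), (∀ p, p ∈ G ↔ p ∈ signedFiber σ x ν y) →
        ∑' p, (signedFiber σ x ν y).indicator (fun _ => (1 : ℝ≥0∞)) p = G.card := by
      intro σ G hG
      rw [tsum_eq_sum (s := G) fun p hp => indicator_of_notMem (fun h => hp ((hG p).2 h)) _,
        Finset.sum_congr rfl fun p hp => indicator_of_mem ((hG p).1 hp) _]
      simp
    classical
    rw [h4 1 (F.filter fun p => 0 < ν p (Fin.last n)) fun p => by
        rw [Finset.mem_filter, hF, signedFiber, mem_ofPred_eq, one_mul, and_assoc],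
      h4 (-1) (F.filter fun p => ν p (Fin.last n) < 0) fun p => by
        rw [Finset.mem_filter, hF, signedFiber, mem_ofPred_eq, neg_one_mul, neg_pos, and_assoc]]
    have h5 : ((F.filter fun p => 0 < ν p (Fin.last n)).card : ℝ≥0∞) =
        (F.filter fun p => ν p (Fin.last n) < 0).card +
          ((if y ∈ wetted (range x) then 1 else 0 : ℕ) : ℝ≥0∞) := by
      rw [← Nat.cast_add]
      congr 1
    rw [h5]
    congr 1
    by_cases hyw : y ∈ wetted (range x)
    · simp [hyw]
    · simp [hyw]
  rw [← h1.2, ← h2.2] at h3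
  have hP := surfaceIntegral_nonneg (x := x) (φ := fun p => max (1 * ν p (Fin.last n)) 0)
    fun p => le_max_right _ _
  have hN := surfaceIntegral_nonneg (x := x) (φ := fun p => max (-1 * ν p (Fin.last n)) 0)
    fun p => le_max_right _ _
  have hfin : volume (wetted (range x)) ≠ ⊤ := by
    intro h
    rw [h, add_top] at h3
    exact ENNReal.ofReal_ne_top h3
  have h4 := congrArg ENNReal.toReal h3
  rw [ENNReal.toReal_add ENNReal.ofReal_ne_top hfin, ENNReal.toReal_ofReal hP,
    ENNReal.toReal_ofReal hN] at h4
  have h5 := surfaceIntegral_add hx hcont (ψ := fun p => max (-1 * ν p (Fin.last n)) 0)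
    ((continuous_const.mul hcont).max continuous_const)
  have h6 : (fun p => ν p (Fin.last n) + max (-1 * ν p (Fin.last n)) 0) =
      fun p => max (1 * ν p (Fin.last n)) 0 := by
    ext1 p
    rw [one_mul, neg_one_mul]
    rcases le_total (ν p (Fin.last n)) 0 with h | h
    · rw [max_eq_left (by linarith), max_eq_right h]; ring
    · rw [max_eq_right (by linarith), max_eq_left h]; ring
  rw [h6] at h5
  linarith

theorem IsCapillary.quermass_one (hx : IsCapillary θ x ν) :
    quermass θ 1 x ν = 1 / (n + 1 : ℝ) * weightedCurv θ 0 x ν := by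
  have h1 : weightedCurv θ 0 x ν = surfaceIntegral x fun p => 1 + -Real.cos θ * ν p (Fin.last n) := by
    rw [weightedCurv]
    congr 1
    ext1 p
    rw [tiltWeight, inner_downVec, meanCurv, normSym_zero]
    ring
  rw [h1, surfaceIntegral_add hx (φ := fun _ => 1)
    (ψ := fun p => -Real.cos θ * ν p (Fin.last n)) continuous_const (continuous_const.mul
    (continuous_last hx.smooth_normal.continuous)), surfaceIntegral_const_mul, ← hx.volume_wetted]
  simp only [quermass]
  ring

end Wetted

/-! ### Integrals that depend on time -/

section Parametric

open MeasureTheory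

variable {E : Type*} [NormedAddCommGroup E] [NormedSpace ℝ E] [MeasurableSpace E] [BorelSpace E]
  {μ : Measure E} [IsFiniteMeasureOnCompacts μ] {T K : Set E} {a b : ℝ} {w : E → ℝ}
  {h h' : E × ℝ → ℝ}

theorem setIntegral_eq_of_compact (hT : MeasurableSet T) (hKT : K ⊆ T)
    (hw0 : ∀ u ∈ T, u ∉ K → w u = 0) (t : ℝ) :
    ∫ u in T, w u * h (u, t) ∂μ = ∫ u in K, w u * h (u, t) ∂μ :=
  setIntegral_eq_of_subset_of_forall_sdiff_eq_zero hT hKT fun u hu => by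
    rw [hw0 u hu.1 hu.2, zero_mul]

theorem continuousOn_setIntegral_param (hT : MeasurableSet T) (hK : IsCompact K) (hKT : K ⊆ T)
    (hw : ContinuousOn w T) (hw0 : ∀ u ∈ T, u ∉ K → w u = 0)
    (hh : ContinuousOn h (T ×ˢ Icc a b)) :
    ContinuousOn (fun t => ∫ u in T, w u * h (u, t) ∂μ) (Icc a b) := by
  simp only [setIntegral_eq_of_compact hT hKT hw0]
  have hc : ContinuousOn (fun z : E × ℝ => w z.1 * h z) (K ×ˢ Icc a b) :=
    ((hw.mono hKT).comp continuousOn_fst fun z hz => hz.1).mul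
      (hh.mono (prod_mono hKT subset_rfl))
  obtain ⟨C, hC⟩ := (hK.prod isCompact_Icc).exists_bound_of_continuousOn hc
  have hKm := hK.measurableSet
  refine continuousOn_of_dominated (bound := fun _ => C) (fun t ht => ?_) (fun t ht => ?_) ?_ ?_
  · exact (hc.comp (f := fun u => (u, t)) (by fun_prop) fun u hu => ⟨hu, ht⟩).aestronglyMeasurable hKm
  · rw [ae_restrict_iff' hKm]
    exact Filter.Eventually.of_forall fun u hu => hC (u, t) ⟨hu, ht⟩
  · exact integrableOn_const hK.measure_lt_top.ne
  · rw [ae_restrict_iff' hKm]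
    exact Filter.Eventually.of_forall fun u hu =>
      hc.comp (f := fun t => (u, t)) (by fun_prop) fun t ht => ⟨hu, ht⟩

theorem hasDerivAt_setIntegral_param (hT : MeasurableSet T) (hK : IsCompact K) (hKT : K ⊆ T)
    (hw : ContinuousOn w T) (hw0 : ∀ u ∈ T, u ∉ K → w u = 0)
    (hh : ContinuousOn h (T ×ˢ Icc a b)) (hh' : ContinuousOn h' (T ×ˢ Icc a b))
    (hd : ∀ u ∈ T, ∀ t ∈ Ioo a b, HasDerivAt (fun r => h (u, r)) (h' (u, t)) t)
    {t : ℝ} (ht : t ∈ Ioo a b) :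
    HasDerivAt (fun t => ∫ u in T, w u * h (u, t) ∂μ) (∫ u in T, w u * h' (u, t) ∂μ) t := by
  simp only [setIntegral_eq_of_compact hT hKT hw0]
  have hc : ∀ {k : E × ℝ → ℝ}, ContinuousOn k (T ×ˢ Icc a b) →
      ContinuousOn (fun z : E × ℝ => w z.1 * k z) (K ×ˢ Icc a b) := fun hk =>
    ((hw.mono hKT).comp continuousOn_fst fun z hz => hz.1).mul
      (hk.mono (prod_mono hKT subset_rfl))
  have hcu : ∀ {k : E × ℝ → ℝ}, ContinuousOn k (T ×ˢ Icc a b) → ∀ t ∈ Ioo a b,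
      ContinuousOn (fun u => w u * k (u, t)) K := fun hk t ht =>
    (hc hk).comp (f := fun u => (u, t)) (by fun_prop) fun u hu => ⟨hu, Ioo_subset_Icc_self ht⟩
  obtain ⟨C, hC⟩ := (hK.prod isCompact_Icc).exists_bound_of_continuousOn (hc hh')
  have hKm := hK.measurableSet
  refine (hasDerivAt_integral_of_dominated_loc_of_deriv_le (Ioo_mem_nhds ht.1 ht.2)
    (bound := fun _ => C) (F' := fun t u => w u * h' (u, t)) ?_ ?_ ?_ ?_ ?_ ?_).2
  · filter_upwards [Ioo_mem_nhds ht.1 ht.2] with r hr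
    exact (hcu hh r hr).aestronglyMeasurable hKm
  · exact (hcu hh t ht).integrableOn_compact hK
  · exact (hcu hh' t ht).aestronglyMeasurable hKm
  · rw [ae_restrict_iff' hKm]
    exact Filter.Eventually.of_forall fun u hu r hr => hC (u, r) ⟨hu, Ioo_subset_Icc_self hr⟩
  · exact integrableOn_const hK.measure_lt_top.ne
  · rw [ae_restrict_iff' hKm]
    exact Filter.Eventually.of_forall fun u hu r hr => (hd u (hKT hu) r hr).const_mul (w u)

end Parametric

/-! ### Smooth families -/

section Families

open MeasureTheory

variable {n : ℕ} [NeZero n] {M : Type*} [TopologicalSpace M] [ChartedSpace (EuclideanHalfSpace n) M]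
  {a b : ℝ} {g : ℝ → M → Amb n}

/-- A family of maps that depends smoothly on a parameter in `[a, b]`. -/
def SmoothFamily (a b : ℝ) (g : ℝ → M → Amb n) : Prop :=
  ∀ c : M, ContDiffOn ℝ ∞ (fun z : EuclideanSpace ℝ (Fin n) × ℝ =>
    g z.2 ((extChartAt (𝓡∂ n) c).symm z.1)) ((extChartAt (𝓡∂ n) c).target ×ˢ Icc a b)

/-- The velocity of a family of maps. -/
def velocity (a b : ℝ) (g : ℝ → M → Amb n) (t : ℝ) (p : M) : Amb n :=
  derivWithin (fun r => g r p) (Icc a b) t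

/-- The derivative of a family in space and time, in the chart centred at `c`. -/
def jointDeriv (a b : ℝ) (g : ℝ → M → Amb n) (c : M) :
    EuclideanSpace ℝ (Fin n) × ℝ → EuclideanSpace ℝ (Fin n) × ℝ →L[ℝ] Amb n :=
  fderivWithin ℝ (fun z : EuclideanSpace ℝ (Fin n) × ℝ =>
    g z.2 ((extChartAt (𝓡∂ n) c).symm z.1)) ((extChartAt (𝓡∂ n) c).target ×ˢ Icc a b)

variable [IsManifold (𝓡∂ n) ∞ M]

theorem uniqueDiffOn_target_prod (hab : a < b) (c : M) :
    UniqueDiffOn ℝ ((extChartAt (𝓡∂ n) c).target ×ˢ Icc a b) :=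
  (uniqueDiffOn_extChartAt_target c).prod (uniqueDiffOn_Icc hab)

theorem contMDiff_of_chart {f : M → Amb n} (hf : ∀ c : M, ContDiffOn ℝ ∞
    (f ∘ (extChartAt (𝓡∂ n) c).symm) (extChartAt (𝓡∂ n) c).target) :
    ContMDiff (𝓡∂ n) 𝓘(ℝ, Amb n) ∞ f := by
  intro p
  have h1 : ContMDiffOn (𝓡∂ n) 𝓘(ℝ, Amb n) ∞
      ((f ∘ (extChartAt (𝓡∂ n) p).symm) ∘ extChartAt (𝓡∂ n) p)
      (chartAt (EuclideanHalfSpace n) p).source :=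
    (contMDiffOn_iff_contDiffOn.2 (hf p)).comp contMDiffOn_extChartAt fun q hq =>
      chart_mem_target hq
  have h2 := (chartAt (EuclideanHalfSpace n) p).open_source.mem_nhds (mem_chart_source' p)
  refine (h1.contMDiffAt h2).congr_of_eventuallyEq ?_
  filter_upwards [h2] with q hq
  simp only [Function.comp_apply, chart_left_inv hq]

theorem SmoothFamily.contMDiff (hg : SmoothFamily a b g) {t : ℝ} (ht : t ∈ Icc a b) :
    ContMDiff (𝓡∂ n) 𝓘(ℝ, Amb n) ∞ (g t) :=
  contMDiff_of_chart fun c => (hg c).comp (f := fun u => (u, t))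
    (contDiffOn_id.prodMk contDiffOn_const) fun _ hu => ⟨hu, ht⟩

theorem SmoothFamily.hasFDerivWithinAt (hg : SmoothFamily a b g) {c : M}
    {z : EuclideanSpace ℝ (Fin n) × ℝ} (hz : z ∈ (extChartAt (𝓡∂ n) c).target ×ˢ Icc a b) :
    HasFDerivWithinAt (fun z : EuclideanSpace ℝ (Fin n) × ℝ =>
      g z.2 ((extChartAt (𝓡∂ n) c).symm z.1)) (jointDeriv a b g c z)
      ((extChartAt (𝓡∂ n) c).target ×ˢ Icc a b) z :=
  ((hg c).differentiableOn (by simp) z hz).hasFDerivWithinAt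

theorem SmoothFamily.hasDerivWithinAt (hg : SmoothFamily a b g) {c p : M}
    (hp : p ∈ (chartAt (EuclideanHalfSpace n) c).source) {t : ℝ} (ht : t ∈ Icc a b) :
    HasDerivWithinAt (fun r => g r p) (jointDeriv a b g c (extChartAt (𝓡∂ n) c p, t) (0, 1))
      (Icc a b) t := by
  have h1 := hg.hasFDerivWithinAt (c := c) (z := (extChartAt (𝓡∂ n) c p, t))
    ⟨chart_mem_target hp, ht⟩
  have h2 : HasDerivWithinAt (fun r : ℝ => (extChartAt (𝓡∂ n) c p, r))
      ((0, 1) : EuclideanSpace ℝ (Fin n) × ℝ) (Icc a b) t :=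
    (hasDerivWithinAt_const t (Icc a b) _).prodMk (hasDerivWithinAt_id t (Icc a b))
  have h3 := h1.comp_hasDerivWithinAt t h2 fun r hr => ⟨chart_mem_target hp, hr⟩
  refine h3.congr (fun r _ => ?_) ?_
  all_goals simp only [Function.comp_apply, chart_left_inv hp]

theorem SmoothFamily.velocity_eq (hg : SmoothFamily a b g) (hab : a < b) {c p : M}
    (hp : p ∈ (chartAt (EuclideanHalfSpace n) c).source) {t : ℝ} (ht : t ∈ Icc a b) :
    velocity a b g t p = jointDeriv a b g c (extChartAt (𝓡∂ n) c p, t) (0, 1) :=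
  (hg.hasDerivWithinAt hp ht).derivWithin (uniqueDiffOn_Icc hab t ht)

theorem SmoothFamily.hasDerivAt (hg : SmoothFamily a b g) (hab : a < b) (p : M) {t : ℝ}
    (ht : t ∈ Ioo a b) : HasDerivAt (fun r => g r p) (velocity a b g t p) t := by
  have h1 := hg.hasDerivWithinAt (mem_chart_source' (n := n) p) (Ioo_subset_Icc_self ht)
  rw [← hg.velocity_eq hab (mem_chart_source' p) (Ioo_subset_Icc_self ht)] at h1
  exact h1.hasDerivAt (Icc_mem_nhds ht.1 ht.2)

theorem SmoothFamily.contDiffOn_jointDeriv (hg : SmoothFamily a b g) (hab : a < b) (c : M)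
    (v : EuclideanSpace ℝ (Fin n) × ℝ) :
    ContDiffOn ℝ ∞ (fun z => jointDeriv a b g c z v)
      ((extChartAt (𝓡∂ n) c).target ×ˢ Icc a b) :=
  ((hg c).fderivWithin (m := ∞) (uniqueDiffOn_target_prod hab c) (by simp)).clm_apply
    contDiffOn_const

theorem SmoothFamily.smoothFamily_velocity (hg : SmoothFamily a b g) (hab : a < b) :
    SmoothFamily a b (velocity a b g) := by
  intro c
  refine (hg.contDiffOn_jointDeriv hab c (0, 1)).congr fun z hz => ?_
  rw [hg.velocity_eq hab (chart_symm_mem hz.1) hz.2, (extChartAt (𝓡∂ n) c).right_inv hz.1]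

theorem SmoothFamily.coordDeriv_eq (hg : SmoothFamily a b g) {c : M}
    {u : EuclideanSpace ℝ (Fin n)} (hu : u ∈ (extChartAt (𝓡∂ n) c).target) {t : ℝ}
    (ht : t ∈ Icc a b) (i : Fin n) :
    coordDeriv c (g t) ((extChartAt (𝓡∂ n) c).symm u) i =
      jointDeriv a b g c (u, t) (stdVec i, 0) := by
  have h1 := hg.hasFDerivWithinAt (c := c) (z := (u, t)) ⟨hu, ht⟩
  have h2 : HasFDerivWithinAt (fun v : EuclideanSpace ℝ (Fin n) => (v, t))
      (ContinuousLinearMap.inl ℝ (EuclideanSpace ℝ (Fin n)) ℝ) (extChartAt (𝓡∂ n) c).target u :=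
    (hasFDerivAt_prodMk_left u t).hasFDerivWithinAt
  have h3 := HasFDerivWithinAt.comp u h1 h2 (show MapsTo _ (extChartAt (𝓡∂ n) c).target
    ((extChartAt (𝓡∂ n) c).target ×ˢ Icc a b) from fun v hv => ⟨hv, ht⟩)
  have h4 : coordDeriv c (g t) ((extChartAt (𝓡∂ n) c).symm u) i =
      fderivWithin ℝ (g t ∘ (extChartAt (𝓡∂ n) c).symm) (extChartAt (𝓡∂ n) c).target u
        (stdVec i) := by
    rw [coordDeriv, (extChartAt (𝓡∂ n) c).right_inv hu, fderivWithin_range_eq hu]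
  rw [h4]
  have h5 := h3.fderivWithin (uniqueDiffOn_extChartAt_target c u hu)
  change fderivWithin ℝ (g t ∘ (extChartAt (𝓡∂ n) c).symm) _ u = _ at h5
  rw [h5]
  rfl

theorem SmoothFamily.contDiffOn_coordDeriv (hg : SmoothFamily a b g) (hab : a < b) (c : M)
    (i : Fin n) :
    ContDiffOn ℝ ∞ (fun z : EuclideanSpace ℝ (Fin n) × ℝ =>
      coordDeriv c (g z.2) ((extChartAt (𝓡∂ n) c).symm z.1) i)
      ((extChartAt (𝓡∂ n) c).target ×ˢ Icc a b) :=
  (hg.contDiffOn_jointDeriv hab c (stdVec i, 0)).congr fun _ hz => hg.coordDeriv_eq hz.1 hz.2 i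

theorem SmoothFamily.hasDerivAt_coordDeriv (hg : SmoothFamily a b g) (hab : a < b) {c : M}
    {u : EuclideanSpace ℝ (Fin n)} (hu : u ∈ (extChartAt (𝓡∂ n) c).target) {t : ℝ}
    (ht : t ∈ Ioo a b) (i : Fin n) :
    HasDerivAt (fun r => coordDeriv c (g r) ((extChartAt (𝓡∂ n) c).symm u) i)
      (coordDeriv c (velocity a b g t) ((extChartAt (𝓡∂ n) c).symm u) i) t := by
  set T := (extChartAt (𝓡∂ n) c).target
  have ht' := Ioo_subset_Icc_self ht
  have hz : (u, t) ∈ T ×ˢ Icc a b := ⟨hu, ht'⟩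
  have hU := uniqueDiffOn_target_prod (n := n) hab c
  have h1 : HasFDerivWithinAt (jointDeriv a b g c)
      (fderivWithin ℝ (jointDeriv a b g c) (T ×ˢ Icc a b) (u, t)) (T ×ˢ Icc a b) (u, t) :=
    (((hg c).fderivWithin (m := ∞) hU (by simp)).differentiableOn (by simp) _ hz).hasFDerivWithinAt
  set D2 := fderivWithin ℝ (jointDeriv a b g c) (T ×ˢ Icc a b) (u, t)
  have h2 : ∀ v, HasFDerivWithinAt (fun z => jointDeriv a b g c z v) (D2.flip v)
      (T ×ˢ Icc a b) (u, t) := by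
    intro v
    have h3 := h1.clm_apply (hasFDerivWithinAt_const v (u, t) _)
    exact h3.congr_fderiv (ContinuousLinearMap.ext fun w => by simp)
  have hsymm : D2 (0, 1) (stdVec i, 0) = D2 (stdVec i, 0) (0, 1) := by
    refine (ContDiffWithinAt.isSymmSndFDerivWithinAt (n := ∞) (hg c (u, t) hz)
      (by simp only [minSmoothness_of_isRCLikeNormedField]; exact ENat.LEInfty.out) hU
      ?_ hz) _ _
    rw [interior_prod_eq, closure_prod_eq, interior_Icc, closure_Ioo hab.ne]
    exact ⟨mem_closure_interior_target hu, ht'⟩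
  have h3 : coordDeriv c (velocity a b g t) ((extChartAt (𝓡∂ n) c).symm u) i =
      D2 (stdVec i, 0) (0, 1) := by
    have h4 : HasFDerivWithinAt (fun v : EuclideanSpace ℝ (Fin n) => (v, t))
        (ContinuousLinearMap.inl ℝ (EuclideanSpace ℝ (Fin n)) ℝ) T u :=
      (hasFDerivAt_prodMk_left u t).hasFDerivWithinAt
    have h5 := HasFDerivWithinAt.comp u (h2 (0, 1)) h4
      (show MapsTo _ T (T ×ˢ Icc a b) from fun v hv => ⟨hv, ht'⟩)
    have h6 : HasFDerivWithinAt (velocity a b g t ∘ (extChartAt (𝓡∂ n) c).symm)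
        ((D2.flip (0, 1)).comp (ContinuousLinearMap.inl ℝ (EuclideanSpace ℝ (Fin n)) ℝ)) T u := by
      refine h5.congr (fun v hv => ?_) ?_
      · simp only [Function.comp_apply]
        rw [hg.velocity_eq hab (chart_symm_mem hv) ht', (extChartAt (𝓡∂ n) c).right_inv hv]
      · simp only [Function.comp_apply]
        rw [hg.velocity_eq hab (chart_symm_mem hu) ht', (extChartAt (𝓡∂ n) c).right_inv hu]
    rw [coordDeriv, (extChartAt (𝓡∂ n) c).right_inv hu, fderivWithin_range_eq hu,
      h6.fderivWithin (uniqueDiffOn_extChartAt_target c u hu)]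
    rfl
  have h4 : HasDerivWithinAt (fun r : ℝ => (u, r))
      ((0, 1) : EuclideanSpace ℝ (Fin n) × ℝ) (Icc a b) t :=
    (hasDerivWithinAt_const t (Icc a b) _).prodMk (hasDerivWithinAt_id t (Icc a b))
  have h5 := (h2 (stdVec i, 0)).comp_hasDerivWithinAt t h4 fun r hr => ⟨hu, hr⟩
  have h6 := h5.hasDerivAt (Icc_mem_nhds ht.1 ht.2)
  rw [h3, ← hsymm]
  refine h6.congr_of_eventuallyEq ?_
  filter_upwards [Icc_mem_nhds ht.1 ht.2] with r hr
  exact hg.coordDeriv_eq hu hr i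

end Families

/-! ### Evolution of the weighted curvature integrals -/

section Evolution

open MeasureTheory

variable {n : ℕ} [NeZero n] {M : Type*} [TopologicalSpace M] [ChartedSpace (EuclideanHalfSpace n) M]
  [IsManifold (𝓡∂ n) ∞ M] {θ a b : ℝ} {x ν g : ℝ → M → Amb n}

/-- A family of capillary hypersurfaces that depends smoothly on a parameter in `[a, b]`. -/
structure IsCapillaryFamily (θ a b : ℝ) (x ν : ℝ → M → Amb n) : Prop where
  lt : a < b
  smooth : SmoothFamily a b x
  smooth_normal : SmoothFamily a b ν
  capillary : ∀ t ∈ Icc a b, IsCapillary θ (x t) (ν t)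

theorem IsCapillaryFamily.orient_eq (h : IsCapillaryFamily θ a b x ν) {c : M}
    {u : EuclideanSpace ℝ (Fin n)} (hu : u ∈ (extChartAt (𝓡∂ n) c).target) {t : ℝ}
    (ht : t ∈ Icc a b) :
    orient (x t) (ν t) c ((extChartAt (𝓡∂ n) c).symm u) =
      orient (x a) (ν a) c ((extChartAt (𝓡∂ n) c).symm u) := by
  have hne : ∀ r ∈ Icc a b, areaForm (x r) (ν r) c ((extChartAt (𝓡∂ n) c).symm u) ≠ 0 :=
    fun r hr => (h.capillary r hr).areaForm_ne_zero (chart_symm_mem hu)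
  have hc : ContinuousOn (fun r => areaForm (x r) (ν r) c ((extChartAt (𝓡∂ n) c).symm u))
      (Icc a b) := by
    refine continuous_frameDet.comp_continuousOn (ContinuousOn.prodMk ?_ (continuousOn_pi.2
      fun i => ?_))
    · exact (h.smooth_normal c).continuousOn.comp (f := fun r => (u, r)) (by fun_prop)
        fun r hr => ⟨hu, hr⟩
    · exact (h.smooth.contDiffOn_coordDeriv h.lt c i).continuousOn.comp (f := fun r => (u, r))
        (by fun_prop) fun r hr => ⟨hu, hr⟩
  have hsq : ∀ r ∈ Icc a b, orient (x r) (ν r) c ((extChartAt (𝓡∂ n) c).symm u) ^ 2 = 1 := by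
    intro r hr
    rw [orient, div_pow, sq_abs, div_self (pow_ne_zero 2 (hne r hr))]
  have ha : a ∈ Icc a b := left_mem_Icc.2 h.lt.le
  refine isPreconnected_Icc.eq_of_sq_eq
    (f := fun r => orient (x r) (ν r) c ((extChartAt (𝓡∂ n) c).symm u))
    (g := fun _ => orient (x a) (ν a) c ((extChartAt (𝓡∂ n) c).symm u))
    (hc.div hc.abs fun r hr => abs_ne_zero.2 (hne r hr)) continuousOn_const
    (fun r hr => ?_) (fun {r} _ h0 => ?_) ha rfl ht
  · simp only [Pi.pow_apply, hsq r hr, hsq a ha]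
  · have h1 := hsq a ha
    rw [h0] at h1
    norm_num at h1

theorem SmoothFamily.continuousOn_frameDet {A : ℝ → M → Amb n} (hA : SmoothFamily a b A)
    (hg : SmoothFamily a b g) (hab : a < b) (c : M) :
    ContinuousOn (fun z : EuclideanSpace ℝ (Fin n) × ℝ =>
      frameDet (A z.2 ((extChartAt (𝓡∂ n) c).symm z.1))
        (coordDeriv c (g z.2) ((extChartAt (𝓡∂ n) c).symm z.1)))
      ((extChartAt (𝓡∂ n) c).target ×ˢ Icc a b) :=
  CapillaryFlow.continuousOn_frameDet (hA c).continuousOn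
    fun i => (hg.contDiffOn_coordDeriv hab c i).continuousOn

theorem SmoothFamily.continuousOn_frameVar {A B : ℝ → M → Amb n} (hA : SmoothFamily a b A)
    (hg : SmoothFamily a b g) (hB : SmoothFamily a b B) (hab : a < b) (c : M) :
    ContinuousOn (fun z : EuclideanSpace ℝ (Fin n) × ℝ =>
      frameVar (A z.2 ((extChartAt (𝓡∂ n) c).symm z.1))
        (coordDeriv c (g z.2) ((extChartAt (𝓡∂ n) c).symm z.1))
        (coordDeriv c (B z.2) ((extChartAt (𝓡∂ n) c).symm z.1)))
      ((extChartAt (𝓡∂ n) c).target ×ˢ Icc a b) :=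
  CapillaryFlow.continuousOn_frameVar (hA c).continuousOn
    (fun i => (hg.contDiffOn_coordDeriv hab c i).continuousOn)
    fun i => (hB.contDiffOn_coordDeriv hab c i).continuousOn

variable [CompactSpace M] [T2Space M]

theorem IsCapillaryFamily.surfaceIntegral_density (h : IsCapillaryFamily θ a b x ν) {t : ℝ}
    (ht : t ∈ Icc a b) {Θ : M → M → ℝ} (hΘ : IsTopForm n Θ) :
    surfaceIntegral (x t) (density (x t) (ν t) Θ) =
      ∑ c ∈ activeCharts n M, ∫ u in (extChartAt (𝓡∂ n) c).target,
        chartPartition n M c ((extChartAt (𝓡∂ n) c).symm u) *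
          orient (x a) (ν a) c ((extChartAt (𝓡∂ n) c).symm u) *
          Θ c ((extChartAt (𝓡∂ n) c).symm u) := by
  rw [surfaceIntegral_eq_sum]
  refine Finset.sum_congr rfl fun c _ => setIntegral_congr_fun (measurableSet_target c) fun u hu => ?_
  rw [mul_assoc, (h.capillary t ht).density_mul_sqrt hΘ (chart_symm_mem hu), h.orient_eq hu ht,
    mul_assoc]

/-- The weight with which a chart enters the surface integral is continuous and vanishes off a compact
subset of the target of the chart. -/
theorem exists_compact_weight (hx : IsCapillary θ (x a) (ν a)) (c : M) :
    ∃ K ⊆ (extChartAt (𝓡∂ n) c).target, IsCompact K ∧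
      (ContinuousOn (fun u => chartPartition n M c ((extChartAt (𝓡∂ n) c).symm u) *
        orient (x a) (ν a) c ((extChartAt (𝓡∂ n) c).symm u)) (extChartAt (𝓡∂ n) c).target) ∧
      ∀ u ∈ (extChartAt (𝓡∂ n) c).target, u ∉ K →
        chartPartition n M c ((extChartAt (𝓡∂ n) c).symm u) *
        orient (x a) (ν a) c ((extChartAt (𝓡∂ n) c).symm u) = 0 := by
  have hsub := tsupport_chartPartition_subset (n := n) c
  refine ⟨extChartAt (𝓡∂ n) c '' tsupport (chartPartition n M c), ?_, ?_, ?_, fun u hu hK => ?_⟩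
  · rintro _ ⟨p, hp, rfl⟩
    exact chart_mem_target (hsub hp)
  · exact (isCompact_tsupport_chartPartition c).image_of_continuousOn
      ((continuousOn_extChartAt c).mono (by rwa [extChartAt_source]))
  · exact ((continuous_chartPartition c).comp_continuousOn (continuousOn_chart_symm c)).mul
      (hx.continuousOn_orient c)
  · rw [image_eq_zero_of_notMem_tsupport fun hmem => hK ⟨_, hmem,
      (extChartAt (𝓡∂ n) c).right_inv hu⟩, zero_mul]

theorem IsCapillaryFamily.continuousOn_surfaceIntegral (h : IsCapillaryFamily θ a b x ν)
    {Θ : ℝ → M → M → ℝ} (hΘ : ∀ t ∈ Icc a b, IsTopForm n (Θ t))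
    (hc : ∀ c, ContinuousOn (fun z : EuclideanSpace ℝ (Fin n) × ℝ =>
      Θ z.2 c ((extChartAt (𝓡∂ n) c).symm z.1)) ((extChartAt (𝓡∂ n) c).target ×ˢ Icc a b)) :
    ContinuousOn (fun t => surfaceIntegral (x t) (density (x t) (ν t) (Θ t))) (Icc a b) := by
  refine ContinuousOn.congr ?_ fun t ht => h.surfaceIntegral_density ht (hΘ t ht)
  refine continuousOn_finsetSum _ fun c _ => ?_
  obtain ⟨K, hKT, hK, hw, hw0⟩ :=
    exists_compact_weight (h.capillary a (left_mem_Icc.2 h.lt.le)) c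
  exact continuousOn_setIntegral_param (measurableSet_target c) hK hKT hw hw0 (hc c)

theorem IsCapillaryFamily.hasDerivAt_surfaceIntegral (h : IsCapillaryFamily θ a b x ν)
    {Θ Θ' : ℝ → M → M → ℝ} (hΘ : ∀ t ∈ Icc a b, IsTopForm n (Θ t))
    (hΘ' : ∀ t ∈ Icc a b, IsTopForm n (Θ' t))
    (hc : ∀ c, ContinuousOn (fun z : EuclideanSpace ℝ (Fin n) × ℝ =>
      Θ z.2 c ((extChartAt (𝓡∂ n) c).symm z.1)) ((extChartAt (𝓡∂ n) c).target ×ˢ Icc a b))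
    (hc' : ∀ c, ContinuousOn (fun z : EuclideanSpace ℝ (Fin n) × ℝ =>
      Θ' z.2 c ((extChartAt (𝓡∂ n) c).symm z.1)) ((extChartAt (𝓡∂ n) c).target ×ˢ Icc a b))
    (hd : ∀ c, ∀ u ∈ (extChartAt (𝓡∂ n) c).target, ∀ t ∈ Ioo a b,
      HasDerivAt (fun r => Θ r c ((extChartAt (𝓡∂ n) c).symm u))
        (Θ' t c ((extChartAt (𝓡∂ n) c).symm u)) t) {t : ℝ} (ht : t ∈ Ioo a b) :
    HasDerivAt (fun t => surfaceIntegral (x t) (density (x t) (ν t) (Θ t)))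
      (surfaceIntegral (x t) (density (x t) (ν t) (Θ' t))) t := by
  rw [h.surfaceIntegral_density (Ioo_subset_Icc_self ht) (hΘ' t (Ioo_subset_Icc_self ht))]
  refine HasDerivAt.congr_of_eventuallyEq (f := fun t => ∑ c ∈ activeCharts n M,
    ∫ u in (extChartAt (𝓡∂ n) c).target, chartPartition n M c ((extChartAt (𝓡∂ n) c).symm u) *
      orient (x a) (ν a) c ((extChartAt (𝓡∂ n) c).symm u) *
      Θ t c ((extChartAt (𝓡∂ n) c).symm u)) ?_ ?_
  · refine HasDerivAt.fun_sum fun c _ => ?_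
    obtain ⟨K, hKT, hK, hw, hw0⟩ :=
      exists_compact_weight (h.capillary a (left_mem_Icc.2 h.lt.le)) c
    exact hasDerivAt_setIntegral_param (measurableSet_target c) hK hKT hw hw0 (hc c) (hc' c)
      (hd c) ht
  · filter_upwards [Ioo_mem_nhds ht.1 ht.2] with r hr
    exact h.surfaceIntegral_density (Ioo_subset_Icc_self hr) (hΘ r (Ioo_subset_Icc_self hr))

theorem IsCapillaryFamily.continuousOn_coneVolume (h : IsCapillaryFamily θ a b x ν)
    (hg : SmoothFamily a b g) :
    ContinuousOn (fun t => surfaceIntegral (x t) (density (x t) (ν t)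
      fun c p => frameDet (g t p) (coordDeriv c (g t) p))) (Icc a b) :=
  h.continuousOn_surfaceIntegral
    (Θ := fun t c p => frameDet (g t p) (coordDeriv c (g t) p))
    (fun _ hr => isTopForm_frameDet _ (hg.contMDiff hr)) (hg.continuousOn_frameDet hg h.lt)

/-- The first variation of the enclosed cone volume of a family that is horizontal along the
boundary. -/
theorem IsCapillaryFamily.hasDerivAt_coneVolume (h : IsCapillaryFamily θ a b x ν)
    (hg : SmoothFamily a b g)
    (hg0 : ∀ t ∈ Icc a b, ∀ p ∈ (𝓡∂ n).boundary M, g t p (Fin.last n) = 0) {t : ℝ}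
    (ht : t ∈ Ioo a b) :
    HasDerivAt (fun t => surfaceIntegral (x t) (density (x t) (ν t)
        fun c p => frameDet (g t p) (coordDeriv c (g t) p)))
      ((n + 1) * surfaceIntegral (x t) (density (x t) (ν t)
        fun c p => frameDet (velocity a b g t p) (coordDeriv c (g t) p))) t := by
  have hA := hg.smoothFamily_velocity h.lt
  have htop : ∀ r ∈ Icc a b, IsTopForm n
      (fun c p => frameDet (velocity a b g r p) (coordDeriv c (g r) p)) := fun r hr =>
    isTopForm_frameDet _ (hg.contMDiff hr)
  have hdiv : ∀ r ∈ Icc a b, IsTopForm n (divForm (g r) (velocity a b g r) (g r)) := fun r hr =>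
    isTopForm_divForm (hg.contMDiff hr) (hA.contMDiff hr) (hg.contMDiff hr)
  have key := h.hasDerivAt_surfaceIntegral
    (Θ := fun t c p => frameDet (g t p) (coordDeriv c (g t) p))
    (Θ' := fun t c p => frameDet (velocity a b g t p) (coordDeriv c (g t) p) +
      frameVar (g t p) (coordDeriv c (g t) p) (coordDeriv c (velocity a b g t) p))
    (fun r hr => isTopForm_frameDet _ (hg.contMDiff hr))
    (fun r hr c c' p hp hp' => by
      have h1 := htop r hr c c' p hp hp'
      have h2 := isTopForm_frameVar (g r) (hg.contMDiff hr) (hA.contMDiff hr) c c' p hp hp'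
      simp only at h1 h2 ⊢
      rw [h1, h2, mul_add])
    (hg.continuousOn_frameDet hg h.lt)
    (fun c => (hA.continuousOn_frameDet hg h.lt c).add (hg.continuousOn_frameVar hg hA h.lt c))
    (fun c u hu r hr => hasDerivAt_frameDet (hg.hasDerivAt h.lt _ hr)
      fun i => hg.hasDerivAt_coordDeriv h.lt hu hr i) ht
  refine key.congr_deriv ?_
  have ht' := Ioo_subset_Icc_self ht
  have hx := h.capillary t ht'
  have h0 : ∀ p ∈ (𝓡∂ n).boundary M, velocity a b g t p (Fin.last n) = 0 := by
    intro p hp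
    have h1 := ((EuclideanSpace.proj (𝕜 := ℝ) (Fin.last n)).hasFDerivAt.comp_hasDerivAt t
      (hg.hasDerivAt h.lt p ht))
    refine h1.unique ((hasDerivAt_const t (0 : ℝ)).congr_of_eventuallyEq ?_)
    filter_upwards [Ioo_mem_nhds ht.1 ht.2] with r hr
    exact hg0 r (Ioo_subset_Icc_self hr) p hp
  have hst := surface_stokes_horizontal hx (hg.contMDiff ht') (hA.contMDiff ht') (hg.contMDiff ht')
    (hg0 t ht') h0 (hg0 t ht')
  have h3 : ∀ p, density (x t) (ν t) (fun c p => frameDet (velocity a b g t p)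
      (coordDeriv c (g t) p) + frameVar (g t p) (coordDeriv c (g t) p)
      (coordDeriv c (velocity a b g t) p)) p =
      density (x t) (ν t) (divForm (g t) (velocity a b g t) (g t)) p +
      (n + 1) * density (x t) (ν t)
        (fun c p => frameDet (velocity a b g t p) (coordDeriv c (g t) p)) p := by
    intro p
    simp only [density, divForm, frameVar_self]
    ring
  rw [funext h3, surfaceIntegral_add (φ := density (x t) (ν t) (divForm (g t)
    (velocity a b g t) (g t))) (ψ := fun p => (n + 1) * density (x t) (ν t)
      (fun c p => frameDet (velocity a b g t p) (coordDeriv c (g t) p)) p) hx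
    (hx.continuous_density (hdiv t ht') (continuousOn_divForm (hg.contMDiff ht')
      (hA.contMDiff ht') (hg.contMDiff ht')))
    (continuous_const.mul (hx.continuous_density (htop t ht') fun c => continuousOn_frameDet
      (hA.contMDiff ht').continuous.continuousOn (continuousOn_coordDeriv (hg.contMDiff ht') c))),
    hst, zero_add, surfaceIntegral_const_mul]

theorem IsCapillaryFamily.smoothFamily_shift (h : IsCapillaryFamily θ a b x ν) (s : ℝ) :
    SmoothFamily a b (fun t => shift θ s (x t) (ν t)) := fun c =>
  (h.smooth c).add (((h.smooth_normal c).add contDiffOn_const).const_smul s)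

theorem IsCapillaryFamily.inner_velocity_shift (h : IsCapillaryFamily θ a b x ν) (s : ℝ) {t : ℝ}
    (ht : t ∈ Ioo a b) (p : M) :
    inner ℝ (velocity a b (fun t => shift θ s (x t) (ν t)) t p) (ν t p) =
      inner ℝ (velocity a b x t p) (ν t p) := by
  have h1 := h.smooth.hasDerivAt h.lt p ht
  have h2 := h.smooth_normal.hasDerivAt h.lt p ht
  have h3 := h1.add ((h2.add_const (Real.cos θ • downVec n)).const_smul s)
  have h4 : velocity a b (fun t => shift θ s (x t) (ν t)) t p =
      velocity a b x t p + s • velocity a b ν t p :=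
    ((h.smoothFamily_shift s).hasDerivAt h.lt p ht).unique h3
  have h5 : inner ℝ (velocity a b ν t p) (ν t p) = 0 := by
    have h6 := h2.inner ℝ h2
    have h7 : HasDerivAt (fun r => inner ℝ (ν r p) (ν r p)) 0 t := by
      refine (hasDerivAt_const t (1 : ℝ)).congr_of_eventuallyEq ?_
      filter_upwards [Ioo_mem_nhds ht.1 ht.2] with r hr
      simp [(h.capillary r (Ioo_subset_Icc_self hr)).unit_normal]
    have h8 := h6.unique h7
    rw [real_inner_comm (velocity a b ν t p)] at h8
    rw [real_inner_comm] at h8 ⊢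
    linarith
  rw [h4, inner_add_left, inner_smul_left, h5, mul_zero, add_zero]

/-- The coefficients of the cone volume of the parallel hypersurfaces. -/
def coneCoeff (θ : ℝ) (x ν : M → Amb n) : ℕ → ℝ
  | 0 => surfaceIntegral x fun p => meanCurv 0 x ν p * inner ℝ (x p) (ν p)
  | k + 1 => (n + 1).choose (k + 1) * weightedCurv θ k x ν

theorem IsCapillary.coneVolume_shift {x ν : M → Amb n} (hx : IsCapillary θ x ν) (s : ℝ) :
    surfaceIntegral x (density x ν fun c p =>
      frameDet (shift θ s x ν p) (coordDeriv c (shift θ s x ν) p)) =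
    ∑ i ∈ Finset.range (n + 2), s ^ i * coneCoeff θ x ν i := by
  have hH : ∀ k ∈ Finset.range (n + 1), Continuous (meanCurv k x ν) := fun k hk =>
    hx.continuous_meanCurv (Nat.lt_succ_iff.1 (Finset.mem_range.1 hk))
  have hc1 : ∀ k ∈ Finset.range (n + 1), Continuous fun p =>
      s ^ k * n.choose k * (meanCurv k x ν p * inner ℝ (x p) (ν p)) := fun k hk =>
    continuous_const.mul ((hH k hk).mul hx.continuous_inner_normal)
  have hc2 : ∀ k ∈ Finset.range (n + 1), Continuous fun p =>
      s ^ (k + 1) * n.choose k * (meanCurv k x ν p * tiltWeight θ ν p) := fun k hk =>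
    continuous_const.mul ((hH k hk).mul hx.continuous_tiltWeight)
  have h1 : ∀ p, density x ν (fun c p => frameDet (shift θ s x ν p)
      (coordDeriv c (shift θ s x ν) p)) p =
      (∑ k ∈ Finset.range (n + 1),
        s ^ k * n.choose k * (meanCurv k x ν p * inner ℝ (x p) (ν p))) +
      ∑ k ∈ Finset.range (n + 1),
        s ^ (k + 1) * n.choose k * (meanCurv k x ν p * tiltWeight θ ν p) := by
    intro p
    rw [hx.density_frameDet_shift (shift θ s x ν) s p, hx.inner_shift, curvPoly, add_mul,
      Finset.mul_sum, Finset.mul_sum]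
    congr 1 <;> refine Finset.sum_congr rfl fun k _ => by ring
  rw [funext h1, surfaceIntegral_add hx (continuous_finsetSum _ hc1) (continuous_finsetSum _ hc2),
    surfaceIntegral_sum hx _ hc1, surfaceIntegral_sum hx _ hc2]
  simp only [surfaceIntegral_const_mul]
  rw [Finset.sum_range_succ' _ (n + 1), Finset.sum_range_succ' _ n]
  have h2 : ∑ k ∈ Finset.range n, s ^ (k + 1) * n.choose (k + 1) *
      surfaceIntegral x (fun p => meanCurv (k + 1) x ν p * inner ℝ (x p) (ν p)) =
      ∑ k ∈ Finset.range (n + 1), s ^ (k + 1) * n.choose (k + 1) * weightedCurv θ k x ν := by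
    rw [Finset.sum_range_succ, Nat.choose_succ_self, Nat.cast_zero, mul_zero, zero_mul, add_zero]
    exact Finset.sum_congr rfl fun k hk => by rw [hx.minkowski (Finset.mem_range.1 hk)]
  rw [h2]
  simp only [coneCoeff, pow_zero, Nat.choose_zero_right, Nat.cast_one, one_mul]
  rw [add_right_comm, ← Finset.sum_add_distrib]
  congr 1
  refine Finset.sum_congr rfl fun k _ => ?_
  rw [Nat.choose_succ_succ, weightedCurv]
  push_cast
  ring

theorem IsCapillaryFamily.hasDerivAt_coneCoeff (h : IsCapillaryFamily θ a b x ν) {t : ℝ}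
    (ht : t ∈ Ioo a b) {k : ℕ} (hk : k ≤ n) :
    HasDerivAt (fun t => coneCoeff θ (x t) (ν t) k)
      ((n + 1) * (n.choose k * surfaceIntegral (x t) fun p =>
        inner ℝ (velocity a b x t p) (ν t p) * meanCurv k (x t) (ν t) p)) t := by
  obtain ⟨L, hL⟩ := exists_coeff_extraction (n + 2)
  have ht' := Ioo_subset_Icc_self ht
  have hx := h.capillary t ht'
  set B : ℕ → ℝ := fun k => (n + 1) * (n.choose k * surfaceIntegral (x t) fun p =>
    inner ℝ (velocity a b x t p) (ν t p) * meanCurv k (x t) (ν t) p) with hB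
  have hd : ∀ s : ℝ, HasDerivAt
      (fun t => ∑ i ∈ Finset.range (n + 2), s ^ i * coneCoeff θ (x t) (ν t) i)
      (∑ i ∈ Finset.range (n + 2), s ^ i * B i) t := by
    intro s
    have h1 := h.hasDerivAt_coneVolume (h.smoothFamily_shift s)
      (fun r hr p hp => (h.capillary r hr).shift_last s hp) ht
    have h2 := h1.congr_of_eventuallyEq (f := fun t => surfaceIntegral (x t)
      (density (x t) (ν t) fun c p => frameDet (shift θ s (x t) (ν t) p)
        (coordDeriv c (shift θ s (x t) (ν t)) p)))
      (f₁ := fun t => ∑ i ∈ Finset.range (n + 2), s ^ i * coneCoeff θ (x t) (ν t) i) (by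
        filter_upwards [Ioo_mem_nhds ht.1 ht.2] with r hr
        exact ((h.capillary r (Ioo_subset_Icc_self hr)).coneVolume_shift s).symm)
    refine h2.congr_deriv ?_
    have h3 : ∀ p, density (x t) (ν t) (fun c p => frameDet
        (velocity a b (fun t => shift θ s (x t) (ν t)) t p)
        (coordDeriv c (shift θ s (x t) (ν t)) p)) p =
        ∑ i ∈ Finset.range (n + 1), s ^ i * n.choose i *
          (inner ℝ (velocity a b x t p) (ν t p) * meanCurv i (x t) (ν t) p) := by
      intro p
      rw [hx.density_frameDet_shift (velocity a b (fun t => shift θ s (x t) (ν t)) t) s p,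
        h.inner_velocity_shift s ht, curvPoly, Finset.mul_sum]
      exact Finset.sum_congr rfl fun i _ => by ring
    rw [funext h3, surfaceIntegral_sum (φ := fun i p => s ^ i * n.choose i *
      (inner ℝ (velocity a b x t p) (ν t p) * meanCurv i (x t) (ν t) p)) hx _ fun i hi => continuous_const.mul
      (((((h.smooth.smoothFamily_velocity h.lt).contMDiff ht').continuous.inner
        hx.smooth_normal.continuous)).mul
        (hx.continuous_meanCurv (Nat.lt_succ_iff.1 (Finset.mem_range.1 hi)))),
      Finset.sum_range_succ _ (n + 1)]
    simp only [surfaceIntegral_const_mul, hB, Nat.choose_succ_self, Nat.cast_zero, zero_mul,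
      mul_zero, add_zero]
    rw [Finset.mul_sum]
    exact Finset.sum_congr rfl fun i _ => by ring
  have hk' : k < n + 2 := by omega
  change HasDerivAt _ (B k) t
  rw [hL B k hk', funext fun t => hL (coneCoeff θ (x t) (ν t)) k hk']
  exact HasDerivAt.fun_sum fun j _ => (hd j).const_mul (L k j)

theorem IsCapillaryFamily.hasDerivAt_weightedCurv (h : IsCapillaryFamily θ a b x ν) {t : ℝ}
    (ht : t ∈ Ioo a b) {k : ℕ} (hk : k < n) :
    HasDerivAt (fun t => weightedCurv θ k (x t) (ν t))
      ((n - k) * surfaceIntegral (x t) fun p =>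
        inner ℝ (velocity a b x t p) (ν t p) * meanCurv (k + 1) (x t) (ν t) p) t := by
  have hc : ((n + 1).choose (k + 1) : ℝ) ≠ 0 := by
    exact_mod_cast (Nat.choose_pos (by omega)).ne'
  have h1 := (h.hasDerivAt_coneCoeff ht hk).const_mul ((n + 1).choose (k + 1) : ℝ)⁻¹
  simp only [coneCoeff, inv_mul_cancel_left₀ hc] at h1
  refine h1.congr_deriv ?_
  rw [inv_mul_eq_iff_eq_mul₀ hc]
  have h2 : ((n : ℝ) + 1) * n.choose k = (n + 1).choose (k + 1) * (k + 1) := by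
    exact_mod_cast Nat.add_one_mul_choose_eq n k
  have h3 : (n.choose (k + 1) : ℝ) * (k + 1) = n.choose k * (n - k) := by
    rw [← Nat.cast_sub hk.le]
    exact_mod_cast Nat.choose_succ_right_eq n k
  have h4 : ((n : ℝ) + 1) * n.choose (k + 1) = (n + 1).choose (k + 1) * (n - k) := by
    have hk1 : (k + 1 : ℝ) ≠ 0 := by positivity
    refine mul_right_cancel₀ hk1 ?_
    linear_combination ((n : ℝ) + 1) * h3 + ((n : ℝ) - k) * h2
  rw [← mul_assoc, h4, mul_assoc]

theorem IsCapillaryFamily.continuousOn_weightedCurv (h : IsCapillaryFamily θ a b x ν) {k : ℕ}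
    (hk : k ≤ n) : ContinuousOn (fun t => weightedCurv θ k (x t) (ν t)) (Icc a b) := by
  obtain ⟨L, hL⟩ := exists_coeff_extraction (n + 2)
  have hd : ∀ s : ℝ, ContinuousOn
      (fun t => ∑ i ∈ Finset.range (n + 2), s ^ i * coneCoeff θ (x t) (ν t) i) (Icc a b) := by
    intro s
    have hE := h.continuousOn_coneVolume (h.smoothFamily_shift s)
    exact hE.congr fun r hr => ((h.capillary r hr).coneVolume_shift s).symm
  have hc : ((n + 1).choose (k + 1) : ℝ) ≠ 0 := by
    exact_mod_cast (Nat.choose_pos (by omega)).ne'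
  have h1 : ContinuousOn (fun t => coneCoeff θ (x t) (ν t) (k + 1)) (Icc a b) := by
    rw [funext fun t => hL (coneCoeff θ (x t) (ν t)) (k + 1) (by omega)]
    exact continuousOn_finsetSum _ fun j _ => continuousOn_const.mul (hd j)
  refine (continuousOn_const (c := ((n + 1).choose (k + 1) : ℝ)⁻¹)|>.mul h1).congr fun t _ => ?_
  exact (inv_mul_cancel_left₀ hc _).symm

end Evolution

/-! ### Monotonicity along the flow -/

/-- Newton's inequalities for consecutive indices imply them for all pairs of indices. -/
theorem mul_le_mul_of_newton {H : ℕ → ℝ} {k m : ℕ} (hkm : k ≤ m) (hpos : ∀ j ≤ m + 1, 0 < H j)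
    (hN : ∀ j, j + 2 ≤ m + 1 → H j * H (j + 2) ≤ H (j + 1) ^ 2) :
    H k * H (m + 1) ≤ H (k + 1) * H m := by
  induction m, hkm using Nat.le_induction with
  | base => rw [mul_comm]
  | succ m hkm ih =>
    have h1 := ih (fun j hj => hpos j (by omega)) fun j hj => hN j (by omega)
    have h2 := hN m le_rfl
    refine le_of_mul_le_mul_right ?_ (hpos (m + 1) (by omega))
    calc H k * H (m + 1 + 1) * H (m + 1) = H k * H (m + 1) * H (m + 2) := by ring
      _ ≤ H (k + 1) * H m * H (m + 2) :=
        mul_le_mul_of_nonneg_right h1 (hpos (m + 2) le_rfl).le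
      _ = H (k + 1) * (H m * H (m + 2)) := by ring
      _ ≤ H (k + 1) * H (m + 1) ^ 2 :=
        mul_le_mul_of_nonneg_left h2 (hpos (k + 1) (by omega)).le
      _ = H (k + 1) * H (m + 1) * H (m + 1) := by ring

section Flow

variable {n : ℕ} [NeZero n] {M : Type*} [TopologicalSpace M] [ChartedSpace (EuclideanHalfSpace n) M]
  [IsManifold (𝓡∂ n) ∞ M] {θ : ℝ}

theorem meanCurv_zero (x ν : M → Amb n) (p : M) : meanCurv 0 x ν p = 1 := normSym_zero _ _

theorem IsCapillary.tiltWeight_nonneg {x ν : M → Amb n} (hx : IsCapillary θ x ν) (p : M) :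
    0 ≤ tiltWeight θ ν p := by
  have h1 : |inner ℝ (ν p) (downVec n)| ≤ 1 := by
    refine (abs_real_inner_le_norm _ _).trans ?_
    simp [hx.unit_normal, downVec]
  have h2 : |Real.cos θ * inner ℝ (ν p) (downVec n)| ≤ 1 := by
    rw [abs_mul]
    exact mul_le_one₀ (Real.abs_cos_le_one θ) (abs_nonneg _) h1
  rw [tiltWeight]
  linarith [neg_le_of_abs_le h2]

theorem StrictlyConvexOrder.pos {x ν : M → Amb n} {l : ℕ} (h : StrictlyConvexOrder l x ν) {j : ℕ}
    (hj : j ≤ l) (p : M) : 0 < meanCurv j x ν p := by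
  rcases Nat.eq_zero_or_pos j with rfl | h0
  · rw [meanCurv_zero]
    exact one_pos
  · exact h j h0 hj p

theorem StrictlyConvexOrder.meanCurv_mul_le {x ν : M → Amb n} (hx : IsCapillary θ x ν) {l k : ℕ}
    (h : StrictlyConvexOrder (l + 1) x ν) (hl : l < n) (hk : k ≤ l) (p : M) :
    meanCurv k x ν p * meanCurv (l + 1) x ν p ≤ meanCurv (k + 1) x ν p * meanCurv l x ν p :=
  mul_le_mul_of_newton (H := fun j => meanCurv j x ν p) hk (fun _ hj => h.pos hj p) fun j hj =>
    normSym_mul_le_sq (hx.posDef (mem_chart_source' p))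
      (hx.pairing_isHermitian (mem_chart_source' p)) j (by rw [Fintype.card_fin]; omega)

variable [CompactSpace M] [T2Space M]

theorem IsCapillary.surfaceIntegral_speed_mul {x ν : M → Amb n} (hx : IsCapillary θ x ν)
    {l k : ℕ} (h : StrictlyConvexOrder (l + 1) x ν) (hl : l < n) (hk : k ≤ l) :
    surfaceIntegral x (fun p => speed θ (l + 1) x ν p * meanCurv (k + 1) x ν p) =
      surfaceIntegral x fun p => tiltWeight θ ν p *
        ((meanCurv (k + 1) x ν p * meanCurv l x ν p - meanCurv k x ν p * meanCurv (l + 1) x ν p) /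
          meanCurv (l + 1) x ν p) := by
  have hl0 : ∀ p, meanCurv (l + 1) x ν p ≠ 0 := fun p => (h.pos le_rfl p).ne'
  have hl1 : ∀ p, meanCurv l x ν p ≠ 0 := fun p => (h.pos l.le_succ p).ne'
  have hH : ∀ {j}, j ≤ n → Continuous (meanCurv j x ν) := fun hj => hx.continuous_meanCurv hj
  have hkn : k + 1 ≤ n := by omega
  have hw := hx.continuous_tiltWeight
  have hi := hx.continuous_inner_normal
  have hf : Continuous fun p => speed θ (l + 1) x ν p * meanCurv (k + 1) x ν p := by
    refine Continuous.mul (Continuous.sub (Continuous.div hw ?_ fun p => ?_) hi) (hH hkn)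
    · exact (hH hl).div (hH hl.le) hl1
    · exact div_ne_zero (hl0 p) (hl1 p)
  have hφ : Continuous fun p => tiltWeight θ ν p *
        ((meanCurv (k + 1) x ν p * meanCurv l x ν p - meanCurv k x ν p * meanCurv (l + 1) x ν p) /
          meanCurv (l + 1) x ν p) :=
    hw.mul ((((hH hkn).mul (hH hl.le)).sub ((hH (by omega)).mul (hH hl))).div (hH hl) hl0)
  have h1 := surfaceIntegral_add hx hf ((hH hkn).mul hi)
  have h2 := surfaceIntegral_add hx hφ ((hH (j := k) (by omega)).mul hw)
  have h3 := hx.minkowski (k := k) (by omega)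
  rw [weightedCurv] at h3
  have h4 : ∀ p, speed θ (l + 1) x ν p * meanCurv (k + 1) x ν p +
      meanCurv (k + 1) x ν p * inner ℝ (x p) (ν p) = tiltWeight θ ν p *
        ((meanCurv (k + 1) x ν p * meanCurv l x ν p - meanCurv k x ν p * meanCurv (l + 1) x ν p) /
          meanCurv (l + 1) x ν p) + meanCurv k x ν p * tiltWeight θ ν p := by
    intro p
    have := hl0 p
    have := hl1 p
    rw [speed, Nat.add_sub_cancel, ← tiltWeight]
    field_simp
    ring
  change surfaceIntegral x (fun p => _ + meanCurv (k + 1) x ν p * inner ℝ (x p) (ν p)) =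
    _ + surfaceIntegral x (fun p => meanCurv (k + 1) x ν p * inner ℝ (x p) (ν p)) at h1
  change _ = _ + surfaceIntegral x (fun p => meanCurv k x ν p * tiltWeight θ ν p) at h2
  rw [funext h4] at h1
  have h5 := h1.symm.trans h2
  rw [h3] at h5
  exact add_right_cancel h5

variable {x ν : ℝ → M → Amb n} {T : EReal} {l : ℕ} {a b : ℝ}

theorem smoothFamily_of_contMDiffOn {g : ℝ → M → Amb n} {S : Set ℝ}
    (hg : ContMDiffOn ((𝓡∂ n).prod 𝓘(ℝ, ℝ)) 𝓘(ℝ, Amb n) ∞ (fun q : M × ℝ => g q.2 q.1)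
      (univ ×ˢ S)) (hS : Icc a b ⊆ S) : SmoothFamily a b g := by
  intro c
  rw [← contMDiffOn_iff_contDiffOn]
  have h1 : ContMDiffOn 𝓘(ℝ, EuclideanSpace ℝ (Fin n) × ℝ) (𝓡∂ n) ∞
      (fun z : EuclideanSpace ℝ (Fin n) × ℝ => (extChartAt (𝓡∂ n) c).symm z.1)
      ((extChartAt (𝓡∂ n) c).target ×ˢ Icc a b) :=
    (contMDiffOn_extChartAt_symm c).comp contDiff_fst.contMDiff.contMDiffOn fun z hz => hz.1
  have h2 : ContMDiffOn 𝓘(ℝ, EuclideanSpace ℝ (Fin n) × ℝ) 𝓘(ℝ, ℝ) ∞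
      (fun z : EuclideanSpace ℝ (Fin n) × ℝ => z.2)
      ((extChartAt (𝓡∂ n) c).target ×ˢ Icc a b) := contDiff_snd.contMDiff.contMDiffOn
  exact hg.comp (h1.prodMk h2) fun z hz => ⟨mem_univ _, hS hz.2⟩

theorem IsFlow.isCapillaryFamily (h : IsFlow θ l T x ν) (hab : a < b)
    (hS : Icc a b ⊆ timeInterval T) : IsCapillaryFamily θ a b x ν where
  lt := hab
  smooth := smoothFamily_of_contMDiffOn h.smooth hS
  smooth_normal := smoothFamily_of_contMDiffOn h.smooth_normal hS
  capillary t ht := h.capillary t (hS ht)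

theorem IsFlow.inner_velocity (h : IsFlow θ l T x ν) (hS : Icc a b ⊆ timeInterval T) {t : ℝ}
    (ht : t ∈ Ioo a b) (p : M) :
    inner ℝ (velocity a b x t p) (ν t p) = speed θ l (x t) (ν t) p := by
  have h1 := Icc_mem_nhds ht.1 ht.2
  rw [← h.normal_velocity t (hS (Ioo_subset_Icc_self ht)) p, velocity, derivWithin_of_mem_nhds h1,
    derivWithin_of_mem_nhds (Filter.mem_of_superset h1 hS)]

theorem IsFlow.hasDerivAt_weightedCurv (h : IsFlow θ (l + 1) T x ν) (hl : l < n)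
    (hS : Icc a b ⊆ timeInterval T)
    (hconv : ∀ t ∈ Icc a b, StrictlyConvexOrder (l + 1) (x t) (ν t)) {k : ℕ} (hk : k ≤ l) {t : ℝ}
    (ht : t ∈ Ioo a b) :
    HasDerivAt (fun t => weightedCurv θ k (x t) (ν t)) ((n - k) * surfaceIntegral (x t) fun p =>
      tiltWeight θ (ν t) p * ((meanCurv (k + 1) (x t) (ν t) p * meanCurv l (x t) (ν t) p -
        meanCurv k (x t) (ν t) p * meanCurv (l + 1) (x t) (ν t) p) /
          meanCurv (l + 1) (x t) (ν t) p)) t := by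
  have ht' := Ioo_subset_Icc_self ht
  have h1 := (h.isCapillaryFamily (ht.1.trans ht.2) hS).hasDerivAt_weightedCurv ht (k := k)
    (by omega)
  simp only [h.inner_velocity hS ht] at h1
  rwa [(h.capillary t (hS ht')).surfaceIntegral_speed_mul (hconv t ht') hl hk] at h1

variable {J : Set ℝ}

theorem IsFlow.monotoneOn_weightedCurv (h : IsFlow θ (l + 1) T x ν) (hl : l < n)
    (hJ : J.OrdConnected) (hJT : J ⊆ timeInterval T)
    (hconv : ∀ t ∈ J, StrictlyConvexOrder (l + 1) (x t) (ν t)) {k : ℕ} (hk : k ≤ l) :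
    MonotoneOn (fun t => weightedCurv θ k (x t) (ν t)) J := by
  intro a ha b hb hab
  rcases hab.eq_or_lt with rfl | hab
  · exact le_rfl
  have hS := hJ.out ha hb
  have hfam := h.isCapillaryFamily hab (hS.trans hJT)
  have hd := fun t (ht : t ∈ Ioo a b) => h.hasDerivAt_weightedCurv hl (hS.trans hJT)
    (fun t ht => hconv t (hS ht)) hk ht
  refine monotoneOn_of_deriv_nonneg (convex_Icc a b) (hfam.continuousOn_weightedCurv (by omega))
    (fun t ht => ?_) (fun t ht => ?_) (left_mem_Icc.2 hab.le) (right_mem_Icc.2 hab.le) hab.le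
  all_goals rw [interior_Icc] at ht
  · exact (hd t ht).differentiableAt.differentiableWithinAt
  · have ht' := Ioo_subset_Icc_self ht
    have hx := hfam.capillary t ht'
    have hc := hconv t (hS ht')
    rw [(hd t ht).deriv]
    refine mul_nonneg (sub_nonneg.2 ?_) (surfaceIntegral_nonneg fun p => ?_)
    · exact_mod_cast (hk.trans hl.le)
    · exact mul_nonneg (hx.tiltWeight_nonneg p)
        (div_nonneg (sub_nonneg.2 (hc.meanCurv_mul_le hx hl hk p)) (hc.pos le_rfl p).le)

theorem IsFlow.antitoneOn_weightedCurv (h : IsFlow θ (l + 1) T x ν) (hl : l < n)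
    (hJ : J.OrdConnected) (hJT : J ⊆ timeInterval T)
    (hconv : ∀ t ∈ J, StrictlyConvexOrder (l + 1) (x t) (ν t)) :
    AntitoneOn (fun t => weightedCurv θ l (x t) (ν t)) J := by
  intro a ha b hb hab
  rcases hab.eq_or_lt with rfl | hab
  · exact le_rfl
  have hS := hJ.out ha hb
  have hfam := h.isCapillaryFamily hab (hS.trans hJT)
  have hd := fun t (ht : t ∈ Ioo a b) => h.hasDerivAt_weightedCurv hl (hS.trans hJT)
    (fun t ht => hconv t (hS ht)) le_rfl ht
  refine antitoneOn_of_deriv_nonpos (convex_Icc a b) (hfam.continuousOn_weightedCurv hl.le)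
    (fun t ht => ?_) (fun t ht => ?_) (left_mem_Icc.2 hab.le) (right_mem_Icc.2 hab.le) hab.le
  all_goals rw [interior_Icc] at ht
  · exact (hd t ht).differentiableAt.differentiableWithinAt
  · rw [(hd t ht).deriv]
    simp only [mul_comm (meanCurv (l + 1) _ _ _), sub_self, zero_div, mul_zero]
    have := surfaceIntegral_const_mul (x := x t) 0 fun _ => 0
    simp only [zero_mul] at this
    rw [this, mul_zero]

theorem IsCapillary.quermass_succ {x ν : M → Amb n} (hx : IsCapillary θ x ν)
    (hθ : θ ∈ Ioo 0 Real.pi) {k : ℕ} (hk : k < n) :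
    quermass θ (k + 1) x ν = 1 / (n + 1) * weightedCurv θ k x ν := by
  rcases k with _ | k
  · exact hx.quermass_one
  · exact hx.quermass_add_two (Real.sin_pos_of_mem_Ioo hθ) (by omega)

end Flow

end CapillaryFlow

end

theorem proposition3p1 {n : ℕ} [NeZero n] {M : Type*} [TopologicalSpace M]
    [ChartedSpace (EuclideanHalfSpace n) M] [IsManifold (𝓡∂ n) ∞ M] [CompactSpace M] [T2Space M]
    (θ : ℝ) (hθ : θ ∈ Ioo 0 Real.pi) (l : ℕ) (hl : 1 ≤ l) (hln : l ≤ n)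
    (T : EReal) (x ν : ℝ → M → CapillaryFlow.Amb n) (hflow : CapillaryFlow.IsFlow θ l T x ν)
    (J : Set ℝ) (hJ : J.OrdConnected) (hJT : J ⊆ CapillaryFlow.timeInterval T)
    (hconv : ∀ t ∈ J, CapillaryFlow.StrictlyConvexOrder l (x t) (ν t)) :
    (∀ s ∈ J, ∀ t ∈ J,
      CapillaryFlow.quermass θ l (x s) (ν s) = CapillaryFlow.quermass θ l (x t) (ν t)) ∧
    (∀ k, 1 ≤ k → k < l →
      MonotoneOn (fun t => CapillaryFlow.quermass θ k (x t) (ν t)) J) := by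
  obtain ⟨l, rfl⟩ := Nat.exists_eq_succ_of_ne_zero (by omega : l ≠ 0)
  have hmono : ∀ k ≤ l, MonotoneOn (fun t => CapillaryFlow.weightedCurv θ k (x t) (ν t)) J :=
    fun k hk => hflow.monotoneOn_weightedCurv hln hJ hJT hconv hk
  have hanti := hflow.antitoneOn_weightedCurv hln hJ hJT hconv
  have hq : ∀ k ≤ l, ∀ t ∈ J, CapillaryFlow.quermass θ (k + 1) (x t) (ν t) =
      1 / (n + 1) * CapillaryFlow.weightedCurv θ k (x t) (ν t) := fun k hk t ht =>
    (hflow.capillary t (hJT ht)).quermass_succ hθ (by omega)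
  refine ⟨fun s hs t ht => ?_, fun k hk hkl s hs t ht hst => ?_⟩
  · rw [Nat.succ_eq_add_one, hq l le_rfl s hs, hq l le_rfl t ht]
    congr 1
    rcases le_total s t with h | h
    · exact le_antisymm (hmono l le_rfl hs ht h) (hanti hs ht h)
    · exact le_antisymm (hanti ht hs h) (hmono l le_rfl ht hs h)
  · obtain ⟨k, rfl⟩ := Nat.exists_eq_succ_of_ne_zero (by omega : k ≠ 0)
    simp only [Nat.succ_eq_add_one]
    rw [hq k (by omega) s hs, hq k (by omega) t ht]
    exact mul_le_mul_of_nonneg_left (hmono k (by omega) hs ht hst) (by positivity)
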